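/- \textbf{Setting.} Work in $\mathbb{R}^p$ with the Euclidean inner product and norm. Let $F:\mathbb{R}^p\to\mathbb{R}^p$ be single-valued and $T:\mathbb{R}^p\rightrightarrows 2^{\mathbb{R}^p}$ set-valued, and consider the inclusion $0\in Fx+Tx$. Assume: (i) there is a solution $x^\star$, i.e. $0\in Fx^\star+Tx^\star$; (ii) $F$ has a (jointly measurable) unbiased stochastic oracle $\mathbf{F}(\cdot,\xi)$ with bounded variance: $Fx=\mathbb{E}_\xi[\mathbf{F}(x,\xi)]$ and $\mathbb{E}_\xi\|\mathbf{F}(x,\xi)-Fx\|^2\le\sigma^2$ for all $x$, where $\sigma\ge 0$; (iii) $T$ is maximally $\rho$-co-hypomonotone for some $\rho\ge0$: $\langle u-v,x-y\rangle\ge-\rho\|u-v\|^2$ for all $(x,u),(y,v)\in\operatorname{gra}T$, and $\operatorname{gra}T$ is not properly contained in the graph of another operator with this property; (iv) $F$ is $\frac1L$-co-coercive in expectation for some $L>0$: $\langle Fx-Fy,x-y\rangle\ge\frac1L\mathbb{E}_\xi\|\mathbf{F}(x,\xi)-\mathbf{F}(y,\xi)\|^2$ for all $x,y$. \textbf{Parameters.}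 Let $\hat L>L$ with $\hat L\rho<1$, and put $\Lambda:=\frac{\hat L-L}{L\hat L}$. Choose $\lambda>0$ with $2\rho\le\lambda<\frac{2(1+\sqrt{1-\hat L\rho})}{\hat L}$, and put $\bar\beta:=\frac{\lambda(4-\hat L\lambda)-4\rho}{4(1-\rho\hat L)}$. Choose $0<\mu<\frac23$, $r>5+\frac1\mu$ and $0<\beta\le\frac{(2-\mu)\bar\beta}{2+\mu}$, and put $\nu:=\frac\mu2$, $t_k:=\mu(k+r)$, $\eta_k:=\frac{2\beta(t_k-1)}{t_k-\nu}$. Let $J_{\lambda T}$ be the resolvent of $\lambda T$ (so that $w=J_{\lambda T}x$ iff $x\in w+\lambda Tw$) and $$G_\lambda x:=\tfrac1\lambda\big(x-J_{\lambda T}(x-\lambda Fx)\big).$$ For an initial point $x^0$ with $Tx^0\ne\emptyset$, let $\Psi_0\ge0$ be given by $$\Psi_0^2:=\mu^2r^2\|G_\lambda x^0\|^2+\frac{2r-1}{4\beta^2(\mu r-1)}\|x^0-x^\star\|^2 .$$ Let $c_b:=\frac{10\beta}{\mu\Lambda}$ and $c_n:=12\sigma^2\max\{1,\frac{2\sqrt2\,\Psi_0}{\mu^2}\}$.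 For $\epsilon\in\big(0,\frac{\mu(r-5)-1}{2\mu(r-1)-2}\big]$ let $$b:=\Big\lfloor\frac{c_b}{\epsilon^2}\Big\rfloor,\qquad n:=\Big\lfloor\frac{c_n}{\epsilon^3}\Big\rfloor,\qquad \mathbf{p}_k:=2\epsilon+\frac{4\mu}{\mu(k+r-1)-1},$$ and assume that neither batch is empty, i.e. $b\ge1$ and $n\ge1$. \textbf{Algorithm (VFOSA$_+$ with the loopless-SVRG estimator).} Set $z^0:=x^0$ and $\tilde x^0:=x^0$, and evaluate the mega-batch average $\bar F\tilde x^0:=\frac1n\sum_{\xi\in\bar{\mathcal S}_0}\mathbf{F}(x^0,\xi)$. At iteration $k\ge1$, with probability $\mathbf{p}_k$ set $\tilde x^k:=x^{k-1}$ and evaluate $\bar F\tilde x^k:=\frac1n\sum_{\xi\in\bar{\mathcal S}_k}\mathbf{F}(x^{k-1},\xi)$ on a fresh mega-batch $\bar{\mathcal S}_k$ of size $n$; otherwise keep $\tilde x^k:=\tilde x^{k-1}$ and the stored value $\bar F\tilde x^k:=\bar F\tilde x^{k-1}$. At every iteration $k\ge0$, draw a fresh mini-batch $\mathcal S_k$ of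 size $b$ and set $$\widetilde F^k:=\bar F\tilde x^k+\frac1b\sum_{\xi\in\mathcal S_k}\big(\mathbf{F}(x^k,\xi)-\mathbf{F}(\tilde x^k,\xi)\big),\qquad \widetilde G^k:=\tfrac1\lambda\big(x^k-J_{\lambda T}(x^k-\lambda\widetilde F^k)\big),$$ $$y^k:=\tfrac{t_k-1}{t_k}x^k+\tfrac1{t_k}z^k,\qquad x^{k+1}:=y^k-\eta_k\widetilde G^k,\qquad z^{k+1}:=z^k+\nu(x^{k+1}-y^k).$$ All samples are i.i.d. copies of $\xi$, and all samples and all coins are independent. \textbf{Claim.} There is a constant $C$, depending only on $L,\hat L,\rho,\lambda,\mu,r,\beta,\sigma,\Psi_0$ and in particular not on $\epsilon$, such that for every $\epsilon$ as above there is a number of iterations $K$ with $$\mathbb{E}\|G_\lambda x^K\|^2\le\epsilon^2,$$ and the expected total number $\bar{\mathcal T}_K$ of evaluations of the oracle $\mathbf{F}(\cdot,\xi)$ and of the resolvent $J_{\lambda T}$ made to compute $x^K$ satisfies $$\bar{\mathcal T}_K\le C\big(\epsilon^{-3}+\epsilon^{-3}\ln(\epsilon^{-1})\big).$$ -/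

import Mathlib

open MeasureTheory ProbabilityTheory

noncomputable section

namespace VFOSA

/-- `ℝ^p` with its Euclidean norm and inner product. -/
abbrev Vec (p : ℕ) : Type := EuclideanSpace ℝ (Fin p)

/-! ### Set-valued operators, resolvents and the forward-backward splitting residual -/

/-- `T` is `ρ`-co-hypomonotone: `⟨u - v, x - y⟩ ≥ -ρ ‖u - v‖²` for all `(x, u), (y, v) ∈ gra T`. -/
def CoHypomonotone {p : ℕ} (ρ : ℝ) (T : Vec p → Set (Vec p)) : Prop :=
  ∀ x y u v : Vec p, u ∈ T x → v ∈ T y → inner ℝ (u - v) (x - y) ≥ -ρ * ‖u - v‖ ^ 2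

/-- `T` is maximally `ρ`-co-hypomonotone: its graph is not properly contained in the graph of
another `ρ`-co-hypomonotone operator. -/
def MaximallyCoHypomonotone {p : ℕ} (ρ : ℝ) (T : Vec p → Set (Vec p)) : Prop :=
  CoHypomonotone ρ T ∧
    ∀ T' : Vec p → Set (Vec p), CoHypomonotone ρ T' → (∀ x, T x ⊆ T' x) → T' = T

/-- The solutions of `0 ∈ F x + T x`. -/
def zer {p : ℕ} (F : Vec p → Vec p) (T : Vec p → Set (Vec p)) : Set (Vec p) :=
  {x | ∃ u ∈ T x, F x + u = 0}

/-- The resolvent of `lam • T` as a set-valued map: all `w` with `x ∈ w + lam • T w`. -/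
def resolventSet {p : ℕ} (lam : ℝ) (T : Vec p → Set (Vec p)) (x : Vec p) : Set (Vec p) :=
  {w | ∃ u ∈ T w, x = w + lam • u}

/-- The resolvent `J_{lam T}` as a single-valued map: the element of `resolventSet lam T x`. -/
def resolvent {p : ℕ} (lam : ℝ) (T : Vec p → Set (Vec p)) (x : Vec p) : Vec p :=
  Classical.epsilon fun w => w ∈ resolventSet lam T x

/-- The forward-backward splitting residual
`G_lam x = (1 / lam) (x - J_{lam T} (x - lam F x))`. -/
def fbsResidual {p : ℕ} (lam : ℝ) (F : Vec p → Vec p) (T : Vec p → Set (Vec p)) (x : Vec p) :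
    Vec p :=
  (1 / lam) • (x - resolvent lam T (x - lam • F x))

/-! ### The stochastic oracle -/

/-- `Fo` is an unbiased stochastic oracle for `F` under the law `P` of the random variable `ξ`,
with variance at most `σ ^ 2`. -/
structure IsUnbiasedOracle {p : ℕ} {Ξ : Type*} [MeasurableSpace Ξ] (P : Measure Ξ)
    (F : Vec p → Vec p) (Fo : Vec p → Ξ → Vec p) (σ : ℝ) : Prop where
  measurable : Measurable fun q : Vec p × Ξ => Fo q.1 q.2
  integrable : ∀ x, Integrable (Fo x) P
  unbiased : ∀ x, ∫ s, Fo x s ∂P = F x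
  integrable_sq : ∀ x, Integrable (fun s => ‖Fo x s - F x‖ ^ 2) P
  variance_le : ∀ x, ∫ s, ‖Fo x s - F x‖ ^ 2 ∂P ≤ σ ^ 2

/-- `F` is `1 / L`-co-coercive in expectation with respect to the oracle `Fo`. -/
def CocoerciveInExpectation {p : ℕ} {Ξ : Type*} [MeasurableSpace Ξ] (P : Measure Ξ)
    (F : Vec p → Vec p) (Fo : Vec p → Ξ → Vec p) (L : ℝ) : Prop :=
  ∀ x y, inner ℝ (F x - F y) (x - y) ≥ (1 / L) * ∫ s, ‖Fo x s - Fo y s‖ ^ 2 ∂P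

/-- The average of the oracle at `x` over a sample `S` of size `m`. -/
def batchMean {p m : ℕ} {Ξ : Type*} (Fo : Vec p → Ξ → Vec p) (x : Vec p) (S : Fin m → Ξ) :
    Vec p :=
  (1 / (m : ℝ)) • ∑ i, Fo x (S i)

/-! ### Constants and parameters -/

/-- `bar β = (lam (4 - Lhat lam) - 4 ρ) / (4 (1 - ρ Lhat))`. -/
def betaBar (Lhat ρ lam : ℝ) : ℝ := (lam * (4 - Lhat * lam) - 4 * ρ) / (4 * (1 - ρ * Lhat))

/-- `Λ = (Lhat - L) / (L Lhat)`. -/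
def Lam (L Lhat : ℝ) : ℝ := (Lhat - L) / (L * Lhat)

/-- `t_k = μ (k + r)`. -/
def tSeq (μ r : ℝ) (k : ℕ) : ℝ := μ * ((k : ℝ) + r)

/-- `η_k = 2 β (t_k - 1) / (t_k - ν)` with `ν = μ / 2`. -/
def etaSeq (μ r β : ℝ) (k : ℕ) : ℝ := 2 * β * (tSeq μ r k - 1) / (tSeq μ r k - μ / 2)

/-- The snapshot probability `p_k = 2 ε + 4 μ / (μ (k + r - 1) - 1)`. -/
def snapProb (μ r ε : ℝ) (k : ℕ) : ℝ := 2 * ε + 4 * μ / (μ * ((k : ℝ) + r - 1) - 1)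

/-- `Ψ₀`, the nonnegative number with
`Ψ₀² = μ² r² ‖G_lam x⁰‖² + (2 r - 1) / (4 β² (μ r - 1)) ‖x⁰ - x*‖²`. -/
def psi0 {p : ℕ} (F : Vec p → Vec p) (T : Vec p → Set (Vec p)) (lam μ r β : ℝ)
    (x0 xstar : Vec p) : ℝ :=
  Real.sqrt (μ ^ 2 * r ^ 2 * ‖fbsResidual lam F T x0‖ ^ 2 +
    (2 * r - 1) / (4 * β ^ 2 * (μ * r - 1)) * ‖x0 - xstar‖ ^ 2)

/-- `c_b = 10 β / (μ Λ)`. -/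
def cb (L Lhat μ β : ℝ) : ℝ := 10 * β / (μ * Lam L Lhat)

/-- `c_n = 12 σ² max {1, 2 √2 Ψ₀ / μ²}`. -/
def cn (σ μ Ψ : ℝ) : ℝ := 12 * σ ^ 2 * max 1 (2 * Real.sqrt 2 * Ψ / μ ^ 2)

/-! ### The randomness of one iteration -/

/-- The randomness of one iteration: a mini-batch of size `b`, a mega-batch of size `n`
and a coin. -/
abbrev Draw (Ξ : Type*) (b n : ℕ) : Type _ := (Fin b → Ξ) × (Fin n → Ξ) × Bool

/-- The law of a coin that shows `true` with probability `q`. -/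
def coinLaw (q : ℝ) : Measure Bool :=
  ENNReal.ofReal q • Measure.dirac true + ENNReal.ofReal (1 - q) • Measure.dirac false

/-- Both batches are i.i.d. samples from `P`; the batches and the coin are independent. -/
def drawLaw {Ξ : Type*} [MeasurableSpace Ξ] (P : Measure Ξ) (b n : ℕ) (q : ℝ) :
    Measure (Draw Ξ b n) :=
  (Measure.pi fun _ => P).prod ((Measure.pi fun _ => P).prod (coinLaw q))

/-! ### The algorithm, together with a counter for its calls -/

/-- The memory of the method at the start of iteration `k`. -/
structure State (p : ℕ) where
  /-- `x^k` -/
  x : Vec p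
  /-- `z^k` -/
  z : Vec p
  /-- `x^{k-1}`, with `x^{-1} = x^0` -/
  xprev : Vec p
  /-- the snapshot point of the previous iteration -/
  snap : Vec p
  /-- the stored mega-batch average of the oracle at the snapshot point -/
  anchor : Vec p
  /-- the number of evaluations of the oracle and of the resolvent made so far -/
  calls : ℕ

/-- The state before iteration `0`; nothing has been evaluated, so `anchor` is a placeholder that
iteration `0` overwrites. -/
def initState {p : ℕ} (x0 : Vec p) : State p where
  x := x0
  z := x0
  xprev := x0
  snap := x0
  anchor := 0
  calls := 0

/-- Iteration `k`. The snapshot is reset to `x^{k-1}` if the coin shows `true`, and the mega-batch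
average is then evaluated there (`n` oracle calls); otherwise both are kept. In iteration `0` the
snapshot is `x^0` and the mega-batch average is evaluated in any case. The mini-batch is evaluated
at `x^k` and at the snapshot (`2 b` oracle calls), and the resolvent is evaluated once. -/
def step {p b n : ℕ} {Ξ : Type*} (Fo : Vec p → Ξ → Vec p) (T : Vec p → Set (Vec p))
    (lam μ r β : ℝ) (k : ℕ) (d : Draw Ξ b n) (s : State p) : State p :=
  let refresh : Bool := decide (k = 0) || d.2.2
  let snap : Vec p := if refresh then s.xprev else s.snap
  let anchor : Vec p := if refresh then batchMean Fo snap d.2.1 else s.anchor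
  let Ftilde : Vec p := anchor + batchMean Fo s.x d.1 - batchMean Fo snap d.1
  let t : ℝ := tSeq μ r k
  let y : Vec p := ((t - 1) / t) • s.x + (1 / t) • s.z
  let Gtilde : Vec p := (1 / lam) • (s.x - resolvent lam T (s.x - lam • Ftilde))
  let xnew : Vec p := y - etaSeq μ r β k • Gtilde
  { x := xnew
    z := s.z + (μ / 2) • (xnew - y)
    xprev := s.x
    snap := snap
    anchor := anchor
    calls := s.calls + (if refresh then n else 0) + 2 * b + 1 }

/-- The state before iteration `k` when iteration `j` uses the randomness `d j`. -/
def run {p b n : ℕ} {Ξ : Type*} (Fo : Vec p → Ξ → Vec p) (T : Vec p → Set (Vec p))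
    (lam μ r β : ℝ) (x0 : Vec p) (d : ℕ → Draw Ξ b n) : ℕ → State p
  | 0 => initState x0
  | k + 1 => step Fo T lam μ r β k (d k) (run Fo T lam μ r β x0 d k)

end VFOSA

end

/-!
The residual `G = fbsResidual lam F T` vanishes at the solutions and is co-coercive: the resolvent
of a maximally co-hypomonotone `T` is everywhere defined and nonexpansive for `2 ρ ≤ lam`, by
Minty's theorem (`resolventSet_nonempty`), and a completed square transfers the co-coercivity of `F`
to `G` (`fbsResidual_cocoercive`), with an additional multiple of the mean squared difference of the
oracle at the two points (`oracleGap`). The method is thus an accelerated method for `G x = 0`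
whose residuals carry an error that is at most the error of the gradient estimate
(`norm_residual_error_le`).

Two functions of the state are followed. The Lyapunov function
`V_k = β (t_k - μ) (t_k - μ - 1) ‖G x_k‖² + (t_k - μ) ⟪G x_k, x_k - z_k⟫ + c_k ‖z_k - x*‖²`
increases in one step by at most a multiple of `t_k (t_k - 1)` times the squared error of the estimate, and
it even decreases by `Λ t_k (t_k - 1)` times the oracle gap of the move from `x_k` to `x_{k + 1}`
(`potential_step`). Alone, `V_k` controls `t_k² ‖G x_k‖²` only with a constant that degenerates as
`μ → 2 / 3`, whereas the batch sizes are fixed in advance. The second function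
`Z_k = ‖z_k - x*‖² / (2 β η_k)` is therefore bounded as well, since each step moves it towards
`V_k / β` (`anchorEnergy_step`), and `V_k` and `Z_k` together control the residual uniformly
(`sq_norm_residual_le`).

The expected squared error of the loopless-SVRG estimate is at most `σ² / n` for the mega-batch plus
`1 / b` times the gap between the iterate and the snapshot. This gap contracts by the factor
`1 - p_k / 2` in each iteration, up to `2 / p_k` times the last move
(`Setting.lintegral_snapGap_le`); the two summands of `p_k` make the weighted sum of the gaps at
most `ε⁻²` times the weighted sum of the moves (`sum_snapshot_le`), and with `b ≥ c_b / (2 ε²)` the moves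
are paid for by the decrease of `V_k` (`lyapunov_sum_le`). There remains
`(t_K - μ)² 𝔼 ‖G x_K‖² ≤ 4 Ψ² + (8 / (3 μ²)) (σ² / n) (t_K - μ)³`
(`Setting.lintegral_sq_norm_residual_le`), which is at most `(t_K - μ)² ε²` as soon as `t_K - μ`
lies between `3 Ψ / ε` and `4 Ψ / ε` (`accuracy_le`).

The expected number of calls is at most `n (1 + ∑ p_k) + (2 b + 1) K`, where `∑ p_k` is at most `2 ε K` plus
a harmonic sum, which is the source of the logarithm (`integral_calls_le`, `calls_bound_le`).
-/

namespace VFOSA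

/-! ### Resolvents of co-hypomonotone operators -/

/-- The finite case of Minty's theorem. A saddle point of
`(u, w) ↦ ∑ i, w i * ⟪c u + b i - x, u - v i⟫` over the convex hull of the `v i` and the standard
simplex gives `u`: at the barycenter of the `v i` with weights `w`, monotonicity makes the value
nonpositive. -/
lemma exists_forall_inner_nonpos_of_finite {E ι : Type*} [NormedAddCommGroup E]
    [InnerProductSpace ℝ E] [Finite ι] (c : ℝ) (hc : 0 ≤ c) (x : E) (v b : ι → E)
    (hmono : ∀ i j, 0 ≤ inner ℝ (b i - b j) (v i - v j)) :
    ∃ u : E, ∀ i, inner ℝ (c • u + b i - x) (u - v i) ≤ 0 := by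
  classical
  cases nonempty_fintype ι
  rcases isEmpty_or_nonempty ι with hι | hι
  · exact ⟨0, fun i => hι.elim i⟩
  let f : E → (ι → ℝ) → ℝ := fun u w => ∑ i, w i * inner ℝ (c • u + b i - x) (u - v i)
  have hcont : ∀ w, Continuous fun u => f u w := by
    intro w; simp only [f]; fun_prop
  have hcont' : ∀ u, Continuous fun w => f u w := by
    intro u; simp only [f]; fun_prop
  have hconv : ∀ i, ConvexOn ℝ Set.univ
      (fun u : E => (inner ℝ (c • u + b i - x) (u - v i) : ℝ)) := by
    intro i
    refine ⟨convex_univ, fun p _ q _ s t hs ht hst => ?_⟩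
    have ht' : t = 1 - s := by linarith
    subst ht'
    have h0 : 0 ≤ s * (1 - s) * (c * ‖p - q‖ ^ 2) := by positivity
    rw [← real_inner_self_eq_norm_sq] at h0
    simp only [inner_add_left, inner_sub_left, inner_sub_right, inner_add_right,
      real_inner_smul_left, real_inner_smul_right, smul_eq_mul] at h0 ⊢
    rw [real_inner_comm p q] at *
    nlinarith [h0]
  obtain ⟨a, -, w, hw, hsad⟩ := Sion.exists_isSaddlePointOn (f := f)
    (X := convexHull ℝ (Set.range v)) (Y := stdSimplex ℝ ι)
    ((Set.range_nonempty v).convexHull) (convex_convexHull ℝ _)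
    ((Set.finite_range v).isCompact_convexHull ℝ)
    (fun w _ => (hcont w).lowerSemicontinuous.lowerSemicontinuousOn _)
    (fun w hw => by
      refine ConvexOn.quasiconvexOn ?_
      have : ConvexOn ℝ (Set.univ : Set E) (fun u => f u w) := by
        have e : (fun u => f u w)
            = ∑ i, fun u : E => w i • (inner ℝ (c • u + b i - x) (u - v i) : ℝ) := by
          ext u; simp [f, Finset.sum_apply]
        rw [e]
        exact Finset.sum_induction _ (ConvexOn ℝ Set.univ) (fun _ _ ha hb => ha.add hb)
          (convexOn_const 0 convex_univ) fun i _ => (hconv i).smul (hw.1 i)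
      exact this.subset (Set.subset_univ _) (convex_convexHull ℝ _))
    (convex_stdSimplex ℝ ι) ⟨_, single_mem_stdSimplex ℝ (Classical.arbitrary ι)⟩
    (isCompact_stdSimplex ℝ ι)
    (fun u _ => (hcont' u).upperSemicontinuous.upperSemicontinuousOn _)
    (fun u _ => by
      refine ConcaveOn.quasiconcaveOn ⟨convex_stdSimplex ℝ ι, fun p _ q _ s t _ _ _ => ?_⟩
      simp only [f, smul_eq_mul, Pi.add_apply, Pi.smul_apply, Finset.mul_sum,
        ← Finset.sum_add_distrib]
      exact le_of_eq (Finset.sum_congr rfl fun i _ => by ring))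
  refine ⟨a, fun i => ?_⟩
  have hbary : ∑ j, w j • v j ∈ convexHull ℝ (Set.range v) :=
    (convex_convexHull ℝ _).sum_mem (fun j _ => hw.1 j) hw.2
      fun j _ => subset_convexHull ℝ _ ⟨j, rfl⟩
  have h1 := hsad _ hbary _ (single_mem_stdSimplex ℝ i)
  have h2 : f a (Pi.single i 1) = inner ℝ (c • a + b i - x) (a - v i) := by
    simp [f, Pi.single_apply]
  rw [h2] at h1
  refine h1.trans ?_
  set u := ∑ j, w j • v j with hu
  have hz : ∑ i, w i • (u - v i) = 0 := by
    simp only [smul_sub, Finset.sum_sub_distrib, ← Finset.sum_smul, hw.2, one_smul, hu, sub_self]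
  have h3 : f u w = ∑ i, w i * inner ℝ (b i) (u - v i) := by
    have : f u w = inner ℝ (c • u - x) (∑ i, w i • (u - v i))
        + ∑ i, w i * inner ℝ (b i) (u - v i) := by
      rw [inner_sum, ← Finset.sum_add_distrib]
      refine Finset.sum_congr rfl fun i _ => ?_
      rw [real_inner_smul_right, ← mul_add, ← inner_add_left]
      congr 2; abel
    rw [this, hz, inner_zero_right, zero_add]
  have h4 : ∀ i, u - v i = ∑ j, w j • (v j - v i) := by
    intro i
    simp only [smul_sub, Finset.sum_sub_distrib, ← Finset.sum_smul, hw.2, one_smul, hu]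
  have h5 : f u w = ∑ i, ∑ j, w i * w j * inner ℝ (b i) (v j - v i) := by
    rw [h3]
    refine Finset.sum_congr rfl fun i _ => ?_
    rw [h4 i, inner_sum, Finset.mul_sum]
    refine Finset.sum_congr rfl fun j _ => ?_
    rw [real_inner_smul_right]; ring
  have h6 : f u w = ∑ i, ∑ j, w i * w j * inner ℝ (b j) (v i - v j) := by
    rw [h5, Finset.sum_comm]
    refine Finset.sum_congr rfl fun i _ => Finset.sum_congr rfl fun j _ => by ring
  have h7 : f u w + f u w = -∑ i, ∑ j, w i * w j * inner ℝ (b i - b j) (v i - v j) := by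
    nth_rewrite 1 [h5]
    rw [h6, ← Finset.sum_add_distrib, ← Finset.sum_neg_distrib]
    refine Finset.sum_congr rfl fun i _ => ?_
    rw [← Finset.sum_add_distrib, ← Finset.sum_neg_distrib]
    refine Finset.sum_congr rfl fun j _ => ?_
    rw [inner_sub_left, ← neg_sub (v i) (v j), inner_neg_right]; ring
  have h8 : 0 ≤ ∑ i, ∑ j, w i * w j * inner ℝ (b i - b j) (v i - v j) :=
    Finset.sum_nonneg fun i _ => Finset.sum_nonneg fun j _ =>
      mul_nonneg (mul_nonneg (hw.1 i) (hw.1 j)) (hmono i j)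
  linarith

/-- Minty's theorem, up to maximality: for a monotone graph `A` and `c > 0` there is `u` such that
`(u, x - c u)` is monotonically related to every point of `A`. The sets of admissible `u` are
closed balls, so compactness reduces the claim to finite subsets of `A`. -/
lemma exists_forall_inner_nonpos {E : Type*} [NormedAddCommGroup E]
    [InnerProductSpace ℝ E] [FiniteDimensional ℝ E] (c : ℝ) (hc : 0 < c) (x : E)
    (A : Set (E × E))
    (hmono : ∀ p ∈ A, ∀ q ∈ A, 0 ≤ inner ℝ (p.2 - q.2) (p.1 - q.1)) :
    ∃ u : E, ∀ p ∈ A, inner ℝ (c • u + p.2 - x) (u - p.1) ≤ 0 := by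
  classical
  rcases A.eq_empty_or_nonempty with rfl | ⟨p0, hp0⟩
  · exact ⟨0, by simp⟩
  let K : A → Set E := fun p => {u | inner ℝ (c • u + p.1.2 - x) (u - p.1.1) ≤ 0}
  have hclosed : ∀ p, IsClosed (K p) := fun p =>
    isClosed_le (by fun_prop) continuous_const
  have hcomp : IsCompact (K ⟨p0, hp0⟩) := by
    refine Metric.isCompact_of_isClosed_isBounded (hclosed _) ?_
    refine (Metric.isBounded_closedBall (x := p0.1)
      (r := ‖x - p0.2 - c • p0.1‖ / c)).subset fun u hu => ?_
    have hu : inner ℝ (c • u + p0.2 - x) (u - p0.1) ≤ 0 := hu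
    rw [mem_closedBall_iff_norm, le_div_iff₀ hc]
    have h1 : c • u + p0.2 - x = c • (u - p0.1) - (x - p0.2 - c • p0.1) := by
      rw [smul_sub]; abel
    rw [h1, inner_sub_left, real_inner_smul_left, real_inner_self_eq_norm_sq] at hu
    have h2 := real_inner_le_norm (x - p0.2 - c • p0.1) (u - p0.1)
    rcases (norm_nonneg (u - p0.1)).eq_or_lt with h3 | h3
    · rw [← h3, zero_mul]; exact norm_nonneg _
    · nlinarith
  obtain ⟨u, -, hu⟩ := hcomp.inter_iInter_nonempty K hclosed (fun s => by
    obtain ⟨u, hu⟩ := exists_forall_inner_nonpos_of_finite (ι := ↥(insert ⟨p0, hp0⟩ s)) c hc.le x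
      (fun i => i.1.1.1) (fun i => i.1.1.2) fun i j => hmono _ i.1.2 _ j.1.2
    refine ⟨u, hu ⟨_, Finset.mem_insert_self _ _⟩, ?_⟩
    simp only [Set.mem_iInter]
    exact fun i hi => hu ⟨i, Finset.mem_insert_of_mem hi⟩)
  exact ⟨u, fun p hp => Set.mem_iInter.1 hu ⟨p, hp⟩⟩

variable {p : ℕ}

lemma resolventSet_nonempty {ρ lam : ℝ} {T : Vec p → Set (Vec p)}
    (hT : MaximallyCoHypomonotone ρ T) (hlam : ρ < lam) (x : Vec p) :
    (resolventSet lam T x).Nonempty := by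
  obtain ⟨hmono, hmax⟩ := hT
  -- `T⁻¹ + ρ I` is monotone, and `lam T` inherits the surjectivity of `T⁻¹ + ρ I + (lam - ρ) I`.
  obtain ⟨u, hu⟩ := exists_forall_inner_nonpos (lam - ρ) (sub_pos.2 hlam) x
    {q : Vec p × Vec p | ∃ w, q.1 ∈ T w ∧ q.2 = w + ρ • q.1} (by
      rintro ⟨u, s⟩ ⟨w, hw, hs⟩ ⟨u', s'⟩ ⟨w', hw', hs'⟩
      have := hmono w w' u u' hw hw'
      simp only at hs hs'
      rw [hs, hs']
      have h1 : w + ρ • u - (w' + ρ • u') = (w - w') + ρ • (u - u') := by rw [smul_sub]; abel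
      simp only
      rw [h1, inner_add_left, real_inner_smul_left, real_inner_self_eq_norm_sq,
        real_inner_comm]
      linarith)
  set w := x - lam • u with hw
  have key : ∀ w' u', u' ∈ T w' → inner ℝ (u - u') (w - w') ≥ -ρ * ‖u - u'‖ ^ 2 := by
    intro w' u' h
    have h1 := hu (u', w' + ρ • u') ⟨w', h, rfl⟩
    have h2 : (lam - ρ) • u + (w' + ρ • u') - x = -((w - w') + ρ • (u - u')) := by
      rw [hw, smul_sub, sub_smul]; abel
    simp only at h1
    rw [h2, inner_neg_left, inner_add_left, real_inner_smul_left, real_inner_self_eq_norm_sq,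
      real_inner_comm] at h1
    linarith
  have hT' := hmax (fun y => {v | v ∈ T y ∨ (y = w ∧ v = u)}) (by
    rintro y y' v v' (hv | ⟨rfl, rfl⟩) (hv' | ⟨rfl, rfl⟩)
    · exact hmono _ _ _ _ hv hv'
    · have := key y v hv
      rwa [← neg_sub v, ← neg_sub y, inner_neg_neg, norm_neg] at this
    · exact key _ _ hv'
    · simp) (fun y v hv => Or.inl hv)
  refine ⟨w, u, ?_, by rw [hw]; abel⟩
  rw [← hT']
  exact Or.inr ⟨rfl, rfl⟩

lemma exists_resolvent_spec {ρ lam : ℝ} {T : Vec p → Set (Vec p)}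
    (hT : MaximallyCoHypomonotone ρ T) (hlam : ρ < lam) (x : Vec p) :
    ∃ u ∈ T (resolvent lam T x), x = resolvent lam T x + lam • u :=
  Classical.epsilon_spec (resolventSet_nonempty hT hlam x)

lemma norm_sub_le_of_mem_resolventSet {ρ lam : ℝ} {T : Vec p → Set (Vec p)}
    (hT : CoHypomonotone ρ T) (hlam0 : 0 ≤ lam) (hlam : 2 * ρ ≤ lam) {x y w w' : Vec p}
    (hw : w ∈ resolventSet lam T x) (hw' : w' ∈ resolventSet lam T y) :
    ‖w - w'‖ ≤ ‖x - y‖ := by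
  obtain ⟨u, hu, rfl⟩ := hw
  obtain ⟨u', hu', rfl⟩ := hw'
  have h := hT _ _ _ _ hu hu'
  refine le_of_sq_le_sq ?_ (norm_nonneg _)
  have h1 : w + lam • u - (w' + lam • u') = (w - w') + lam • (u - u') := by rw [smul_sub]; abel
  rw [h1, norm_add_sq_real, real_inner_smul_right, norm_smul, mul_pow, Real.norm_eq_abs, sq_abs,
    real_inner_comm]
  nlinarith [sq_nonneg ‖u - u'‖, mul_nonneg hlam0 (sub_nonneg.2 hlam),
    mul_nonneg (mul_nonneg hlam0 (sub_nonneg.2 hlam)) (sq_nonneg ‖u - u'‖)]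

lemma norm_resolvent_sub_le {ρ lam : ℝ} {T : Vec p → Set (Vec p)}
    (hT : MaximallyCoHypomonotone ρ T) (hlam0 : 0 < lam) (hlam : 2 * ρ ≤ lam)
    (x y : Vec p) : ‖resolvent lam T x - resolvent lam T y‖ ≤ ‖x - y‖ := by
  have h : ρ < lam := by linarith
  exact norm_sub_le_of_mem_resolventSet hT.1 hlam0.le hlam (exists_resolvent_spec hT h x)
    (exists_resolvent_spec hT h y)

lemma resolvent_eq_of_mem {ρ lam : ℝ} {T : Vec p → Set (Vec p)}
    (hT : MaximallyCoHypomonotone ρ T) (hlam0 : 0 < lam) (hlam : 2 * ρ ≤ lam)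
    {x w : Vec p} (hw : w ∈ resolventSet lam T x) : resolvent lam T x = w := by
  have h : ρ < lam := by linarith
  have := norm_sub_le_of_mem_resolventSet hT.1 hlam0.le hlam (exists_resolvent_spec hT h x) hw
  rw [sub_self, norm_zero] at this
  exact sub_eq_zero.1 (norm_le_zero_iff.1 this)

lemma continuous_resolvent {ρ lam : ℝ} {T : Vec p → Set (Vec p)}
    (hT : MaximallyCoHypomonotone ρ T) (hlam0 : 0 < lam) (hlam : 2 * ρ ≤ lam) :
    Continuous (resolvent lam T) :=
  (LipschitzWith.of_dist_le_mul (K := 1) fun x y => by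
    simpa [dist_eq_norm] using norm_resolvent_sub_le hT hlam0 hlam x y).continuous

/-! ### The forward-backward splitting residual -/

lemma fbsResidual_eq_zero {ρ lam : ℝ} {F : Vec p → Vec p} {T : Vec p → Set (Vec p)}
    (hT : MaximallyCoHypomonotone ρ T) (hlam0 : 0 < lam) (hlam : 2 * ρ ≤ lam)
    {x : Vec p} (hx : x ∈ zer F T) : fbsResidual lam F T x = 0 := by
  obtain ⟨u, hu, h⟩ := hx
  have : resolvent lam T (x - lam • F x) = x := by
    refine resolvent_eq_of_mem hT hlam0 hlam ⟨u, hu, ?_⟩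
    rw [eq_neg_of_add_eq_zero_left h, smul_neg]; abel
  rw [fbsResidual, this, sub_self, smul_zero]

/-- The residual inherits co-coercivity from `F`; the part of the co-coercivity of `F` that is
not needed for the constant `betaBar` is kept as the term `S`. -/
lemma fbsResidual_cocoercive {ρ lam L Lhat : ℝ} {F : Vec p → Vec p} {T : Vec p → Set (Vec p)}
    (hT : MaximallyCoHypomonotone ρ T) (hlam0 : 0 < lam) (hlam : 2 * ρ ≤ lam)
    (hL : 0 < L) (hLhat : L < Lhat) (hLρ : Lhat * ρ < 1) {x y : Vec p} {S : ℝ}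
    (hF : (1 / L) * S ≤ inner ℝ (F x - F y) (x - y)) (hS : ‖F x - F y‖ ^ 2 ≤ S) :
    betaBar Lhat ρ lam * ‖fbsResidual lam F T x - fbsResidual lam F T y‖ ^ 2 + Lam L Lhat * S
      ≤ inner ℝ (fbsResidual lam F T x - fbsResidual lam F T y) (x - y) := by
  have hlt : ρ < lam := by linarith
  have hLh : 0 < Lhat := hL.trans hLhat
  obtain ⟨u, hu, hux⟩ := exists_resolvent_spec hT hlt (x - lam • F x)
  obtain ⟨v, hv, hvy⟩ := exists_resolvent_spec hT hlt (y - lam • F y)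
  have hmono := hT.1 _ _ _ _ hu hv
  have hres : ∀ (x u : Vec p), x - lam • F x = resolvent lam T (x - lam • F x) + lam • u →
      u = fbsResidual lam F T x - F x ∧
        resolvent lam T (x - lam • F x) = x - lam • fbsResidual lam F T x := by
    intro x u h
    have h1 : resolvent lam T (x - lam • F x) = x - lam • F x - lam • u := by
      rw [eq_sub_iff_add_eq]; exact h.symm
    have h2 : fbsResidual lam F T x = F x + u := by
      rw [fbsResidual, h1, sub_sub, ← smul_add, sub_sub_cancel, smul_smul,
        one_div_mul_cancel hlam0.ne', one_smul]
    exact ⟨by rw [h2]; abel, by rw [h1, h2, smul_add, sub_sub]⟩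
  obtain ⟨hu1, hx1⟩ := hres x u hux
  obtain ⟨hv1, hy1⟩ := hres y v hvy
  rw [hu1, hv1, hx1, hy1] at hmono
  set g := fbsResidual lam F T x - fbsResidual lam F T y with hg
  set f := F x - F y with hf
  have e1 : fbsResidual lam F T x - F x - (fbsResidual lam F T y - F y) = g - f := by
    rw [hg, hf]; abel
  have e2 : x - lam • fbsResidual lam F T x - (y - lam • fbsResidual lam F T y)
      = (x - y) - lam • g := by rw [hg, smul_sub]; abel
  rw [e1, e2, norm_sub_sq_real, inner_sub_left, inner_sub_right _ (x - y),
    inner_sub_right _ (x - y), real_inner_smul_right, real_inner_smul_right,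
    real_inner_self_eq_norm_sq, real_inner_comm g f] at hmono
  have hLam : Lam L Lhat = 1 / L - 1 / Lhat := by
    rw [Lam]; field_simp
  have hS' : 1 / Lhat * ‖f‖ ^ 2 ≤ 1 / Lhat * S :=
    mul_le_mul_of_nonneg_left hS (by positivity)
  have hd : 0 < 1 - ρ * Lhat := by linarith [mul_comm ρ Lhat]
  -- completing the square in `f`
  have hsq : 0 ≤ (1 - ρ * Lhat) / Lhat
      * ‖f - ((lam - 2 * ρ) * Lhat / (2 * (1 - ρ * Lhat))) • g‖ ^ 2 := by positivity
  rw [norm_sub_sq_real, real_inner_smul_right, norm_smul, mul_pow, Real.norm_eq_abs, sq_abs,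
    real_inner_comm] at hsq
  have hid : (1 - ρ * Lhat) / Lhat * (‖f‖ ^ 2
      - 2 * ((lam - 2 * ρ) * Lhat / (2 * (1 - ρ * Lhat)) * inner ℝ g f)
      + ((lam - 2 * ρ) * Lhat / (2 * (1 - ρ * Lhat))) ^ 2 * ‖g‖ ^ 2)
      = (1 / Lhat - ρ) * ‖f‖ ^ 2 - (lam - 2 * ρ) * inner ℝ g f
        + ((lam - ρ) - betaBar Lhat ρ lam) * ‖g‖ ^ 2 := by
    rw [betaBar]; field_simp; ring
  rw [hid] at hsq
  rw [hLam]
  linarith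

lemma continuous_fbsResidual {ρ lam : ℝ} {F : Vec p → Vec p} {T : Vec p → Set (Vec p)}
    (hT : MaximallyCoHypomonotone ρ T) (hlam0 : 0 < lam) (hlam : 2 * ρ ≤ lam)
    (hF : Continuous F) : Continuous (fbsResidual lam F T) := by
  have := continuous_resolvent hT hlam0 hlam
  unfold fbsResidual
  fun_prop

/-- Nonexpansiveness of the resolvent turns the error of an estimate `f` of `F x` into an error of
the residual of at most the same size. -/
lemma norm_residual_error_le {ρ lam : ℝ} {F : Vec p → Vec p} {T : Vec p → Set (Vec p)}
    (hT : MaximallyCoHypomonotone ρ T) (hlam0 : 0 < lam) (hlam : 2 * ρ ≤ lam)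
    (x f : Vec p) :
    ‖(1 / lam) • (x - resolvent lam T (x - lam • f)) - fbsResidual lam F T x‖ ≤ ‖f - F x‖ := by
  have h := norm_resolvent_sub_le hT hlam0 hlam (x - lam • F x) (x - lam • f)
  have h1 : x - lam • F x - (x - lam • f) = lam • (f - F x) := by rw [smul_sub]; abel
  rw [h1, norm_smul, Real.norm_of_nonneg hlam0.le] at h
  rw [fbsResidual, ← smul_sub, sub_sub_sub_cancel_left, norm_smul,
    Real.norm_of_nonneg (by positivity)]
  calc 1 / lam * _ ≤ 1 / lam * (lam * ‖f - F x‖) := by gcongr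
    _ = ‖f - F x‖ := by field_simp

/-! ### One step of the Lyapunov functions -/

lemma two_mul_inner_le {E : Type*} [NormedAddCommGroup E] [InnerProductSpace ℝ E]
    {a c m : ℝ} (ha : 0 ≤ a) (hc : 0 ≤ c) (h : m ^ 2 ≤ a * c) (u v : E) :
    2 * m * inner ℝ u v ≤ a * ‖u‖ ^ 2 + c * ‖v‖ ^ 2 := by
  have h1 : |m| ≤ √a * √c := by
    rw [← Real.sqrt_mul ha]; exact Real.abs_le_sqrt h
  have h2 : m * inner ℝ u v ≤ |m| * (‖u‖ * ‖v‖) := by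
    refine (le_abs_self _).trans ?_
    rw [abs_mul]
    exact mul_le_mul_of_nonneg_left (abs_real_inner_le_norm u v) (abs_nonneg m)
  have h3 : |m| * (‖u‖ * ‖v‖) ≤ (√a * √c) * (‖u‖ * ‖v‖) :=
    mul_le_mul_of_nonneg_right h1 (by positivity)
  nlinarith [sq_nonneg (√a * ‖u‖ - √c * ‖v‖), Real.sq_sqrt ha, Real.sq_sqrt hc]

/-- The step size `η` as a function of `t`, so that `etaSeq μ r β k = eta μ β (tSeq μ r k)`. -/
noncomputable def eta (μ β t : ℝ) : ℝ := 2 * β * (t - 1) / (t - μ / 2)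

/-- The Lyapunov function, in terms of the residual `g` at `x`, of `d = x - z` and of
`ζ = z - xstar`. -/
noncomputable def potential {E : Type*} [NormedAddCommGroup E] [InnerProductSpace ℝ E]
    (μ β t : ℝ) (g d ζ : E) : ℝ :=
  β * ((t - μ) * (t - μ - 1)) * ‖g‖ ^ 2 + (t - μ) * inner ℝ g d
    + (1 - μ) / μ / eta μ β t * ‖ζ‖ ^ 2

/-- The scaled squared distance of `z` to the solution, in terms of `ζ = z - xstar`. -/
noncomputable def anchorEnergy {E : Type*} [NormedAddCommGroup E] (μ β t : ℝ) (ζ : E) : ℝ :=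
  ‖ζ‖ ^ 2 / (2 * β * eta μ β t)

section scalars

variable {μ β t : ℝ}

lemma eta_pos (hβ : 0 < β) (hμ : 0 < μ) (hμ' : μ < 2 / 3) (ht : 1 + 5 * μ < t) :
    0 < eta μ β t := by
  have h1 : 0 < t - 1 := by linarith
  have h2 : 0 < t - μ / 2 := by linarith
  unfold eta; positivity

lemma eta_le (hβ : 0 < β) (hμ : 0 < μ) (hμ' : μ < 2 / 3) (ht : 1 + 5 * μ < t) :
    eta μ β t ≤ 2 * β := by
  have h2 : 0 < t - μ / 2 := by linarith
  rw [eta, div_le_iff₀ h2]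
  nlinarith

lemma eta_mul (hμ : 0 < μ) (ht : 1 + 5 * μ < t) :
    eta μ β t * (t - μ / 2) = 2 * β * (t - 1) := by
  have h2 : t - μ / 2 ≠ 0 := by linarith
  rw [eta, div_mul_cancel₀ _ h2]

lemma inv_eta_sub (hβ : 0 < β) (hμ : 0 < μ) (ht : 1 + 5 * μ < t) :
    1 / eta μ β t - 1 / eta μ β (t + μ)
      = (1 - μ / 2) * μ / (2 * β * (t - 1) * (t + μ - 1)) := by
  have h1 : t - 1 ≠ 0 := by linarith
  have h2 : t + μ - 1 ≠ 0 := by linarith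
  unfold eta
  rw [one_div_div, one_div_div]
  field_simp
  ring

/-- The total coefficient of `‖g‖ ^ 2 / β` in the decrease of the Lyapunov function. -/
lemma residual_coefficient_le (hμ : 0 < μ) (hμ' : μ < 2 / 3) (ht : 1 + 5 * μ < t) :
    t * (t - 1) * (2 * ((t - 1) / (t - μ / 2)) - 1) - (t - μ) * (t - μ - 1)
      - (1 - μ) * ((2 + μ) / (2 - μ)) + (1 - μ) * (μ / 2) * ((t - 1) / (t - μ / 2))
      ≤ -(1 - μ / 2) ^ 2 := by
  have hN : 1 ≤ t - μ / 2 := by linarith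
  have hN0 : 0 < t - μ / 2 := by linarith
  have hq : (t - 1) / (t - μ / 2) ≤ 1 := by rw [div_le_one hN0]; linarith
  have h1 : t - (1 - μ / 2) * (1 + μ / 2) ≤ t * (t - 1) / (t - μ / 2) := by
    rw [le_div_iff₀ hN0]
    nlinarith [mul_nonneg (mul_nonneg (by linarith : (0 : ℝ) ≤ μ / 2)
      (by linarith : (0 : ℝ) ≤ 1 - μ / 2)) (by linarith : 0 ≤ t - μ / 2 - 1)]
  have h2 : t * (t - 1) * (2 * ((t - 1) / (t - μ / 2)) - 1)
      = t * (t - 1) - (2 - μ) * (t * (t - 1) / (t - μ / 2)) := by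
    have h : (t - 1) / (t - μ / 2) = 1 - (1 - μ / 2) / (t - μ / 2) := by
      rw [eq_sub_iff_add_eq, ← add_div, div_eq_one_iff_eq hN0.ne']; ring
    rw [h]; ring
  have h3 : 1 - 3 / 4 * μ ^ 2 ≤ (1 - μ) * ((2 + μ) / (2 - μ)) := by
    have : 0 < 2 - μ := by linarith
    rw [mul_div_assoc', le_div_iff₀ this]
    nlinarith [mul_pos hμ hμ, mul_pos (mul_pos hμ hμ) (by linarith : 0 < 2 / 3 - μ)]
  have h4 : (2 - μ) * (t - (1 - μ / 2) * (1 + μ / 2)) ≤ (2 - μ) * (t * (t - 1) / (t - μ / 2)) :=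
    mul_le_mul_of_nonneg_left h1 (by linarith)
  have h5 : (1 - μ) * (μ / 2) * ((t - 1) / (t - μ / 2)) ≤ (1 - μ) * (μ / 2) * 1 :=
    mul_le_mul_of_nonneg_left hq (mul_nonneg (by linarith) (by linarith))
  have h6 : 0 ≤ (2 - 3 * μ) * (t - (1 + 5 * μ)) := mul_nonneg (by linarith) (by linarith)
  rw [h2]
  nlinarith [mul_nonneg hμ.le (by linarith : 0 ≤ 2 / 3 - μ),
    mul_nonneg (mul_nonneg hμ.le hμ.le) (by linarith : 0 ≤ 2 / 3 - μ)]

/-- The total coefficient of `‖e‖ ^ 2` in the decrease of the Lyapunov function. -/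
lemma error_coefficient_le (hβ : 0 < β) (hμ : 0 < μ) (hμ' : μ < 2 / 3) :
    β * ((2 - μ) / (2 * μ)) + β + β * ((1 - μ) / (2 - μ)) ≤ 5 * β / (3 * μ) := by
  have h : 0 < 2 - μ := by linarith
  have : (2 - μ) / (2 * μ) + 1 + (1 - μ) / (2 - μ) ≤ 5 / (3 * μ) := by
    rw [div_add_one (by positivity), div_add_div _ _ (by positivity) h.ne',
      div_le_div_iff₀ (by positivity) (by positivity)]
    nlinarith [mul_pos hμ hμ, mul_pos (mul_pos hμ hμ) hμ,
      mul_nonneg hμ.le (by linarith : 0 ≤ 2 / 3 - μ),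
      mul_nonneg (mul_nonneg hμ.le hμ.le) (by linarith : 0 ≤ 2 / 3 - μ),
      mul_nonneg (mul_nonneg (mul_nonneg hμ.le hμ.le) hμ.le) (by linarith : 0 ≤ 2 / 3 - μ)]
  calc _ = β * ((2 - μ) / (2 * μ) + 1 + (1 - μ) / (2 - μ)) := by ring
    _ ≤ β * (5 / (3 * μ)) := by gcongr
    _ = _ := by ring

end scalars

section steps

variable {E : Type*} [NormedAddCommGroup E] [InnerProductSpace ℝ E] {μ β βb t : ℝ}

/-- One step of the method with residual error `e`. In the notation of the algorithm, `hco` is the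
co-coercivity of the residual between two consecutive iterates and `hsol` is its co-coercivity
between the current iterate and the solution. -/
lemma potential_step (hβ : 0 < β) (hμ : 0 < μ) (hμ' : μ < 2 / 3) (ht : 1 + 5 * μ < t)
    (hβb : (2 + μ) / (2 - μ) * β ≤ βb) {g g' e d ζ : E} {S : ℝ}
    (hco : βb * ‖g' - g‖ ^ 2 + S ≤ inner ℝ (g' - g) (-((1 / t) • d) - eta μ β t • (g + e)))
    (hsol : βb * ‖g‖ ^ 2 ≤ inner ℝ g (d + ζ)) :
    potential μ β (t + μ) g' (((t - 1) / t) • d - ((1 - μ / 2) * eta μ β t) • (g + e))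
        (ζ - (μ / 2 * eta μ β t) • (g + e)) + t * (t - 1) * S
      ≤ potential μ β t g d ζ + 5 * β / (3 * μ) * (t * (t - 1)) * ‖e‖ ^ 2 := by
  set η := eta μ β t with hη
  set η' := eta μ β (t + μ) with hη'
  have ht0 : 0 < t := by linarith
  have ht1 : 0 < t - 1 := by linarith
  have hN : 0 < t - μ / 2 := by linarith
  have hηpos : 0 < η := eta_pos hβ hμ hμ' ht
  have hηmul : η * (t - μ / 2) = 2 * β * (t - 1) := eta_mul hμ ht
  have hηq : η = 2 * β * ((t - 1) / (t - μ / 2)) := by rw [hη, eta]; ring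
  have hD : 0 < t * (t - 1) := by positivity
  set D := t * (t - 1) with hDdef
  -- With `z` the value of `ζ` after the step, the cross terms of `e` with `ζ` become cross terms
  -- with `z`, for which the growth of the step size leaves `(a - a') * ‖z‖ ^ 2`.
  obtain ⟨z, rfl⟩ : ∃ z, ζ = z + (μ / 2 * η) • (g + e) :=
    ⟨ζ - (μ / 2 * η) • (g + e), by abel⟩
  rw [add_sub_cancel_right]
  set a := (1 - μ) / μ / η with ha
  set a' := (1 - μ) / μ / η' with ha'
  have haη : a * (μ / 2 * η) = (1 - μ) / 2 := by
    rw [ha]; field_simp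
  have hinv : a - a' = (1 - μ) / μ * ((1 - μ / 2) * μ / (2 * β * (t - 1) * (t + μ - 1))) := by
    rw [ha, ha', ← inv_eta_sub hβ hμ ht]; ring
  have ht2 : 0 < t + μ - 1 := by linarith
  have hm2 : 0 < 2 - μ := by linarith
  have hm1 : 0 < 1 - μ := by linarith
  have hinv0 : 0 ≤ a - a' := by
    rw [hinv]
    have : 0 < 1 - μ / 2 := by linarith
    positivity
  -- the three uses of Young's inequality
  have y1 := two_mul_inner_le (a := D * (β * (2 * μ / (2 - μ))))
    (c := D * (β * ((2 - μ) / (2 * μ)))) (m := -(β * D)) (by positivity) (by positivity)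
    (le_of_eq (by field_simp)) (g' - g) e
  have y2 := two_mul_inner_le (a := β * (1 - μ / 2) ^ 2) (c := D * β)
    (m := -((2 * β - η) * D / 2)) (by positivity) (by positivity) (by
      have h1 : (2 * β - η) * (t - μ / 2) = 2 * β * (1 - μ / 2) := by
        rw [sub_mul, hηmul]; ring
      have h2 : 2 * β - η = 2 * β * (1 - μ / 2) / (t - μ / 2) := by
        rw [eq_div_iff hN.ne', h1]
      have h3 : D ≤ (t - μ / 2) ^ 2 := by rw [hDdef]; nlinarith [sq_nonneg μ]
      rw [h2]
      calc (-(2 * β * (1 - μ / 2) / (t - μ / 2) * D / 2)) ^ 2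
          = β * (1 - μ / 2) ^ 2 * (D * β) * (D / (t - μ / 2) ^ 2) := by field_simp
        _ ≤ β * (1 - μ / 2) ^ 2 * (D * β) * 1 := by
            gcongr
            rw [div_le_one (by positivity)]; exact h3
        _ = _ := by ring) g e
  have y3 := two_mul_inner_le (a := a - a') (c := D * (β * ((1 - μ) / (2 - μ))))
    (m := -((1 - μ) / 2)) hinv0 (by positivity) (by
      rw [hinv]
      have h3 : (t - 1) * (t + μ - 1) ≤ D := by rw [hDdef]; nlinarith
      calc (-((1 - μ) / 2)) ^ 2
          = (1 - μ) ^ 2 / 4 * 1 := by ring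
        _ ≤ (1 - μ) ^ 2 / 4 * (D / ((t - 1) * (t + μ - 1))) := by
            gcongr
            rw [one_le_div (by positivity)]; exact h3
        _ = _ := by field_simp; ring) z e
  -- bounds for the coefficients of `‖g‖ ^ 2` and `‖e‖ ^ 2`
  have c1 := mul_le_mul_of_nonneg_right (mul_le_mul_of_nonneg_left
    (residual_coefficient_le hμ hμ' ht) hβ.le) (sq_nonneg ‖g‖)
  have c2 := mul_le_mul_of_nonneg_right (mul_le_mul_of_nonneg_left
    (error_coefficient_le hβ hμ hμ') hD.le) (sq_nonneg ‖e‖)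
  have c3 : 0 ≤ (1 - μ) * (μ / 4) * η * ‖e‖ ^ 2 := by positivity
  have c4 := mul_le_mul_of_nonneg_right hβb (mul_nonneg hD.le (sq_nonneg ‖g' - g‖))
  have c5 := mul_le_mul_of_nonneg_right hβb (mul_nonneg hm1.le (sq_nonneg ‖g‖))
  have c6 : (2 + μ) / (2 - μ) * β = β + β * (2 * μ / (2 - μ)) := by field_simp; ring
  have co := mul_le_mul_of_nonneg_left hco hD.le
  have so := mul_le_mul_of_nonneg_left hsol hm1.le
  have hDt : D * (1 / t) = t - 1 := by rw [hDdef]; field_simp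
  have htt : t * ((t - 1) / t) = t - 1 := by field_simp
  rw [← hDdef] at c1
  unfold potential
  rw [← hη, ← hη', ← ha, ← ha', add_sub_cancel_right, ← hDdef]
  have hq : (t - 1) / (t - μ / 2) = η / (2 * β) := by rw [hηq]; field_simp
  rw [hq] at c1
  have hc1 : β * (D * (2 * (η / (2 * β)) - 1) - (t - μ) * (t - μ - 1)
      - (1 - μ) * ((2 + μ) / (2 - μ)) + (1 - μ) * (μ / 2) * (η / (2 * β)))
      = D * (η - β) - β * ((t - μ) * (t - μ - 1)) - (1 - μ) * ((2 + μ) / (2 - μ) * β)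
        + (1 - μ) * (μ / 4) * η := by
    field_simp; ring
  rw [hc1] at c1
  have hηD : t * η * (t - μ / 2) = 2 * β * D := by rw [hDdef, mul_assoc, hηmul]; ring
  rw [← real_inner_self_eq_norm_sq, ← real_inner_self_eq_norm_sq] at *
  simp only [inner_add_left, inner_sub_left, inner_add_right, inner_sub_right, inner_neg_right,
    real_inner_smul_left, real_inner_smul_right, ← real_inner_self_eq_norm_sq] at *
  rw [real_inner_comm g' g, real_inner_comm e g, real_inner_comm e g', real_inner_comm z g,
    real_inner_comm z e] at *
  -- both sides as quadratic forms in `g`, `g'`, `e`, `d` and `z`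
  linear_combination co + so + y1 + y2 + y3 + c1 + c2 + c3 + c4 + c5
    - c6 * (D * (inner ℝ g' g' - inner ℝ g' g - (inner ℝ g' g - inner ℝ g g)))
    - hDt * (inner ℝ g' d - inner ℝ g d) + htt * inner ℝ g' d
    - hηD * (inner ℝ g' g + inner ℝ e g')
    - haη * (2 * (inner ℝ z g + inner ℝ z e)
      + μ / 2 * η * (inner ℝ g g + 2 * inner ℝ e g + inner ℝ e e))

/-- The Lyapunov function dominates a nonnegative quadratic form in the residual and in the
distance of `z` to the solution. -/
lemma le_potential (hβ : 0 < β) (hμ : 0 < μ) (hμ' : μ < 2 / 3) (ht : 1 + 5 * μ < t)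
    (hβb : (2 + μ) / (2 - μ) * β ≤ βb) {g d ζ : E} (hsol : βb * ‖g‖ ^ 2 ≤ inner ℝ g (d + ζ)) :
    β * (t - μ) ^ 2 * ‖g‖ ^ 2 - (t - μ) * inner ℝ g ζ + 1 / (2 * eta μ β t) * ‖ζ‖ ^ 2
      ≤ potential μ β t g d ζ := by
  have hη := eta_pos hβ hμ hμ' ht
  have h1 : 1 / (2 * eta μ β t) ≤ (1 - μ) / μ / eta μ β t := by
    rw [div_div, div_le_div_iff₀ (by positivity) (by positivity)]
    nlinarith
  have h2 : β ≤ βb := by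
    refine le_trans ?_ hβb
    have : 1 ≤ (2 + μ) / (2 - μ) := by rw [one_le_div (by linarith)]; linarith
    nlinarith
  have h3 := mul_le_mul_of_nonneg_right h1 (sq_nonneg ‖ζ‖)
  have h4 : 0 ≤ (t - μ) * (inner ℝ g (d + ζ) - β * ‖g‖ ^ 2) := by
    refine mul_nonneg (by linarith) ?_
    nlinarith [mul_le_mul_of_nonneg_right h2 (sq_nonneg ‖g‖)]
  rw [inner_add_right] at h4
  unfold potential
  linarith

lemma potential_nonneg (hβ : 0 < β) (hμ : 0 < μ) (hμ' : μ < 2 / 3) (ht : 1 + 5 * μ < t)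
    (hβb : (2 + μ) / (2 - μ) * β ≤ βb) {g d ζ : E} (hsol : βb * ‖g‖ ^ 2 ≤ inner ℝ g (d + ζ)) :
    0 ≤ potential μ β t g d ζ := by
  have hη := eta_pos hβ hμ hμ' ht
  have h := two_mul_inner_le (a := β * (t - μ) ^ 2) (c := 1 / (2 * eta μ β t))
    (m := (t - μ) / 2) (by positivity) (by positivity) (by
      have h1 : 1 / 2 ≤ β * (1 / eta μ β t) := by
        rw [mul_one_div, div_le_div_iff₀ (by norm_num) hη]
        linarith [eta_le hβ hμ hμ' ht]
      calc ((t - μ) / 2) ^ 2 = (t - μ) ^ 2 / 2 * (1 / 2) := by ring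
        _ ≤ (t - μ) ^ 2 / 2 * (β * (1 / eta μ β t)) := by gcongr
        _ = _ := by field_simp) g ζ
  linarith [le_potential hβ hμ hμ' ht hβb hsol]

/-- The Lyapunov function alone controls the residual only with a constant that degenerates as
`μ` tends to `2 / 3`; together with `anchorEnergy` it does so uniformly. -/
lemma sq_norm_residual_le (hβ : 0 < β) (hμ : 0 < μ) (hμ' : μ < 2 / 3) (ht : 1 + 5 * μ < t)
    (hβb : (2 + μ) / (2 - μ) * β ≤ βb) {g d ζ : E} (hsol : βb * ‖g‖ ^ 2 ≤ inner ℝ g (d + ζ)) :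
    β * (t - μ) ^ 2 * ‖g‖ ^ 2
      ≤ 2 * (β * anchorEnergy μ β t ζ) + 2 * potential μ β t g d ζ := by
  have hη := eta_pos hβ hμ hμ' ht
  have h := two_mul_inner_le (a := β * (t - μ) ^ 2) (c := 2 / eta μ β t)
    (m := (t - μ)) (by positivity) (by positivity) (by
      have h1 : 1 ≤ 2 * (β * (1 / eta μ β t)) := by
        rw [mul_one_div, mul_div_assoc', one_le_div hη]
        linarith [eta_le hβ hμ hμ' ht]
      calc (t - μ) ^ 2 = (t - μ) ^ 2 * 1 := by ring
        _ ≤ (t - μ) ^ 2 * (2 * (β * (1 / eta μ β t))) := by gcongr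
        _ = _ := by field_simp) g ζ
  have h2 := le_potential hβ hμ hμ' ht hβb hsol
  have h3 : 2 * (β * anchorEnergy μ β t ζ) + 2 * (1 / (2 * eta μ β t) * ‖ζ‖ ^ 2)
      = 2 / eta μ β t * ‖ζ‖ ^ 2 := by
    unfold anchorEnergy; field_simp; ring
  linarith

/-- The scaled squared distance of `z` to the solution relaxes towards the Lyapunov function
divided by `β`. The Lyapunov function bounds `-⟪g, ζ⟫` from below by `le_potential`, and this cross
term is the main part of the change of `‖ζ‖ ^ 2` in one step. The growth of the step size leaves
room for the cross term with the error `e`. -/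
lemma anchorEnergy_step (hβ : 0 < β) (hμ : 0 < μ) (hμ' : μ < 2 / 3) (ht : 1 + 5 * μ < t)
    (hβb : (2 + μ) / (2 - μ) * β ≤ βb) {g e d ζ : E}
    (hsol : βb * ‖g‖ ^ 2 ≤ inner ℝ g (d + ζ)) :
    anchorEnergy μ β (t + μ) (ζ - (μ / 2 * eta μ β t) • (g + e))
      ≤ (1 - μ / 2 / (t - μ)) * anchorEnergy μ β t ζ
        + μ / 2 / (t - μ) * (potential μ β t g d ζ / β) + 1 / 4 * (t * (t - 1)) * ‖e‖ ^ 2 := by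
  have hη := eta_pos hβ hμ hμ' ht
  have hη' := eta_pos hβ hμ hμ' (t := t + μ) (by linarith)
  have hs : 0 < t - μ := by linarith
  have ht1 : 0 < t - 1 := by linarith
  have ht2 : 0 < t + μ - 1 := by linarith
  have hN : 0 < t - μ / 2 := by linarith
  have hν1 : 0 < 1 - μ / 2 := by linarith
  have hηq : eta μ β t = 2 * β * ((t - 1) / (t - μ / 2)) := by rw [eta]; ring
  have hinv := inv_eta_sub hβ hμ ht
  have hηle := eta_le hβ hμ hμ' ht
  have hlow := le_potential hβ hμ hμ' ht hβb hsol
  set η := eta μ β t with hηdef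
  set η' := eta μ β (t + μ) with hη'def
  set u := ζ - (μ / 2 * η) • g with hu
  have hu' : ζ - (μ / 2 * η) • (g + e) = u - (μ / 2 * η) • e := by rw [hu, smul_add]; abel
  -- the error-free step
  have step1 : ‖u‖ ^ 2 / (2 * β * η) ≤ (1 - μ / 2 / (t - μ)) * (‖ζ‖ ^ 2 / (2 * β * η))
      + μ / 2 / (t - μ) * (potential μ β t g d ζ / β) := by
    have h1 : μ / 2 / (t - μ) * ((β * (t - μ) ^ 2 * ‖g‖ ^ 2 - (t - μ) * inner ℝ g ζ
        + 1 / (2 * η) * ‖ζ‖ ^ 2) / β) ≤ μ / 2 / (t - μ) * (potential μ β t g d ζ / β) := by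
      gcongr
    have h2 : ‖u‖ ^ 2 = ‖ζ‖ ^ 2 - μ * η * inner ℝ g ζ + (μ / 2 * η) ^ 2 * ‖g‖ ^ 2 := by
      rw [hu, norm_sub_sq_real, real_inner_smul_right, norm_smul, mul_pow, Real.norm_eq_abs,
        sq_abs, real_inner_comm]
      ring
    have h3 : (μ / 2) ^ 2 * η / (2 * β) * ‖g‖ ^ 2 ≤ μ / 2 * (t - μ) * ‖g‖ ^ 2 := by
      refine mul_le_mul_of_nonneg_right ?_ (sq_nonneg _)
      rw [div_le_iff₀ (by positivity)]
      nlinarith [mul_le_mul_of_nonneg_left hηle (by positivity : 0 ≤ (μ / 2) ^ 2),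
        mul_pos hμ hβ, mul_pos (mul_pos hμ hβ) (by linarith : 0 < t - μ - μ / 2)]
    have h4 : ‖u‖ ^ 2 / (2 * β * η) = ‖ζ‖ ^ 2 / (2 * β * η) - μ / (2 * β) * inner ℝ g ζ
        + (μ / 2) ^ 2 * η / (2 * β) * ‖g‖ ^ 2 := by
      rw [h2]; field_simp
    have h5 : μ / 2 / (t - μ) * ((β * (t - μ) ^ 2 * ‖g‖ ^ 2 - (t - μ) * inner ℝ g ζ
        + 1 / (2 * η) * ‖ζ‖ ^ 2) / β) = μ / 2 * (t - μ) * ‖g‖ ^ 2 - μ / (2 * β) * inner ℝ g ζ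
        + μ / 2 / (t - μ) * (‖ζ‖ ^ 2 / (2 * β * η)) := by
      field_simp
    rw [h4]
    linarith
  -- the error
  have step2 : ‖u - (μ / 2 * η) • e‖ ^ 2 / (2 * β * η')
      ≤ ‖u‖ ^ 2 / (2 * β * η) + 1 / 4 * (t * (t - 1)) * ‖e‖ ^ 2 := by
    set δ := 1 / η - 1 / η' with hδ
    have hδ0 : 0 ≤ δ := by rw [hinv]; positivity
    have hR : η / η' = 1 - η * δ := by rw [hδ]; field_simp; ring
    have hN2 : 0 < t + μ / 2 := by linarith
    have ht0 : 0 < t := by linarith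
    have hRδ : (μ / 2) ^ 2 * (η / η') ≤ δ * (β / 2 * (t * (t - 1))) := by
      have hη'q : η' = 2 * β * (t + μ - 1) / (t + μ / 2) := by
        rw [hη'def, eta]; congr 1; ring
      have h1 : η / η' = (t - 1) * (t + μ / 2) / ((t - μ / 2) * (t + μ - 1)) := by
        rw [hηq, hη'q]; field_simp
      rw [h1, hinv]
      have h2 : μ * ((t - 1) * (t + μ / 2)) ≤ (1 - μ / 2) * (t * (t - μ / 2)) := by
        have h3 : (t - 1) * (t + μ / 2) ≤ t * (t - μ / 2) := by nlinarith
        exact mul_le_mul (by linarith) h3 (by positivity) hν1.le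
      calc (μ / 2) ^ 2 * ((t - 1) * (t + μ / 2) / ((t - μ / 2) * (t + μ - 1)))
          = μ / 4 / ((t - μ / 2) * (t + μ - 1)) * (μ * ((t - 1) * (t + μ / 2))) := by ring
        _ ≤ μ / 4 / ((t - μ / 2) * (t + μ - 1)) * ((1 - μ / 2) * (t * (t - μ / 2))) := by gcongr
        _ = _ := by
            have hN' := hN.ne'
            generalize t - μ / 2 = N at hN' ⊢
            field_simp; ring
    have hc : 0 ≤ β / 2 * (t * (t - 1)) - (μ / 2) ^ 2 * η * (η / η') := by
      have h1 : η * δ ≤ 1 := by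
        have : 0 < η / η' := by positivity
        linarith
      have h2 := mul_le_mul_of_nonneg_left hRδ hη.le
      have h3 : η * δ * (β / 2 * (t * (t - 1))) ≤ 1 * (β / 2 * (t * (t - 1))) := by gcongr
      linarith
    have y := two_mul_inner_le (a := δ)
      (c := β / 2 * (t * (t - 1)) - (μ / 2) ^ 2 * η * (η / η')) (m := -(μ / 2 * (η / η')))
      hδ0 hc (by
        have h1 : (-(μ / 2 * (η / η'))) ^ 2
            = (μ / 2) ^ 2 * (η / η') - δ * ((μ / 2) ^ 2 * η * (η / η')) := by
          calc (-(μ / 2 * (η / η'))) ^ 2 = (μ / 2) ^ 2 * (η / η') * (η / η') := by ring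
            _ = (μ / 2) ^ 2 * (η / η') * (1 - η * δ) := by nth_rewrite 2 [hR]; rfl
            _ = _ := by ring
        rw [h1]; linarith) u e
    have e1 : ‖u - (μ / 2 * η) • e‖ ^ 2
        = ‖u‖ ^ 2 - μ * η * inner ℝ u e + (μ / 2 * η) ^ 2 * ‖e‖ ^ 2 := by
      rw [norm_sub_sq_real, real_inner_smul_right, norm_smul, mul_pow, Real.norm_eq_abs, sq_abs]
      ring
    have e2 : ‖u - (μ / 2 * η) • e‖ ^ 2 / (2 * β * η')
        = (1 / η' * ‖u‖ ^ 2 - μ * (η / η') * inner ℝ u e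
          + (μ / 2) ^ 2 * η * (η / η') * ‖e‖ ^ 2) / (2 * β) := by
      rw [e1]; field_simp
    have e3 : ‖u‖ ^ 2 / (2 * β * η) + 1 / 4 * (t * (t - 1)) * ‖e‖ ^ 2
        = (1 / η * ‖u‖ ^ 2 + β / 2 * (t * (t - 1)) * ‖e‖ ^ 2) / (2 * β) := by
      field_simp; ring
    rw [e2, e3]
    refine div_le_div_of_nonneg_right ?_ (by positivity)
    rw [hδ] at y
    linarith
  unfold anchorEnergy
  rw [hu', ← hη'def, ← hηdef]
  linarith

end steps

/-! ### Sampling -/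

section sampling

variable {Ξ E : Type*} [MeasurableSpace Ξ] {P : Measure Ξ} [IsProbabilityMeasure P]
  [NormedAddCommGroup E] [InnerProductSpace ℝ E] [CompleteSpace E]

lemma integral_norm_add_sq {f : Ξ → E} (hf : Integrable f P)
    (hf2 : Integrable (fun s => ‖f s‖ ^ 2) P) (h0 : ∫ s, f s ∂P = 0) (a : E) :
    Integrable (fun s => ‖a + f s‖ ^ 2) P ∧
      ∫ s, ‖a + f s‖ ^ 2 ∂P = ‖a‖ ^ 2 + ∫ s, ‖f s‖ ^ 2 ∂P := by
  have hi : Integrable (fun s => 2 * inner ℝ a (f s)) P := (hf.const_inner a).const_mul 2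
  have h1 : (fun s => ‖a + f s‖ ^ 2) = fun s => ‖a‖ ^ 2 + 2 * inner ℝ a (f s) + ‖f s‖ ^ 2 := by
    ext s; exact norm_add_sq_real a (f s)
  rw [h1]
  refine ⟨((integrable_const _).add hi).add hf2, ?_⟩
  have h2 : ∫ s, (‖a‖ ^ 2 + 2 * inner ℝ a (f s)) ∂P = ‖a‖ ^ 2 := by
    rw [integral_add (integrable_const _) hi, integral_const_mul, integral_inner hf, h0]
    simp
  rw [integral_add (f := fun s => ‖a‖ ^ 2 + 2 * inner ℝ a (f s))
    ((integrable_const _).add hi) hf2, h2]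

/-- The variance of a sum of i.i.d. centered vectors, shifted by a deterministic vector. -/
lemma lintegral_norm_add_sum_sq [MeasurableSpace E] [BorelSpace E] [SecondCountableTopology E]
    {f : Ξ → E} (hm : Measurable f)
    (hf : Integrable f P) (hf2 : Integrable (fun s => ‖f s‖ ^ 2) P) (h0 : ∫ s, f s ∂P = 0)
    (m : ℕ) (a : E) :
    ∫⁻ S : Fin m → Ξ, ENNReal.ofReal (‖a + ∑ i, f (S i)‖ ^ 2) ∂(Measure.pi fun _ => P)
      = ENNReal.ofReal (‖a‖ ^ 2 + m * ∫ s, ‖f s‖ ^ 2 ∂P) := by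
  have hV : 0 ≤ ∫ s, ‖f s‖ ^ 2 ∂P := integral_nonneg fun _ => sq_nonneg _
  induction m generalizing a with
  | zero => simp
  | succ m ih =>
    have hmp := (measurePreserving_piFinSuccAbove (fun _ : Fin (m + 1) => P) 0).symm
    rw [← hmp.lintegral_comp_emb (MeasurableEquiv.measurableEmbedding _)]
    have hmeas : Measurable fun q : Ξ × (Fin m → Ξ) =>
        ENNReal.ofReal (‖(a + f q.1) + ∑ i, f (q.2 i)‖ ^ 2) := by
      have : ∀ i : Fin m, Measurable fun q : Ξ × (Fin m → Ξ) => f (q.2 i) := fun i =>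
        hm.comp ((measurable_pi_apply i).comp measurable_snd)
      have h2 : Measurable fun q : Ξ × (Fin m → Ξ) => f q.1 := hm.comp measurable_fst
      exact ((((measurable_const.add h2).add
        (Finset.measurable_fun_sum _ fun i _ => this i)).norm.pow_const 2)).ennreal_ofReal
    have e : ∀ q : Ξ × (Fin m → Ξ),
        ENNReal.ofReal (‖a + ∑ i, f ((MeasurableEquiv.piFinSuccAbove
          (fun _ : Fin (m + 1) => Ξ) 0).symm q i)‖ ^ 2)
        = ENNReal.ofReal (‖(a + f q.1) + ∑ i, f (q.2 i)‖ ^ 2) := by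
      intro q
      rw [Fin.sum_univ_succ, ← add_assoc]
      rfl
    simp_rw [e]
    rw [lintegral_prod _ hmeas.aemeasurable]
    simp only [ih]
    obtain ⟨hi, hv⟩ := integral_norm_add_sq hf hf2 h0 a
    rw [← ofReal_integral_eq_lintegral_ofReal
      (f := fun s => ‖a + f s‖ ^ 2 + m * ∫ s, ‖f s‖ ^ 2 ∂P) (hi.add (integrable_const _))
      (Filter.Eventually.of_forall fun s => add_nonneg (sq_nonneg _)
        (mul_nonneg (Nat.cast_nonneg _) hV)),
      integral_add hi (integrable_const _), hv]
    simp only [integral_const, smul_eq_mul, probReal_univ, one_mul]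
    congr 1; push_cast; ring

end sampling

section oracle

variable {p : ℕ} {Ξ : Type*} [MeasurableSpace Ξ] {P : Measure Ξ}
  {F : Vec p → Vec p} {Fo : Vec p → Ξ → Vec p} {σ L : ℝ}

/-- The mean squared difference of the oracle at two points. -/
noncomputable def oracleGap (P : Measure Ξ) (Fo : Vec p → Ξ → Vec p) (x y : Vec p) : ℝ :=
  ∫ s, ‖Fo x s - Fo y s‖ ^ 2 ∂P

lemma oracleGap_nonneg (x y : Vec p) : 0 ≤ oracleGap P Fo x y :=
  integral_nonneg fun _ => sq_nonneg _

@[simp] lemma oracleGap_self (x : Vec p) : oracleGap P Fo x x = 0 := by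
  simp [oracleGap]

namespace IsUnbiasedOracle

variable (h : IsUnbiasedOracle P F Fo σ)
include h

lemma measurable_apply (x : Vec p) : Measurable (Fo x) :=
  h.measurable.comp (measurable_const.prodMk measurable_id)

variable [IsProbabilityMeasure P]

lemma integrable_gap (x y : Vec p) : Integrable (fun s => ‖Fo x s - Fo y s‖ ^ 2) P := by
  have hd : ∀ x, MemLp (fun s => Fo x s - F x) 2 P := fun x =>
    (memLp_two_iff_integrable_sq_norm ((h.integrable x).sub (integrable_const _)).1).2
      (h.integrable_sq x)
  have h1 : MemLp (fun s => Fo x s - Fo y s) 2 P := by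
    have e : (fun s => Fo x s - Fo y s)
        = (fun s => Fo x s - F x) - (fun s => Fo y s - F y) + fun _ => F x - F y := by
      ext1 s
      simp only [Pi.add_apply, Pi.sub_apply]
      abel
    rw [e]
    exact ((hd x).sub (hd y)).add (memLp_const _)
  exact (memLp_two_iff_integrable_sq_norm h1.1).1 h1

lemma measurable_gap : Measurable fun q : Vec p × Vec p => oracleGap P Fo q.1 q.2 := by
  have h1 : Measurable fun q : (Vec p × Vec p) × Ξ => ‖Fo q.1.1 q.2 - Fo q.1.2 q.2‖ ^ 2 := by
    have e1 : Measurable fun q : (Vec p × Vec p) × Ξ => Fo q.1.1 q.2 :=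
      h.measurable.comp (measurable_fst.fst.prodMk measurable_snd)
    have e2 : Measurable fun q : (Vec p × Vec p) × Ξ => Fo q.1.2 q.2 :=
      h.measurable.comp (measurable_fst.snd.prodMk measurable_snd)
    exact (e1.sub e2).norm.pow_const 2
  exact (h1.stronglyMeasurable.integral_prod_right (ν := P)).measurable

lemma integral_centered_gap (x y : Vec p) :
    Integrable (fun s => (Fo x s - Fo y s) - (F x - F y)) P ∧
    ∫ s, ((Fo x s - Fo y s) - (F x - F y)) ∂P = 0 ∧
    Integrable (fun s => ‖(Fo x s - Fo y s) - (F x - F y)‖ ^ 2) P ∧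
    oracleGap P Fo x y
      = ‖F x - F y‖ ^ 2 + ∫ s, ‖(Fo x s - Fo y s) - (F x - F y)‖ ^ 2 ∂P := by
  have hi : Integrable (fun s => Fo x s - Fo y s) P := (h.integrable x).sub (h.integrable y)
  have h1 : Integrable (fun s => (Fo x s - Fo y s) - (F x - F y)) P :=
    hi.sub (integrable_const _)
  have h2 : ∫ s, ((Fo x s - Fo y s) - (F x - F y)) ∂P = 0 := by
    rw [integral_sub hi (integrable_const _), integral_sub (h.integrable x) (h.integrable y),
      h.unbiased, h.unbiased]
    simp
  have hm : MemLp (fun s => (Fo x s - Fo y s) - (F x - F y)) 2 P :=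
    ((memLp_two_iff_integrable_sq_norm hi.1).2 (h.integrable_gap x y)).sub (memLp_const _)
  have h3 := (memLp_two_iff_integrable_sq_norm h1.1).1 hm
  refine ⟨h1, h2, h3, ?_⟩
  rw [← (integral_norm_add_sq h1 h3 h2 (F x - F y)).2]
  simp [oracleGap]

lemma sq_norm_sub_le_gap (x y : Vec p) : ‖F x - F y‖ ^ 2 ≤ oracleGap P Fo x y := by
  rw [(h.integral_centered_gap x y).2.2.2]
  exact le_add_of_nonneg_right (integral_nonneg fun _ => sq_nonneg _)

/-- Young's inequality for the oracle gaps between three points. -/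
lemma gap_le {c : ℝ} (hc : 0 < c) (x y w : Vec p) :
    oracleGap P Fo x w ≤ (1 + c) * oracleGap P Fo y w + (1 + 1 / c) * oracleGap P Fo x y := by
  unfold oracleGap
  rw [← integral_const_mul, ← integral_const_mul,
    ← integral_add ((h.integrable_gap y w).const_mul _) ((h.integrable_gap x y).const_mul _)]
  refine integral_mono (h.integrable_gap x w)
    (((h.integrable_gap y w).const_mul _).add ((h.integrable_gap x y).const_mul _)) fun s => ?_
  have e : Fo x s - Fo w s = (Fo y s - Fo w s) + (Fo x s - Fo y s) := by abel
  simp only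
  rw [e, norm_add_sq_real]
  have := two_mul_inner_le (a := c) (c := 1 / c) (m := 1) hc.le (by positivity)
    (by field_simp; norm_num) (Fo y s - Fo w s) (Fo x s - Fo y s)
  linarith

/-- Co-coercivity in expectation makes `F` Lipschitz continuous with constant `L`. -/
lemma continuous (hco : CocoerciveInExpectation P F Fo L) (hL : 0 < L) : Continuous F := by
  refine (LipschitzWith.of_dist_le_mul (K := L.toNNReal) fun x y => ?_).continuous
  rw [dist_eq_norm, dist_eq_norm, Real.coe_toNNReal _ hL.le]
  have h1 := hco x y
  have h2 := h.sq_norm_sub_le_gap x y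
  have h3 := real_inner_le_norm (F x - F y) (x - y)
  have h4 : 1 / L * ‖F x - F y‖ ^ 2 ≤ ‖F x - F y‖ * ‖x - y‖ :=
    (mul_le_mul_of_nonneg_left h2 (by positivity)).trans (h1.trans h3)
  rcases (norm_nonneg (F x - F y)).eq_or_lt with h5 | h5
  · rw [← h5]; positivity
  · rw [one_div, inv_mul_le_iff₀ hL] at h4
    nlinarith

/-- The error of a mega-batch average. -/
lemma lintegral_batchMean_sub_sq_le {m : ℕ} (hm : 1 ≤ m) (x : Vec p) :
    ∫⁻ S, ENNReal.ofReal (‖batchMean Fo x S - F x‖ ^ 2) ∂(Measure.pi fun _ : Fin m => P)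
      ≤ ENNReal.ofReal (σ ^ 2 / m) := by
  have hm0 : (0 : ℝ) < m := by exact_mod_cast hm
  have hi : Integrable (fun s => Fo x s - F x) P := (h.integrable x).sub (integrable_const _)
  have e : ∀ S : Fin m → Ξ, batchMean Fo x S - F x
      = 0 + ∑ i, (1 / (m : ℝ)) • (Fo x (S i) - F x) := by
    intro S
    rw [← Finset.smul_sum, Finset.sum_sub_distrib, smul_sub, batchMean]
    simp [← Nat.cast_smul_eq_nsmul ℝ, smul_smul, hm0.ne']
  simp_rw [e]
  have hsq : ∀ s, ‖(1 / (m : ℝ)) • (Fo x s - F x)‖ ^ 2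
      = (1 / (m : ℝ)) ^ 2 * ‖Fo x s - F x‖ ^ 2 := by
    intro s; rw [norm_smul, mul_pow, Real.norm_of_nonneg (by positivity)]
  rw [lintegral_norm_add_sum_sq (f := fun s => (1 / (m : ℝ)) • (Fo x s - F x))
    (((h.measurable_apply x).sub measurable_const).fun_const_smul (1 / (m : ℝ)))
    (Integrable.fun_smul (1 / (m : ℝ)) hi)
    (by simp_rw [hsq]; exact (h.integrable_sq x).const_mul _) (by
      rw [integral_smul, integral_sub (h.integrable x) (integrable_const _), h.unbiased]
      simp)]
  refine ENNReal.ofReal_le_ofReal ?_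
  simp_rw [hsq]
  rw [integral_const_mul]
  have := h.variance_le x
  calc _ = (∫ s, ‖Fo x s - F x‖ ^ 2 ∂P) / m := by field_simp; simp
    _ ≤ σ ^ 2 / m := by gcongr

/-- The mini-batch correction is unbiased, so that its error adds up with an independent error
`a` in the mean square. -/
lemma lintegral_add_batchMean_sub_sq_le {m : ℕ} (hm : 1 ≤ m) (x y a : Vec p) :
    ∫⁻ S, ENNReal.ofReal (‖a + ((batchMean Fo x S - batchMean Fo y S) - (F x - F y))‖ ^ 2)
        ∂(Measure.pi fun _ : Fin m => P)
      ≤ ENNReal.ofReal (‖a‖ ^ 2 + oracleGap P Fo x y / m) := by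
  have hm0 : (0 : ℝ) < m := by exact_mod_cast hm
  obtain ⟨hi, h0, hi2, hgap⟩ := h.integral_centered_gap x y
  have e : ∀ S : Fin m → Ξ, (batchMean Fo x S - batchMean Fo y S) - (F x - F y)
      = ∑ i, (1 / (m : ℝ)) • ((Fo x (S i) - Fo y (S i)) - (F x - F y)) := by
    intro S
    rw [← Finset.smul_sum, Finset.sum_sub_distrib, smul_sub, Finset.sum_sub_distrib, smul_sub,
      batchMean, batchMean, Finset.sum_const, Finset.card_univ, Fintype.card_fin,
      ← Nat.cast_smul_eq_nsmul ℝ, smul_smul, one_div_mul_cancel hm0.ne', one_smul]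
  simp_rw [e]
  have hsq : ∀ s, ‖(1 / (m : ℝ)) • ((Fo x s - Fo y s) - (F x - F y))‖ ^ 2
      = (1 / (m : ℝ)) ^ 2 * ‖(Fo x s - Fo y s) - (F x - F y)‖ ^ 2 := by
    intro s; rw [norm_smul, mul_pow, Real.norm_of_nonneg (by positivity)]
  rw [lintegral_norm_add_sum_sq
    (f := fun s => (1 / (m : ℝ)) • ((Fo x s - Fo y s) - (F x - F y)))
    ((((h.measurable_apply x).sub (h.measurable_apply y)).sub
      measurable_const).fun_const_smul (1 / (m : ℝ)))
    (Integrable.fun_smul (1 / (m : ℝ)) hi) (by simp_rw [hsq]; exact hi2.const_mul _)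
    (by rw [integral_smul, h0, smul_zero])]
  refine ENNReal.ofReal_le_ofReal ?_
  simp_rw [hsq]
  rw [integral_const_mul]
  have h1 : ∫ s, ‖(Fo x s - Fo y s) - (F x - F y)‖ ^ 2 ∂P ≤ oracleGap P Fo x y := by
    rw [hgap]; exact le_add_of_nonneg_left (sq_nonneg _)
  calc _ = ‖a‖ ^ 2 + (∫ s, ‖(Fo x s - Fo y s) - (F x - F y)‖ ^ 2 ∂P) / m := by field_simp
    _ ≤ _ := by gcongr

end IsUnbiasedOracle

end oracle

/-! ### One iteration of the method -/

/-- The standing assumptions on the parameters and on the problem. -/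
structure Setting {p : ℕ} {Ξ : Type*} [MeasurableSpace Ξ] (L Lhat ρ lam μ r β σ : ℝ)
    (P : Measure Ξ) (F : Vec p → Vec p) (Fo : Vec p → Ξ → Vec p) (T : Vec p → Set (Vec p))
    (xstar : Vec p) : Prop where
  L_pos : 0 < L
  L_lt : L < Lhat
  Lhat_mul_lt : Lhat * ρ < 1
  lam_pos : 0 < lam
  lam_ge : 2 * ρ ≤ lam
  μ_pos : 0 < μ
  μ_lt : μ < 2 / 3
  lt_r : 5 + 1 / μ < r
  β_pos : 0 < β
  β_le : β ≤ (2 - μ) * betaBar Lhat ρ lam / (2 + μ)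
  oracle : IsUnbiasedOracle P F Fo σ
  cocoercive : CocoerciveInExpectation P F Fo L
  maximal : MaximallyCoHypomonotone ρ T
  solution : xstar ∈ zer F T

/-- The gradient estimate of an iteration that leads from `s` to `s'`. -/
noncomputable def estimate {p b n : ℕ} {Ξ : Type*} (Fo : Vec p → Ξ → Vec p) (d : Draw Ξ b n)
    (s s' : State p) : Vec p :=
  s'.anchor + batchMean Fo s.x d.1 - batchMean Fo s'.snap d.1

/-- The Lyapunov function of a state at the start of iteration `k`. -/
noncomputable def statePotential {p : ℕ} (F : Vec p → Vec p) (T : Vec p → Set (Vec p))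
    (xstar : Vec p) (lam μ r β : ℝ) (k : ℕ) (s : State p) : ℝ :=
  potential μ β (tSeq μ r k) (fbsResidual lam F T s.x) (s.x - s.z) (s.z - xstar)

/-- The scaled squared distance of `z` to the solution at the start of iteration `k`. -/
noncomputable def stateEnergy {p : ℕ} (xstar : Vec p) (μ r β : ℝ) (k : ℕ) (s : State p) : ℝ :=
  anchorEnergy μ β (tSeq μ r k) (s.z - xstar)

/-- The weight of the errors of iteration `k`. -/
noncomputable def weight (μ r : ℝ) (k : ℕ) : ℝ := tSeq μ r k * (tSeq μ r k - 1)

lemma tSeq_succ (μ r : ℝ) (k : ℕ) : tSeq μ r (k + 1) = tSeq μ r k + μ := by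
  simp only [tSeq]; push_cast; ring

namespace Setting

variable {p : ℕ} {Ξ : Type*} [MeasurableSpace Ξ] {L Lhat ρ lam μ r β σ : ℝ}
  {P : Measure Ξ} {F : Vec p → Vec p} {Fo : Vec p → Ξ → Vec p} {T : Vec p → Set (Vec p)}
  {xstar : Vec p} (h : Setting L Lhat ρ lam μ r β σ P F Fo T xstar)
include h

lemma lt_tSeq (k : ℕ) : 1 + 5 * μ < tSeq μ r k := by
  have h1 := mul_lt_mul_of_pos_left h.lt_r h.μ_pos
  rw [mul_add, mul_one_div_cancel h.μ_pos.ne'] at h1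
  have h2 : 0 ≤ μ * k := mul_nonneg h.μ_pos.le (Nat.cast_nonneg k)
  rw [tSeq, mul_add]
  linarith

lemma weight_pos (k : ℕ) : 0 < weight μ r k := by
  have h1 := h.lt_tSeq k
  have h2 := h.μ_pos
  exact mul_pos (by linarith) (by linarith)

lemma mul_le_betaBar : (2 + μ) / (2 - μ) * β ≤ betaBar Lhat ρ lam := by
  have h1 := h.β_le
  have h2 := h.μ_pos
  have h3 : 0 < 2 - μ := by linarith [h.μ_lt]
  rw [le_div_iff₀ (by linarith)] at h1
  rw [div_mul_eq_mul_div, div_le_iff₀ h3]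
  linarith

lemma Lam_pos : 0 < Lam L Lhat := by
  have h1 := h.L_pos
  have h2 := h.L_lt
  exact div_pos (by linarith) (mul_pos h1 (h1.trans h2))

lemma continuous_residual [IsProbabilityMeasure P] : Continuous (fbsResidual lam F T) :=
  continuous_fbsResidual h.maximal h.lam_pos h.lam_ge
    (h.oracle.continuous h.cocoercive h.L_pos)

lemma residual_cocoercive [IsProbabilityMeasure P] (x y : Vec p) :
    betaBar Lhat ρ lam * ‖fbsResidual lam F T x - fbsResidual lam F T y‖ ^ 2
        + Lam L Lhat * oracleGap P Fo x y
      ≤ inner ℝ (fbsResidual lam F T x - fbsResidual lam F T y) (x - y) :=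
  fbsResidual_cocoercive h.maximal h.lam_pos h.lam_ge h.L_pos h.L_lt h.Lhat_mul_lt
    (h.cocoercive x y) (h.oracle.sq_norm_sub_le_gap x y)

/-- Co-coercivity of the residual between `x` and the solution, split at the anchor point `z`. -/
lemma residual_solution [IsProbabilityMeasure P] (x z : Vec p) :
    betaBar Lhat ρ lam * ‖fbsResidual lam F T x‖ ^ 2
      ≤ inner ℝ (fbsResidual lam F T x) ((x - z) + (z - xstar)) := by
  have h1 := h.residual_cocoercive x xstar
  rw [fbsResidual_eq_zero h.maximal h.lam_pos h.lam_ge h.solution, sub_zero] at h1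
  rw [sub_add_sub_cancel]
  exact le_trans (le_add_of_nonneg_right
    (mul_nonneg h.Lam_pos.le (oracleGap_nonneg _ _))) h1

lemma statePotential_nonneg [IsProbabilityMeasure P] (k : ℕ) (s : State p) :
    0 ≤ statePotential F T xstar lam μ r β k s :=
  potential_nonneg h.β_pos h.μ_pos h.μ_lt (h.lt_tSeq k) h.mul_le_betaBar
    (h.residual_solution _ _)

lemma stateEnergy_nonneg (k : ℕ) (s : State p) : 0 ≤ stateEnergy xstar μ r β k s := by
  have := eta_pos h.β_pos h.μ_pos h.μ_lt (h.lt_tSeq k)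
  have := h.β_pos
  unfold stateEnergy anchorEnergy
  positivity

lemma sq_norm_residual_le_state [IsProbabilityMeasure P] (k : ℕ) (s : State p) :
    β * (tSeq μ r k - μ) ^ 2 * ‖fbsResidual lam F T s.x‖ ^ 2
      ≤ 2 * (β * stateEnergy xstar μ r β k s) + 2 * statePotential F T xstar lam μ r β k s :=
  sq_norm_residual_le h.β_pos h.μ_pos h.μ_lt (h.lt_tSeq k) h.mul_le_betaBar
    (h.residual_solution _ _)

variable {b n : ℕ}

/-- In one iteration, `x` and `z` move along the exact residual plus an error that is no larger
than the error of the estimate of `F`. -/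
lemma exists_step_eq (k : ℕ) (d : Draw Ξ b n) (s : State p) :
    ∃ e : Vec p, ‖e‖ ≤ ‖estimate Fo d s (step Fo T lam μ r β k d s) - F s.x‖ ∧
      (step Fo T lam μ r β k d s).x - s.x
        = -((1 / tSeq μ r k) • (s.x - s.z))
          - eta μ β (tSeq μ r k) • (fbsResidual lam F T s.x + e) ∧
      (step Fo T lam μ r β k d s).x - (step Fo T lam μ r β k d s).z
        = ((tSeq μ r k - 1) / tSeq μ r k) • (s.x - s.z)
          - ((1 - μ / 2) * eta μ β (tSeq μ r k)) • (fbsResidual lam F T s.x + e) ∧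
      (step Fo T lam μ r β k d s).z - xstar
        = (s.z - xstar) - (μ / 2 * eta μ β (tSeq μ r k)) • (fbsResidual lam F T s.x + e) := by
  set s' := step Fo T lam μ r β k d s with hs'
  set t := tSeq μ r k with ht
  have ht0 : t ≠ 0 := by linarith [h.lt_tSeq k, h.μ_pos]
  set w := (1 / lam) • (s.x - resolvent lam T (s.x - lam • estimate Fo d s s')) with hw
  have hx : s'.x = (((t - 1) / t) • s.x + (1 / t) • s.z) - eta μ β t • w := rfl
  have hz : s'.z = s.z + (μ / 2) • (s'.x - (((t - 1) / t) • s.x + (1 / t) • s.z)) := rfl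
  have ht1 : (t - 1) / t = 1 - 1 / t := by rw [sub_div, div_self ht0]
  refine ⟨w - fbsResidual lam F T s.x,
    norm_residual_error_le h.maximal h.lam_pos h.lam_ge _ _, ?_, ?_, ?_⟩
  · rw [add_sub_cancel, hx, ht1]; module
  · rw [add_sub_cancel, hz, hx, ht1]; module
  · rw [add_sub_cancel, hz, hx, ht1]; module

lemma statePotential_step [IsProbabilityMeasure P] (k : ℕ) (d : Draw Ξ b n) (s : State p) :
    statePotential F T xstar lam μ r β (k + 1) (step Fo T lam μ r β k d s)
        + weight μ r k * (Lam L Lhat * oracleGap P Fo (step Fo T lam μ r β k d s).x s.x)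
      ≤ statePotential F T xstar lam μ r β k s + 5 * β / (3 * μ) * weight μ r k
          * ‖estimate Fo d s (step Fo T lam μ r β k d s) - F s.x‖ ^ 2 := by
  obtain ⟨e, he, h1, h2, h3⟩ := h.exists_step_eq k d s
  have hco := h.residual_cocoercive (step Fo T lam μ r β k d s).x s.x
  rw [h1] at hco
  have := potential_step h.β_pos h.μ_pos h.μ_lt (h.lt_tSeq k) h.mul_le_betaBar hco
    (h.residual_solution s.x s.z)
  unfold statePotential
  rw [tSeq_succ, h2, h3]
  refine this.trans (add_le_add_right ?_ _)
  have hw := h.weight_pos k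
  have hμ := h.μ_pos
  have hβ := h.β_pos
  unfold weight at hw ⊢
  gcongr

lemma stateEnergy_step [IsProbabilityMeasure P] (k : ℕ) (d : Draw Ξ b n) (s : State p) :
    stateEnergy xstar μ r β (k + 1) (step Fo T lam μ r β k d s)
      ≤ (1 - μ / 2 / (tSeq μ r k - μ)) * stateEnergy xstar μ r β k s
        + μ / 2 / (tSeq μ r k - μ) * (statePotential F T xstar lam μ r β k s / β)
        + 1 / 4 * weight μ r k * ‖estimate Fo d s (step Fo T lam μ r β k d s) - F s.x‖ ^ 2 := by
  obtain ⟨e, he, -, -, h3⟩ := h.exists_step_eq k d s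
  have := anchorEnergy_step h.β_pos h.μ_pos h.μ_lt (h.lt_tSeq k) h.mul_le_betaBar (e := e)
    (h.residual_solution s.x s.z)
  unfold stateEnergy
  rw [tSeq_succ, h3]
  refine this.trans (add_le_add_right ?_ _)
  have hw := h.weight_pos k
  unfold weight at hw ⊢
  gcongr

/-- `psi0` bounds both Lyapunov functions of the initial state. -/
lemma initial_le (x0 : Vec p) :
    statePotential F T xstar lam μ r β 0 (initState x0)
        ≤ β * psi0 F T lam μ r β x0 xstar ^ 2 ∧
      stateEnergy xstar μ r β 0 (initState x0) ≤ psi0 F T lam μ r β x0 xstar ^ 2 := by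
  have hμ := h.μ_pos
  have hμ' := h.μ_lt
  have hβ := h.β_pos
  have ht := h.lt_tSeq 0
  have ht0 : tSeq μ r 0 = μ * r := by simp [tSeq]
  rw [ht0] at ht
  have h1 : 0 < μ * r - 1 := by linarith
  have hr : 1 < r := by nlinarith
  have h2r : 0 < 2 * r - 1 := by linarith
  have h2 : (1 : ℝ) / eta μ β (μ * r) = μ * β * ((2 * r - 1) / (4 * β ^ 2 * (μ * r - 1))) := by
    rw [eta, one_div_div, show μ * r - μ / 2 = μ * (2 * r - 1) / 2 by ring]
    field_simp; ring
  have hc : 0 < (2 * r - 1) / (4 * β ^ 2 * (μ * r - 1)) := by positivity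
  set c := (2 * r - 1) / (4 * β ^ 2 * (μ * r - 1)) with hcdef
  have hpsi : psi0 F T lam μ r β x0 xstar ^ 2
      = μ ^ 2 * r ^ 2 * ‖fbsResidual lam F T x0‖ ^ 2 + c * ‖x0 - xstar‖ ^ 2 := by
    rw [psi0, Real.sq_sqrt (by positivity)]
  rw [hpsi]
  constructor
  · simp only [statePotential, potential, initState, ht0, sub_self, inner_zero_right, mul_zero,
      add_zero]
    have e1 : (1 - μ) / μ / eta μ β (μ * r) = (1 - μ) * (β * c) := by
      rw [div_eq_mul_one_div, h2]; field_simp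
    rw [e1]
    have e2 : (μ * r - μ) * (μ * r - μ - 1) ≤ μ ^ 2 * r ^ 2 := by nlinarith
    have e3 := mul_le_mul_of_nonneg_left e2 hβ.le
    have e4 := mul_le_mul_of_nonneg_right e3 (sq_nonneg ‖fbsResidual lam F T x0‖)
    have e5 : 0 ≤ μ * (β * c) * ‖x0 - xstar‖ ^ 2 := by positivity
    nlinarith
  · simp only [stateEnergy, anchorEnergy, initState, ht0]
    have e1 : ‖x0 - xstar‖ ^ 2 / (2 * β * eta μ β (μ * r)) = μ / 2 * (c * ‖x0 - xstar‖ ^ 2) := by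
      rw [← div_div, div_eq_mul_one_div, h2]; field_simp
    rw [e1]
    have e2 : 0 ≤ c * ‖x0 - xstar‖ ^ 2 := by positivity
    have e3 : 0 ≤ μ ^ 2 * r ^ 2 * ‖fbsResidual lam F T x0‖ ^ 2 := by positivity
    nlinarith

end Setting

/-! ### The method as a random process -/

/-- The vectors of a state determine its σ-algebra; the counter `calls` is left out, since its
expectation is computed from the coins alone. -/
instance instMeasurableSpaceState (p : ℕ) : MeasurableSpace (State p) :=
  MeasurableSpace.comap (fun s => (s.x, s.z, s.xprev, s.snap, s.anchor)) inferInstance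

section measurability

variable {p : ℕ}

lemma State.measurable_vectors :
    Measurable fun s : State p => (s.x, s.z, s.xprev, s.snap, s.anchor) :=
  comap_measurable _

lemma State.measurable_x : Measurable fun s : State p => s.x := measurable_vectors.fst
lemma State.measurable_z : Measurable fun s : State p => s.z := measurable_vectors.snd.fst
lemma State.measurable_xprev : Measurable fun s : State p => s.xprev :=
  measurable_vectors.snd.snd.fst
lemma State.measurable_snap : Measurable fun s : State p => s.snap :=
  measurable_vectors.snd.snd.snd.fst
lemma State.measurable_anchor : Measurable fun s : State p => s.anchor :=
  measurable_vectors.snd.snd.snd.snd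

variable {Ξ : Type*} [MeasurableSpace Ξ] {Fo : Vec p → Ξ → Vec p} {T : Vec p → Set (Vec p)}

lemma measurable_batchMean (hFo : Measurable fun q : Vec p × Ξ => Fo q.1 q.2) {α : Type*}
    [MeasurableSpace α] {m : ℕ} {u : α → Vec p} {S : α → Fin m → Ξ} (hu : Measurable u)
    (hS : Measurable S) : Measurable fun a => batchMean Fo (u a) (S a) := by
  unfold batchMean
  refine Measurable.fun_const_smul (Finset.measurable_fun_sum _ fun i _ => ?_) _
  exact hFo.comp (hu.prodMk ((measurable_pi_apply i).comp hS))

lemma measurable_step (hFo : Measurable fun q : Vec p × Ξ => Fo q.1 q.2) {lam : ℝ}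
    (hJ : Measurable (resolvent lam T)) (μ r β : ℝ) (b n k : ℕ) :
    Measurable fun q : Draw Ξ b n × State p => step Fo T lam μ r β k q.1 q.2 := by
  have hx : Measurable fun q : Draw Ξ b n × State p => q.2.x :=
    State.measurable_x.comp measurable_snd
  have hz : Measurable fun q : Draw Ξ b n × State p => q.2.z :=
    State.measurable_z.comp measurable_snd
  have hxp : Measurable fun q : Draw Ξ b n × State p => q.2.xprev :=
    State.measurable_xprev.comp measurable_snd
  have hsn : Measurable fun q : Draw Ξ b n × State p => q.2.snap :=
    State.measurable_snap.comp measurable_snd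
  have han : Measurable fun q : Draw Ξ b n × State p => q.2.anchor :=
    State.measurable_anchor.comp measurable_snd
  have hmini : Measurable fun q : Draw Ξ b n × State p => q.1.1 := measurable_fst.fst
  have hmega : Measurable fun q : Draw Ξ b n × State p => q.1.2.1 := measurable_fst.snd.fst
  have hcoin : Measurable fun q : Draw Ξ b n × State p => (decide (k = 0) || q.1.2.2) :=
    (measurable_of_finite fun c : Bool => (decide (k = 0) || c)).comp measurable_fst.snd.snd
  have hset : MeasurableSet {q : Draw Ξ b n × State p | (decide (k = 0) || q.1.2.2) = true} :=
    hcoin (measurableSet_singleton true)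
  have hsnap : Measurable fun q : Draw Ξ b n × State p =>
      (step Fo T lam μ r β k q.1 q.2).snap := Measurable.ite hset hxp hsn
  have hanchor : Measurable fun q : Draw Ξ b n × State p =>
      (step Fo T lam μ r β k q.1 q.2).anchor :=
    Measurable.ite hset (measurable_batchMean hFo hsnap hmega) han
  have hest := (hanchor.add (measurable_batchMean hFo hx hmini)).sub
    (measurable_batchMean hFo hsnap hmini)
  have hy : Measurable fun q : Draw Ξ b n × State p =>
      ((tSeq μ r k - 1) / tSeq μ r k) • q.2.x + (1 / tSeq μ r k) • q.2.z :=
    (hx.fun_const_smul _).add (hz.fun_const_smul _)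
  have hxnew : Measurable fun q : Draw Ξ b n × State p => (step Fo T lam μ r β k q.1 q.2).x :=
    hy.sub (((hx.sub (hJ.comp (hx.sub (hest.const_smul lam)))).const_smul (1 / lam)).const_smul
      (etaSeq μ r β k))
  have hznew : Measurable fun q : Draw Ξ b n × State p => (step Fo T lam μ r β k q.1 q.2).z :=
    hz.add ((hxnew.sub hy).const_smul (μ / 2))
  exact measurable_comap_iff.2
    (hxnew.prodMk (hznew.prodMk (hx.prodMk (hsnap.prodMk hanchor))))

end measurability

instance (q : ℝ) : IsFiniteMeasure (coinLaw q) := by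
  constructor
  simp [coinLaw, ENNReal.add_lt_top]

lemma lintegral_coinLaw (q : ℝ) (f : Bool → ENNReal) :
    ∫⁻ c, f c ∂(coinLaw q) = ENNReal.ofReal q * f true + ENNReal.ofReal (1 - q) * f false := by
  rw [coinLaw, lintegral_add_measure, lintegral_smul_measure, lintegral_smul_measure,
    lintegral_dirac, lintegral_dirac]
  rfl

section drawLaw

variable {Ξ : Type*} [MeasurableSpace Ξ] {P : Measure Ξ} [IsProbabilityMeasure P] {b n : ℕ}

instance (q : ℝ) : IsFiniteMeasure (drawLaw P b n q) := by
  unfold drawLaw; infer_instance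

lemma lintegral_drawLaw (q : ℝ) {f : Draw Ξ b n → ENNReal} (hf : Measurable f) :
    ∫⁻ d, f d ∂(drawLaw P b n q)
      = ENNReal.ofReal q * ∫⁻ S : Fin n → Ξ, ∫⁻ B : Fin b → Ξ, f (B, S, true)
          ∂(Measure.pi fun _ => P) ∂(Measure.pi fun _ => P)
        + ENNReal.ofReal (1 - q) * ∫⁻ S : Fin n → Ξ, ∫⁻ B : Fin b → Ξ, f (B, S, false)
          ∂(Measure.pi fun _ => P) ∂(Measure.pi fun _ => P) := by
  rw [drawLaw, lintegral_prod_symm _ hf.aemeasurable, lintegral_prod_symm _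
    (Measurable.lintegral_prod_left' hf).aemeasurable, lintegral_coinLaw]

end drawLaw

section process

variable {p : ℕ} {Ξ : Type*} [MeasurableSpace Ξ] {P : Measure Ξ} [IsProbabilityMeasure P]
  {Fo : Vec p → Ξ → Vec p} {T : Vec p → Set (Vec p)} {lam μ r β : ℝ} {x0 : Vec p}
  {b n : ℕ} {Ω : Type*} {D : ℕ → Ω → Draw Ξ b n}

/-- The state before iteration `k` depends on the draws of the earlier iterations only. -/
lemma measurable_run_iSup (hFo : Measurable fun q : Vec p × Ξ => Fo q.1 q.2)
    (hJ : Measurable (resolvent lam T)) (k : ℕ) :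
    Measurable[⨆ i ∈ Set.Iio k, MeasurableSpace.comap (D i) inferInstance]
      fun ω => run Fo T lam μ r β x0 (fun j => D j ω) k := by
  induction k with
  | zero => exact measurable_const
  | succ k ih =>
    have h1 : Measurable[⨆ i ∈ Set.Iio (k + 1), MeasurableSpace.comap (D i) inferInstance]
        fun ω => run Fo T lam μ r β x0 (fun j => D j ω) k :=
      ih.mono (biSup_mono fun i hi => Nat.lt_succ_of_lt hi) le_rfl
    have h2 : Measurable[⨆ i ∈ Set.Iio (k + 1), MeasurableSpace.comap (D i) inferInstance]
        (D k) := by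
      refine Measurable.mono (comap_measurable (D k)) ?_ le_rfl
      exact le_biSup (fun i => MeasurableSpace.comap (D i) inferInstance)
        (Set.mem_Iio.2 (Nat.lt_succ_self k))
    have h3 : (fun ω => run Fo T lam μ r β x0 (fun j => D j ω) (k + 1))
        = (fun q : Draw Ξ b n × State p => step Fo T lam μ r β k q.1 q.2) ∘
          fun ω => (D k ω, run Fo T lam μ r β x0 (fun j => D j ω) k) := rfl
    rw [h3]
    exact Measurable.comp (measurable_step hFo hJ μ r β b n k) (Measurable.prodMk h2 h1)

variable [MeasurableSpace Ω] {Q : Measure Ω} [IsProbabilityMeasure Q]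

lemma measurable_run (hFo : Measurable fun q : Vec p × Ξ => Fo q.1 q.2)
    (hJ : Measurable (resolvent lam T)) (hD : ∀ k, Measurable (D k)) (k : ℕ) :
    Measurable fun ω => run Fo T lam μ r β x0 (fun j => D j ω) k :=
  (measurable_run_iSup hFo hJ k).mono
    (iSup₂_le fun i _ => (hD i).comap_le) le_rfl

/-- The draw of iteration `k` can be integrated out with the state frozen. -/
lemma lintegral_draw_run (hFo : Measurable fun q : Vec p × Ξ => Fo q.1 q.2)
    (hJ : Measurable (resolvent lam T)) (hD : ∀ k, Measurable (D k)) {q : ℕ → ℝ}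
    (hlaw : ∀ k, Q.map (D k) = drawLaw P b n (q k)) (hind : iIndepFun D Q) (k : ℕ)
    {f : Draw Ξ b n × State p → ENNReal} (hf : Measurable f) :
    ∫⁻ ω, f (D k ω, run Fo T lam μ r β x0 (fun j => D j ω) k) ∂Q
      = ∫⁻ ω, ∫⁻ d, f (d, run Fo T lam μ r β x0 (fun j => D j ω) k) ∂(drawLaw P b n (q k)) ∂Q := by
  have hS := measurable_run (μ := μ) (r := r) (β := β) (x0 := x0) hFo hJ hD k
  have h1 : IndepFun (D k) (fun ω => run Fo T lam μ r β x0 (fun j => D j ω) k) Q := by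
    have h2 := indep_iSup_of_disjoint (fun i => (hD i).comap_le) hind
      (S := {k}) (T := Set.Iio k) (by simp)
    rw [IndepFun_iff_Indep]
    refine indep_of_indep_of_le_left (indep_of_indep_of_le_right h2 ?_) ?_
    · exact (measurable_run_iSup hFo hJ k).comap_le
    · simp
  have h3 := (indepFun_iff_map_prod_eq_prod_map_map (hD k).aemeasurable hS.aemeasurable).1 h1
  rw [hlaw] at h3
  calc _ = ∫⁻ y, f y ∂(Q.map fun ω =>
        (D k ω, run Fo T lam μ r β x0 (fun j => D j ω) k)) :=
        (lintegral_map hf ((hD k).prodMk hS)).symm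
    _ = _ := by
        rw [h3]
        have := Measure.isProbabilityMeasure_map hS.aemeasurable (μ := Q)
        rw [lintegral_prod_symm _ hf.aemeasurable,
          lintegral_map (Measurable.lintegral_prod_left' hf) hS]

end process

/-! ### The error of the loopless-SVRG estimator -/

/-- The squared error of the stored mega-batch average. -/
noncomputable def anchorError {p : ℕ} (F : Vec p → Vec p) (s : State p) : ℝ :=
  ‖s.anchor - F s.snap‖ ^ 2

/-- The oracle gap between the point at which the last gradient estimate was taken and the
snapshot used for it. -/
noncomputable def snapGap {p : ℕ} {Ξ : Type*} [MeasurableSpace Ξ] (P : Measure Ξ)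
    (Fo : Vec p → Ξ → Vec p) (s : State p) : ℝ :=
  oracleGap P Fo s.xprev s.snap

/-- The oracle gap between the last two iterates. -/
noncomputable def moveGap {p : ℕ} {Ξ : Type*} [MeasurableSpace Ξ] (P : Measure Ξ)
    (Fo : Vec p → Ξ → Vec p) (s : State p) : ℝ :=
  oracleGap P Fo s.x s.xprev

lemma measurable_stateEnergy {p : ℕ} (xstar : Vec p) (μ r β : ℝ) (k : ℕ) :
    Measurable fun s : State p => stateEnergy xstar μ r β k s :=
  ((State.measurable_z.sub_const _).norm.pow_const 2).div_const _

/-- The first gradient estimate is taken at the snapshot. -/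
lemma lintegral_snapGap_zero {p b n : ℕ} {Ξ : Type*} [MeasurableSpace Ξ] {lam μ r β : ℝ}
    {P : Measure Ξ} {Fo : Vec p → Ξ → Vec p} {T : Vec p → Set (Vec p)} (q : ℝ) {s : State p}
    (hs : s.xprev = s.x) :
    ∫⁻ d : Draw Ξ b n, ENNReal.ofReal (snapGap P Fo (step Fo T lam μ r β 0 d s))
        ∂(drawLaw P b n q) = 0 := by
  have e1 : ∀ d : Draw Ξ b n, snapGap P Fo (step Fo T lam μ r β 0 d s) = 0 := by
    intro d; simp [snapGap, step, hs]
  simp [e1]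

namespace Setting

variable {p : ℕ} {Ξ : Type*} [MeasurableSpace Ξ] {L Lhat ρ lam μ r β σ : ℝ}
  {P : Measure Ξ} {F : Vec p → Vec p} {Fo : Vec p → Ξ → Vec p} {T : Vec p → Set (Vec p)}
  {xstar : Vec p} (h : Setting L Lhat ρ lam μ r β σ P F Fo T xstar)
include h

lemma measurable_resolvent : Measurable (resolvent lam T) :=
  (continuous_resolvent h.maximal h.lam_pos h.lam_ge).measurable

variable {b n : ℕ}

lemma measurable_step (k : ℕ) :
    Measurable fun q : Draw Ξ b n × State p => step Fo T lam μ r β k q.1 q.2 :=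
  VFOSA.measurable_step h.oracle.measurable h.measurable_resolvent μ r β b n k

lemma measurable_step_left (k : ℕ) (s : State p) :
    Measurable fun d : Draw Ξ b n => step Fo T lam μ r β k d s :=
  Measurable.comp (g := fun q : Draw Ξ b n × State p => step Fo T lam μ r β k q.1 q.2)
    (f := fun d => (d, s)) (h.measurable_step k) measurable_prodMk_right

variable [IsProbabilityMeasure P]

lemma measurable_F : Measurable F :=
  (h.oracle.continuous h.cocoercive h.L_pos).measurable

lemma measurable_statePotential (k : ℕ) :
    Measurable fun s : State p => statePotential F T xstar lam μ r β k s := by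
  have h1 : Measurable fun s : State p => fbsResidual lam F T s.x :=
    h.continuous_residual.measurable.comp State.measurable_x
  have h2 := State.measurable_x.sub (State.measurable_z (p := p))
  have h3 := (State.measurable_z (p := p)).sub_const xstar
  exact ((((h1.norm.pow_const 2).const_mul _).add ((h1.inner h2).const_mul _)).add
    ((h3.norm.pow_const 2).const_mul _))

lemma measurable_anchorError : Measurable (anchorError (p := p) F) :=
  (State.measurable_anchor.sub (h.measurable_F.comp State.measurable_snap)).norm.pow_const 2

lemma measurable_snapGap : Measurable (snapGap (p := p) P Fo) :=
  Measurable.comp (f := fun s : State p => (s.xprev, s.snap)) h.oracle.measurable_gap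
    (State.measurable_xprev.prodMk State.measurable_snap)

lemma measurable_anchorError_step (k : ℕ) (s : State p) :
    Measurable fun d : Draw Ξ b n =>
      ENNReal.ofReal (anchorError F (step Fo T lam μ r β k d s)) :=
  (Measurable.comp (g := anchorError F) h.measurable_anchorError
    (h.measurable_step_left k s)).ennreal_ofReal

lemma measurable_snapGap_step (k : ℕ) (s : State p) :
    Measurable fun d : Draw Ξ b n =>
      ENNReal.ofReal (snapGap P Fo (step Fo T lam μ r β k d s)) :=
  (Measurable.comp (g := snapGap P Fo) h.measurable_snapGap
    (h.measurable_step_left k s)).ennreal_ofReal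

lemma measurable_estimate_error (k : ℕ) :
    Measurable fun q : Draw Ξ b n × State p =>
      ‖estimate Fo q.1 q.2 (step Fo T lam μ r β k q.1 q.2) - F q.2.x‖ ^ 2 := by
  have hx : Measurable fun q : Draw Ξ b n × State p => q.2.x :=
    State.measurable_x.comp measurable_snd
  have hs := h.measurable_step (b := b) (n := n) k
  have h1 := measurable_batchMean h.oracle.measurable hx
    (measurable_fst.fst : Measurable fun q : Draw Ξ b n × State p => q.1.1)
  have h2 := measurable_batchMean h.oracle.measurable (State.measurable_snap.comp hs)
    (measurable_fst.fst : Measurable fun q : Draw Ξ b n × State p => q.1.1)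
  exact ((((State.measurable_anchor.comp hs).add h1).sub h2).sub
    (h.measurable_F.comp hx)).norm.pow_const 2

/-- The mini-batch is independent of the snapshot and of the stored average. -/
lemma lintegral_estimate_error_le (hb : 1 ≤ b) (q : ℝ) (k : ℕ) (s : State p) :
    ∫⁻ d : Draw Ξ b n, ENNReal.ofReal
        (‖estimate Fo d s (step Fo T lam μ r β k d s) - F s.x‖ ^ 2) ∂(drawLaw P b n q)
      ≤ ∫⁻ d : Draw Ξ b n, ENNReal.ofReal (anchorError F (step Fo T lam μ r β k d s)
        + snapGap P Fo (step Fo T lam μ r β k d s) / b) ∂(drawLaw P b n q) := by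
  have hs := h.measurable_step_left (b := b) (n := n) k s
  have m1 : Measurable fun d : Draw Ξ b n => ENNReal.ofReal
      (‖estimate Fo d s (step Fo T lam μ r β k d s) - F s.x‖ ^ 2) :=
    (Measurable.comp (g := fun q : Draw Ξ b n × State p =>
      ‖estimate Fo q.1 q.2 (step Fo T lam μ r β k q.1 q.2) - F q.2.x‖ ^ 2)
      (h.measurable_estimate_error k) measurable_prodMk_right).ennreal_ofReal
  have m2 : Measurable fun d : Draw Ξ b n => ENNReal.ofReal
      (anchorError F (step Fo T lam μ r β k d s)
        + snapGap P Fo (step Fo T lam μ r β k d s) / b) :=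
    ((h.measurable_anchorError.comp hs).add
      ((h.measurable_snapGap.comp hs).div_const _)).ennreal_ofReal
  rw [drawLaw, lintegral_prod_symm _ m1.aemeasurable, lintegral_prod_symm _ m2.aemeasurable]
  refine lintegral_mono fun y => ?_
  set u := if (decide (k = 0) || y.2) = true then s.xprev else s.snap with hu
  set v := if (decide (k = 0) || y.2) = true then batchMean Fo u y.1 else s.anchor with hv
  have e1 : ∀ B : Fin b → Ξ, estimate Fo ((B, y) : Draw Ξ b n) s
      (step Fo T lam μ r β k ((B, y) : Draw Ξ b n) s) - F s.x
      = (v - F u) + ((batchMean Fo s.x B - batchMean Fo u B) - (F s.x - F u)) := by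
    intro B
    have : estimate Fo ((B, y) : Draw Ξ b n) s
      (step Fo T lam μ r β k ((B, y) : Draw Ξ b n) s)
      = v + batchMean Fo s.x B - batchMean Fo u B := rfl
    rw [this]; abel
  have e2 : ∀ B : Fin b → Ξ, anchorError F (step Fo T lam μ r β k ((B, y) : Draw Ξ b n) s)
      + snapGap P Fo (step Fo T lam μ r β k ((B, y) : Draw Ξ b n) s) / b
      = ‖v - F u‖ ^ 2 + oracleGap P Fo s.x u / b := fun B => rfl
  simp only [e1, e2, lintegral_const, measure_univ, mul_one]
  exact h.oracle.lintegral_add_batchMean_sub_sq_le hb s.x u (v - F u)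

lemma lintegral_anchorError_le (hn : 1 ≤ n) (q : ℝ) {k : ℕ} (hk : k ≠ 0) (s : State p) :
    ∫⁻ d : Draw Ξ b n, ENNReal.ofReal (anchorError F (step Fo T lam μ r β k d s))
        ∂(drawLaw P b n q)
      ≤ ENNReal.ofReal q * ENNReal.ofReal (σ ^ 2 / n)
        + ENNReal.ofReal (1 - q) * ENNReal.ofReal (anchorError F s) := by
  rw [lintegral_drawLaw q (h.measurable_anchorError_step k s)]
  have e1 : ∀ (S : Fin n → Ξ) (B : Fin b → Ξ),
      anchorError F (step Fo T lam μ r β k ((B, S, true) : Draw Ξ b n) s)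
        = ‖batchMean Fo s.xprev S - F s.xprev‖ ^ 2 := by
    intro S B; simp [anchorError, step]
  have e2 : ∀ (S : Fin n → Ξ) (B : Fin b → Ξ),
      anchorError F (step Fo T lam μ r β k ((B, S, false) : Draw Ξ b n) s)
        = anchorError F s := by
    intro S B; simp [anchorError, step, hk]
  simp only [e1, e2, lintegral_const, measure_univ, mul_one]
  gcongr
  exact h.oracle.lintegral_batchMean_sub_sq_le hn s.xprev

lemma lintegral_anchorError_zero_le (hn : 1 ≤ n) {q : ℝ} (hq0 : 0 ≤ q) (hq1 : q ≤ 1)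
    (s : State p) :
    ∫⁻ d : Draw Ξ b n, ENNReal.ofReal (anchorError F (step Fo T lam μ r β 0 d s))
        ∂(drawLaw P b n q) ≤ ENNReal.ofReal (σ ^ 2 / n) := by
  rw [lintegral_drawLaw q (h.measurable_anchorError_step 0 s)]
  have e1 : ∀ (S : Fin n → Ξ) (B : Fin b → Ξ) (c : Bool),
      anchorError F (step Fo T lam μ r β 0 ((B, S, c) : Draw Ξ b n) s)
        = ‖batchMean Fo s.xprev S - F s.xprev‖ ^ 2 := by
    intro S B c; simp [anchorError, step]
  simp only [e1, lintegral_const, measure_univ, mul_one]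
  rw [← add_mul, ← ENNReal.ofReal_add hq0 (by linarith), add_sub_cancel, ENNReal.ofReal_one,
    one_mul]
  exact h.oracle.lintegral_batchMean_sub_sq_le hn s.xprev

/-- With probability `q` the snapshot moves to the previous iterate; otherwise the gap grows by
the last move. The weights of Young's inequality are chosen to contract by `1 - q / 2`. -/
lemma lintegral_snapGap_le {q : ℝ} (hq0 : 0 < q) (hq1 : q ≤ 1) {k : ℕ} (hk : k ≠ 0)
    (s : State p) :
    ∫⁻ d : Draw Ξ b n, ENNReal.ofReal (snapGap P Fo (step Fo T lam μ r β k d s))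
        ∂(drawLaw P b n q)
      ≤ ENNReal.ofReal ((1 - q / 2) * snapGap P Fo s + 2 / q * moveGap P Fo s) := by
  rw [lintegral_drawLaw q (h.measurable_snapGap_step k s)]
  have e1 : ∀ (S : Fin n → Ξ) (B : Fin b → Ξ),
      snapGap P Fo (step Fo T lam μ r β k ((B, S, true) : Draw Ξ b n) s) = moveGap P Fo s := by
    intro S B; simp [snapGap, moveGap, step]
  have e2 : ∀ (S : Fin n → Ξ) (B : Fin b → Ξ),
      snapGap P Fo (step Fo T lam μ r β k ((B, S, false) : Draw Ξ b n) s)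
        = oracleGap P Fo s.x s.snap := by
    intro S B; simp [snapGap, step, hk]
  simp only [e1, e2, lintegral_const, measure_univ, mul_one]
  have hm : 0 ≤ moveGap P Fo s := oracleGap_nonneg _ _
  have hs : 0 ≤ snapGap P Fo s := oracleGap_nonneg _ _
  have hq1' : 0 ≤ 1 - q := by linarith
  rw [← ENNReal.ofReal_mul hq0.le, ← ENNReal.ofReal_mul hq1',
    ← ENNReal.ofReal_add (by positivity) (mul_nonneg hq1' (oracleGap_nonneg _ _))]
  refine ENNReal.ofReal_le_ofReal ?_
  have hg := h.oracle.gap_le (c := q / 2) (by positivity) s.x s.xprev s.snap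
  have hg' : oracleGap P Fo s.x s.snap
      ≤ (1 + q / 2) * snapGap P Fo s + (1 + 2 / q) * moveGap P Fo s := by
    rwa [one_div_div] at hg
  have h1 := mul_le_mul_of_nonneg_left hg' hq1'
  have h2 : q * moveGap P Fo s + (1 - q) * ((1 + q / 2) * snapGap P Fo s
      + (1 + 2 / q) * moveGap P Fo s)
      = (1 - q / 2) * snapGap P Fo s + 2 / q * moveGap P Fo s
        - q ^ 2 / 2 * snapGap P Fo s - moveGap P Fo s := by
    field_simp; ring
  have h3 : 0 ≤ q ^ 2 / 2 * snapGap P Fo s := by positivity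
  linarith

end Setting

/-! ### Summation of the error recursions -/

/-- Summation of the snapshot recursion: `w` are the weights, `ω` the snapshot gaps and `m` the
gaps between consecutive iterates. -/
lemma sum_snapshot_le {w ω m q : ℕ → ℝ} {ε : ℝ} (hε : 0 < ε)
    (hw : ∀ k, 0 ≤ w k) (hω : ∀ k, 0 ≤ ω k) (hm : ∀ k, 0 ≤ m k) (h0 : ω 0 = 0)
    (hrec : ∀ k, ω (k + 1) ≤ (1 - q (k + 1) / 2) * ω k + 2 / q (k + 1) * m (k + 1))
    (hdec : ∀ k, w (k + 1) * (1 - q (k + 1) / 2) ≤ (1 - ε) * w k)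
    (hq : ∀ k, w (k + 1) * (2 / q (k + 1)) ≤ w k / ε) (K : ℕ) :
    ∑ j ∈ Finset.range K, w j * ω j ≤ 1 / ε ^ 2 * ∑ j ∈ Finset.range K, w j * m (j + 1) := by
  have key : w K * ω K + ε * ∑ j ∈ Finset.range K, w j * ω j
      ≤ 1 / ε * ∑ j ∈ Finset.range K, w j * m (j + 1) := by
    induction K with
    | zero => simp [h0]
    | succ k ih =>
      rw [Finset.sum_range_succ, Finset.sum_range_succ]
      have h1 := mul_le_mul_of_nonneg_left (hrec k) (hw (k + 1))
      have h2 := mul_le_mul_of_nonneg_right (hdec k) (hω k)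
      have h3 := mul_le_mul_of_nonneg_right (hq k) (hm (k + 1))
      have h4 : w k / ε * m (k + 1) = 1 / ε * (w k * m (k + 1)) := by ring
      nlinarith
  have h5 : 0 ≤ w K * ω K := mul_nonneg (hw K) (hω K)
  have h6 : ε * ∑ j ∈ Finset.range K, w j * ω j
      ≤ ε * (1 / ε ^ 2 * ∑ j ∈ Finset.range K, w j * m (j + 1)) := by
    calc _ ≤ 1 / ε * ∑ j ∈ Finset.range K, w j * m (j + 1) := by linarith
      _ = _ := by field_simp
  exact le_of_mul_le_mul_left h6 hε

/-- The recursions for the two Lyapunov functions `v` and `z`. The gaps `m` between consecutive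
iterates, which the decrease of `v` controls, pay for the mini-batch part of the errors `e`. -/
lemma lyapunov_sum_le {w m e v z θ : ℕ → ℝ} {β μ Λ N Ψ c : ℝ} (hβ : 0 < β) (hμ : 0 < μ)
    (hμ' : μ < 2 / 3) (hΛ : 0 < Λ) (hN : 0 ≤ N) (hw : ∀ k, 0 ≤ w k)
    (hm : ∀ k, 0 ≤ m k) (hθ : ∀ k, 0 ≤ θ k) (hθ1 : ∀ k, θ k ≤ 1)
    (hc : c ≤ μ * Λ / (5 * β))
    (hv : ∀ k, v (k + 1) + w k * Λ * m (k + 1) ≤ v k + 5 * β / (3 * μ) * w k * e k)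
    (hz : ∀ k, z (k + 1) ≤ (1 - θ k) * z k + θ k * (v k / β) + 1 / 4 * w k * e k)
    (he0 : ∀ k, 0 ≤ e k)
    (hsum : ∀ K, ∑ j ∈ Finset.range K, w j * e j
      ≤ N * ∑ j ∈ Finset.range K, w j + c * ∑ j ∈ Finset.range K, w j * m (j + 1))
    (hv0 : v 0 ≤ β * Ψ ^ 2) (hz0 : z 0 ≤ Ψ ^ 2) (K : ℕ) :
    2 * (β * z K) + 2 * v K ≤ β * (4 * Ψ ^ 2 + 8 / μ * (N * ∑ j ∈ Finset.range K, w j)) := by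
  set S : ℕ → ℝ := fun k => ∑ j ∈ Finset.range k, w j with hS
  set M : ℕ → ℝ := fun k => ∑ j ∈ Finset.range k, w j * m (j + 1) with hM
  set R : ℕ → ℝ := fun k => ∑ j ∈ Finset.range k, w j * e j with hR
  have hM0 : ∀ k, 0 ≤ M k := fun k =>
    Finset.sum_nonneg fun j _ => mul_nonneg (hw j) (hm _)
  have hS0 : ∀ k, 0 ≤ S k := fun k => Finset.sum_nonneg fun j _ => hw j
  have hRle : ∀ k, R k ≤ N * S k + μ * Λ / (5 * β) * M k := fun k =>
    (hsum k).trans (add_le_add_right (mul_le_mul_of_nonneg_right hc (hM0 k)) _)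
  -- the decrease of `v`, summed up
  have hvk : ∀ k, v k + Λ * M k ≤ β * Ψ ^ 2 + 5 * β / (3 * μ) * R k := by
    intro k
    induction k with
    | zero => simpa [hM, hR] using hv0
    | succ k ih =>
      have h1 := hv k
      simp only [hM, hR, Finset.sum_range_succ] at ih ⊢
      nlinarith
  have hcoef : ∀ k, 5 * β / (3 * μ) * R k ≤ 5 * β / (3 * μ) * (N * S k) + 1 / 3 * (Λ * M k) := by
    intro k
    have h1 := mul_le_mul_of_nonneg_left (hRle k) (by positivity : 0 ≤ 5 * β / (3 * μ))
    have h2 : 5 * β / (3 * μ) * (μ * Λ / (5 * β) * M k) = 1 / 3 * (Λ * M k) := by field_simp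
    linarith
  have hΛM : ∀ k, 0 ≤ Λ * M k := fun k => mul_nonneg hΛ.le (hM0 k)
  have hmono : ∀ k ≤ K, S k ≤ S K := fun k hk =>
    Finset.sum_le_sum_of_subset_of_nonneg (Finset.range_mono hk) fun j _ _ => hw j
  have hvX : ∀ k ≤ K, v k / β ≤ Ψ ^ 2 + 5 / (3 * μ) * (N * S K) := by
    intro k hk
    rw [div_le_iff₀ hβ]
    have h1 := mul_le_mul_of_nonneg_left (mul_le_mul_of_nonneg_left (hmono k hk) hN)
      (by positivity : 0 ≤ 5 * β / (3 * μ))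
    have h2 : (Ψ ^ 2 + 5 / (3 * μ) * (N * S K)) * β
        = β * Ψ ^ 2 + 5 * β / (3 * μ) * (N * S K) := by ring
    linarith [hvk k, hcoef k, hΛM k]
  have hzk : ∀ k ≤ K, z k ≤ Ψ ^ 2 + 5 / (3 * μ) * (N * S K) + 1 / 4 * R k := by
    intro k
    induction k with
    | zero =>
      intro _
      have : 0 ≤ 5 / (3 * μ) * (N * S K) :=
        mul_nonneg (by positivity) (mul_nonneg hN (hS0 K))
      simp only [hR, Finset.range_zero, Finset.sum_empty]
      linarith
    | succ k ih =>
      intro hk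
      have h1 := ih (by omega)
      have h2 := mul_le_mul_of_nonneg_left (hvX k (by omega)) (hθ k)
      have h3 := mul_le_mul_of_nonneg_left h1 (sub_nonneg.2 (hθ1 k))
      have hR0 : 0 ≤ R k := Finset.sum_nonneg fun j _ => mul_nonneg (hw j) (he0 j)
      have h4 : R (k + 1) = R k + w k * e k := Finset.sum_range_succ _ _
      rw [h4]
      nlinarith [hz k, mul_nonneg (hθ k) hR0]
  have hfin := hzk K le_rfl
  have h1 := hvk K
  have h2 := hcoef K
  have h3 := hRle K
  have hNS : 0 ≤ N * S K := mul_nonneg hN (hS0 K)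
  have h4 := mul_le_mul_of_nonneg_left hfin hβ.le
  have h5 := mul_le_mul_of_nonneg_left h3 (by positivity : 0 ≤ β / 4)
  have h6 : β / 4 * (μ * Λ / (5 * β) * M K) = μ / 20 * (Λ * M K) := by field_simp; ring
  have h7 : μ / 20 * (Λ * M K) ≤ 2 / 3 * (Λ * M K) :=
    mul_le_mul_of_nonneg_right (by linarith) (hΛM K)
  have h8 : β * (5 / (3 * μ) * (N * S K)) = 5 / 3 * (β / μ * (N * S K)) := by ring
  have h9 : 5 * β / (3 * μ) * (N * S K) = 5 / 3 * (β / μ * (N * S K)) := by ring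
  have h10 : β / 4 * (N * S K) ≤ 2 / 3 * (β / μ * (N * S K)) := by
    have : β / 4 ≤ 2 / 3 * (β / μ) := by
      rw [mul_div_assoc', le_div_iff₀ hμ]; nlinarith
    nlinarith [mul_le_mul_of_nonneg_right this hNS]
  have h11 : β * (8 / μ * (N * S K)) = 8 * (β / μ * (N * S K)) := by ring
  rw [mul_add β (4 * Ψ ^ 2), h11]
  linarith

/-! ### Weights and snapshot probabilities -/

namespace Setting

variable {p : ℕ} {Ξ : Type*} [MeasurableSpace Ξ] {L Lhat ρ lam μ r β σ : ℝ}
  {P : Measure Ξ} {F : Vec p → Vec p} {Fo : Vec p → Ξ → Vec p} {T : Vec p → Set (Vec p)}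
  {xstar : Vec p} (h : Setting L Lhat ρ lam μ r β σ P F Fo T xstar)
include h

omit h in
lemma snapProb_eq (μ r ε : ℝ) (k : ℕ) :
    snapProb μ r ε k = 2 * ε + 4 * μ / (tSeq μ r k - μ - 1) := by
  rw [snapProb, tSeq]; congr 2; ring

lemma snapProb_pos {ε : ℝ} (hε : 0 < ε) (k : ℕ) : 0 < snapProb μ r ε k := by
  have h1 := h.lt_tSeq k
  have h2 := h.μ_pos
  rw [snapProb_eq]
  have : 0 < tSeq μ r k - μ - 1 := by linarith
  positivity

/-- The upper bound on `ε` makes the snapshot probability at index `0`, the largest one, at most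
`1`. -/
lemma ε_bound {ε : ℝ} (hε : ε ≤ (μ * (r - 5) - 1) / (2 * μ * (r - 1) - 2)) :
    2 * ε ≤ 1 - 4 * μ / (tSeq μ r 0 - μ - 1) := by
  have h1 := h.lt_tSeq 0
  have h2 := h.μ_pos
  have h3 : tSeq μ r 0 = μ * r := by simp [tSeq]
  rw [h3] at h1 ⊢
  have h4 : 0 < μ * r - μ - 1 := by linarith
  have h5 : 2 * μ * (r - 1) - 2 = 2 * (μ * r - μ - 1) := by ring
  rw [h5, le_div_iff₀ (by positivity)] at hε
  rw [le_sub_iff_add_le, ← le_sub_iff_add_le', div_le_iff₀ h4]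
  linarith

lemma ε_lt_half {ε : ℝ} (hε : ε ≤ (μ * (r - 5) - 1) / (2 * μ * (r - 1) - 2)) :
    ε < 1 / 2 := by
  have h1 := h.lt_tSeq 0
  have h2 := h.μ_pos
  have h3 : 0 < tSeq μ r 0 - μ - 1 := by linarith
  have : 0 < 4 * μ / (tSeq μ r 0 - μ - 1) := by positivity
  linarith [h.ε_bound hε]

lemma tSeq_zero_le (k : ℕ) : tSeq μ r 0 ≤ tSeq μ r k := by
  have := mul_nonneg h.μ_pos.le (Nat.cast_nonneg (α := ℝ) k)
  simp only [tSeq, Nat.cast_zero]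
  linarith

lemma snapProb_le_one {ε : ℝ} (hε : ε ≤ (μ * (r - 5) - 1) / (2 * μ * (r - 1) - 2)) (k : ℕ) :
    snapProb μ r ε k ≤ 1 := by
  have h1 := h.lt_tSeq 0
  have h2 := h.μ_pos
  have h3 := h.tSeq_zero_le k
  have h4 : 0 < tSeq μ r 0 - μ - 1 := by linarith
  have h5 : 4 * μ / (tSeq μ r k - μ - 1) ≤ 4 * μ / (tSeq μ r 0 - μ - 1) := by gcongr
  rw [snapProb_eq]
  linarith [h.ε_bound hε]

/-- The second summand of the snapshot probability absorbs the growth of the weights. -/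
lemma weight_succ_mul_le {ε : ℝ} (hε : 0 < ε) (k : ℕ) :
    weight μ r (k + 1) * (1 - snapProb μ r ε (k + 1) / 2) ≤ (1 - ε) * weight μ r k := by
  have h1 := h.lt_tSeq k
  have h2 := h.μ_pos
  rw [snapProb_eq, weight, weight, tSeq_succ, add_sub_cancel_right]
  set t := tSeq μ r k
  have ht1 : 0 < t - 1 := by linarith
  have e : (t + μ) * (t + μ - 1) * (1 - (2 * ε + 4 * μ / (t - 1)) / 2)
      = (t + μ) * (t + μ - 1) - 2 * μ * ((t + μ) * (t + μ - 1) / (t - 1))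
        - ε * ((t + μ) * (t + μ - 1)) := by ring
  have h3 : (t + μ) + μ ≤ (t + μ) * (t + μ - 1) / (t - 1) := by
    rw [le_div_iff₀ ht1]; nlinarith
  have h4 : t * (t - 1) ≤ (t + μ) * (t + μ - 1) := by nlinarith
  have h5 := mul_le_mul_of_nonneg_left h3 (by positivity : 0 ≤ 2 * μ)
  have h6 := mul_le_mul_of_nonneg_left h4 hε.le
  rw [e]
  nlinarith

/-- The first summand of the snapshot probability bounds its inverse. -/
lemma weight_succ_mul_div_le {ε : ℝ} (hε : 0 < ε) (hε' : ε < 1 / 2) (k : ℕ) :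
    weight μ r (k + 1) * (2 / snapProb μ r ε (k + 1)) ≤ weight μ r k / ε := by
  have h1 := h.lt_tSeq k
  have h2 := h.μ_pos
  have hp := h.snapProb_pos hε (k + 1)
  rw [mul_div_assoc', div_le_div_iff₀ hp hε]
  rw [snapProb_eq, weight, weight, tSeq_succ, add_sub_cancel_right]
  set t := tSeq μ r k
  have ht1 : 0 < t - 1 := by linarith
  have e : t * (t - 1) * (2 * ε + 4 * μ / (t - 1)) = 2 * ε * (t * (t - 1)) + 4 * μ * t := by
    field_simp
  rw [e]
  have h3 : ε * (2 * t * μ + μ ^ 2) ≤ 1 / 2 * (2 * t * μ + μ ^ 2) := by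
    have : 0 ≤ 2 * t * μ + μ ^ 2 := by nlinarith
    gcongr
  nlinarith [mul_pos hε h2]

lemma sum_weight_le (K : ℕ) :
    ∑ j ∈ Finset.range K, weight μ r j ≤ (tSeq μ r K - μ) ^ 3 / (3 * μ) := by
  have h2 := h.μ_pos
  induction K with
  | zero =>
    have := h.lt_tSeq 0
    have : 0 < tSeq μ r 0 - μ := by linarith
    simp only [Finset.range_zero, Finset.sum_empty]
    positivity
  | succ k ih =>
    have h1 := h.lt_tSeq k
    rw [Finset.sum_range_succ, tSeq_succ, add_sub_cancel_right, weight]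
    set t := tSeq μ r k
    have e : t ^ 3 / (3 * μ) = (t - μ) ^ 3 / (3 * μ) + (t ^ 2 - t * μ + μ ^ 2 / 3) := by
      field_simp; ring
    rw [e]
    nlinarith [h.μ_lt]

end Setting

/-! ### Expectations along the run -/

/-- Passes from an inequality between expectations in `[0, ∞]` to one between real numbers. -/
lemma toReal_le_of_le_add {x y z : ENNReal} {a b : ℝ} (ha : 0 ≤ a) (hb : 0 ≤ b)
    (hy : y ≠ ⊤) (hz : z ≠ ⊤) (hx : x ≤ ENNReal.ofReal a * y + ENNReal.ofReal b * z) :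
    x ≠ ⊤ ∧ x.toReal ≤ a * y.toReal + b * z.toReal := by
  have h1 : ENNReal.ofReal a * y ≠ ⊤ := ENNReal.mul_ne_top ENNReal.ofReal_ne_top hy
  have h2 : ENNReal.ofReal b * z ≠ ⊤ := ENNReal.mul_ne_top ENNReal.ofReal_ne_top hz
  have h3 := ENNReal.add_ne_top.2 ⟨h1, h2⟩
  refine ⟨ne_top_of_le_ne_top h3 hx, ?_⟩
  have := ENNReal.toReal_mono h3 hx
  rwa [ENNReal.toReal_add h1 h2, ENNReal.toReal_mul, ENNReal.toReal_mul,
    ENNReal.toReal_ofReal ha, ENNReal.toReal_ofReal hb] at this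

lemma lintegral_ofReal_add_mul {α : Type*} [MeasurableSpace α] {Q : Measure α} {X Y : α → ℝ}
    (hX : Measurable X) (hX0 : ∀ a, 0 ≤ X a) (hY0 : ∀ a, 0 ≤ Y a)
    {c d : ℝ} (hc : 0 ≤ c) (hd : 0 ≤ d) :
    ∫⁻ a, ENNReal.ofReal (c * X a + d * Y a) ∂Q
      = ENNReal.ofReal c * ∫⁻ a, ENNReal.ofReal (X a) ∂Q
        + ENNReal.ofReal d * ∫⁻ a, ENNReal.ofReal (Y a) ∂Q := by
  rw [← lintegral_const_mul' _ _ ENNReal.ofReal_ne_top,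
    ← lintegral_const_mul' _ _ ENNReal.ofReal_ne_top,
    ← lintegral_add_left (hX.ennreal_ofReal.const_mul _)]
  refine lintegral_congr fun a => ?_
  rw [ENNReal.ofReal_add (mul_nonneg hc (hX0 a)) (mul_nonneg hd (hY0 a)),
    ENNReal.ofReal_mul hc, ENNReal.ofReal_mul hd]

namespace Setting

variable {p : ℕ} {Ξ : Type*} [MeasurableSpace Ξ] {L Lhat ρ lam μ r β σ : ℝ}
  {P : Measure Ξ} {F : Vec p → Vec p} {Fo : Vec p → Ξ → Vec p} {T : Vec p → Set (Vec p)}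
  {xstar : Vec p} (h : Setting L Lhat ρ lam μ r β σ P F Fo T xstar)
  {x0 : Vec p} {ε : ℝ} {b n : ℕ} {Ω : Type*} [MeasurableSpace Ω] {D : ℕ → Ω → Draw Ξ b n}
include h

lemma measurable_run (hD : ∀ k, Measurable (D k)) (k : ℕ) :
    Measurable fun ω => run Fo T lam μ r β x0 (fun j => D j ω) k :=
  VFOSA.measurable_run h.oracle.measurable h.measurable_resolvent hD k

variable [IsProbabilityMeasure P] {Q : Measure Ω}

section recursions

variable (hD : ∀ k, Measurable (D k))
include hD

lemma lintegral_potential_succ (k : ℕ) :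
    ∫⁻ ω, ENNReal.ofReal (statePotential F T xstar lam μ r β (k + 1)
        (run Fo T lam μ r β x0 (fun j => D j ω) (k + 1))) ∂Q
      + ENNReal.ofReal (weight μ r k * Lam L Lhat) * ∫⁻ ω, ENNReal.ofReal (moveGap P Fo
        (run Fo T lam μ r β x0 (fun j => D j ω) (k + 1))) ∂Q
    ≤ ENNReal.ofReal 1 * ∫⁻ ω, ENNReal.ofReal (statePotential F T xstar lam μ r β k
        (run Fo T lam μ r β x0 (fun j => D j ω) k)) ∂Q
      + ENNReal.ofReal (5 * β / (3 * μ) * weight μ r k) * ∫⁻ ω, ENNReal.ofReal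
        (‖estimate Fo (D k ω) (run Fo T lam μ r β x0 (fun j => D j ω) k)
          (run Fo T lam μ r β x0 (fun j => D j ω) (k + 1))
        - F (run Fo T lam μ r β x0 (fun j => D j ω) k).x‖ ^ 2) ∂Q := by
  have hw := h.weight_pos k
  have hΛ := h.Lam_pos
  have hβ := h.β_pos
  have hμ := h.μ_pos
  have m1 : ∀ k, Measurable fun ω => statePotential F T xstar lam μ r β k
      (run Fo T lam μ r β x0 (fun j => D j ω) k) := fun k =>
    (h.measurable_statePotential k).comp (h.measurable_run hD k)
  rw [← lintegral_ofReal_add_mul (m1 k) (fun ω => h.statePotential_nonneg k _)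
    (fun ω => sq_nonneg _) zero_le_one (by positivity)]
  rw [← one_mul (∫⁻ ω, ENNReal.ofReal (statePotential F T xstar lam μ r β (k + 1) _) ∂Q),
    ← ENNReal.ofReal_one,
    ← lintegral_ofReal_add_mul
      (Y := fun ω => moveGap P Fo (run Fo T lam μ r β x0 (fun j => D j ω) (k + 1)))
      (m1 (k + 1)) (fun ω => h.statePotential_nonneg (k + 1) _)
    (fun ω => oracleGap_nonneg _ _) zero_le_one (by positivity)]
  refine lintegral_mono fun ω => ENNReal.ofReal_le_ofReal ?_
  have := h.statePotential_step k (D k ω) (run Fo T lam μ r β x0 (fun j => D j ω) k)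
  rw [one_mul, one_mul, mul_assoc]
  exact this

lemma lintegral_energy_succ (k : ℕ) :
    ∫⁻ ω, ENNReal.ofReal (stateEnergy xstar μ r β (k + 1)
        (run Fo T lam μ r β x0 (fun j => D j ω) (k + 1))) ∂Q
    ≤ ENNReal.ofReal 1 * (ENNReal.ofReal (1 - μ / 2 / (tSeq μ r k - μ)) *
        ∫⁻ ω, ENNReal.ofReal (stateEnergy xstar μ r β k
          (run Fo T lam μ r β x0 (fun j => D j ω) k)) ∂Q
      + ENNReal.ofReal (μ / 2 / (tSeq μ r k - μ) / β) *
        ∫⁻ ω, ENNReal.ofReal (statePotential F T xstar lam μ r β k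
          (run Fo T lam μ r β x0 (fun j => D j ω) k)) ∂Q)
      + ENNReal.ofReal (1 / 4 * weight μ r k) * ∫⁻ ω, ENNReal.ofReal
        (‖estimate Fo (D k ω) (run Fo T lam μ r β x0 (fun j => D j ω) k)
          (run Fo T lam μ r β x0 (fun j => D j ω) (k + 1))
        - F (run Fo T lam μ r β x0 (fun j => D j ω) k).x‖ ^ 2) ∂Q := by
  have hw := h.weight_pos k
  have hβ := h.β_pos
  have hμ := h.μ_pos
  have ht := h.lt_tSeq k
  have hs : 0 < tSeq μ r k - μ := by linarith
  have hθ : 0 ≤ μ / 2 / (tSeq μ r k - μ) := by positivity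
  have hθ1 : 0 ≤ 1 - μ / 2 / (tSeq μ r k - μ) := by
    rw [sub_nonneg, div_le_one hs]; linarith
  have m1 : Measurable fun ω => statePotential F T xstar lam μ r β k
      (run Fo T lam μ r β x0 (fun j => D j ω) k) :=
    (h.measurable_statePotential k).comp (h.measurable_run hD k)
  have m2 : Measurable fun ω => stateEnergy xstar μ r β k
      (run Fo T lam μ r β x0 (fun j => D j ω) k) :=
    (measurable_stateEnergy xstar μ r β k).comp (h.measurable_run hD k)
  have hθβ : 0 ≤ μ / 2 / (tSeq μ r k - μ) / β := by positivity
  have n1 := fun ω => h.statePotential_nonneg k (run Fo T lam μ r β x0 (fun j => D j ω) k)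
  have n2 := fun ω => h.stateEnergy_nonneg k (run Fo T lam μ r β x0 (fun j => D j ω) k)
  rw [← lintegral_ofReal_add_mul m2 n2 n1 hθ1 hθβ,
    ← lintegral_ofReal_add_mul
      (X := fun ω => (1 - μ / 2 / (tSeq μ r k - μ)) * stateEnergy xstar μ r β k
          (run Fo T lam μ r β x0 (fun j => D j ω) k)
        + μ / 2 / (tSeq μ r k - μ) / β * statePotential F T xstar lam μ r β k
          (run Fo T lam μ r β x0 (fun j => D j ω) k))
      (Y := fun ω => ‖estimate Fo (D k ω) (run Fo T lam μ r β x0 (fun j => D j ω) k)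
          (run Fo T lam μ r β x0 (fun j => D j ω) (k + 1))
        - F (run Fo T lam μ r β x0 (fun j => D j ω) k).x‖ ^ 2)
      ((m2.const_mul _).add (m1.const_mul _))
      (fun ω => add_nonneg (mul_nonneg hθ1 (n2 ω)) (mul_nonneg hθβ (n1 ω)))
      (fun ω => sq_nonneg _) zero_le_one (by positivity)]
  refine lintegral_mono fun ω => ENNReal.ofReal_le_ofReal ?_
  have := h.stateEnergy_step k (D k ω) (run Fo T lam μ r β x0 (fun j => D j ω) k)
  refine this.trans (le_of_eq ?_)
  rw [one_mul, mul_div_assoc', div_mul_eq_mul_div (μ / 2 / _)]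
  rfl

variable [IsProbabilityMeasure Q]
  (hlaw : ∀ k, Q.map (D k) = drawLaw P b n (snapProb μ r ε k)) (hind : iIndepFun D Q)
include hlaw hind

/-- Integrating out the draw of iteration `k` when the integrand is a function of the next
state. -/
lemma lintegral_run_succ (k : ℕ) {f : State p → ENNReal} (hf : Measurable f) :
    ∫⁻ ω, f (run Fo T lam μ r β x0 (fun j => D j ω) (k + 1)) ∂Q
      = ∫⁻ ω, ∫⁻ d, f (step Fo T lam μ r β k d (run Fo T lam μ r β x0 (fun j => D j ω) k))
        ∂(drawLaw P b n (snapProb μ r ε k)) ∂Q :=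
  lintegral_draw_run h.oracle.measurable h.measurable_resolvent hD hlaw hind k
    (f := fun q => f (step Fo T lam μ r β k q.1 q.2)) (hf.comp (h.measurable_step k))

lemma lintegral_estimate_error_run_le (hb : 1 ≤ b) (k : ℕ) :
    ∫⁻ ω, ENNReal.ofReal
        (‖estimate Fo (D k ω) (run Fo T lam μ r β x0 (fun j => D j ω) k)
          (run Fo T lam μ r β x0 (fun j => D j ω) (k + 1))
        - F (run Fo T lam μ r β x0 (fun j => D j ω) k).x‖ ^ 2) ∂Q
    ≤ ENNReal.ofReal 1 * ∫⁻ ω, ENNReal.ofReal (anchorError F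
        (run Fo T lam μ r β x0 (fun j => D j ω) (k + 1))) ∂Q
      + ENNReal.ofReal (1 / b) * ∫⁻ ω, ENNReal.ofReal (snapGap P Fo
        (run Fo T lam μ r β x0 (fun j => D j ω) (k + 1))) ∂Q := by
  have hS := h.measurable_run (x0 := x0) hD (k + 1)
  rw [← lintegral_ofReal_add_mul
    (X := fun ω => anchorError F (run Fo T lam μ r β x0 (fun j => D j ω) (k + 1)))
    (Y := fun ω => snapGap P Fo (run Fo T lam μ r β x0 (fun j => D j ω) (k + 1)))
    (h.measurable_anchorError.comp hS) (fun ω => sq_nonneg _)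
    (fun ω => oracleGap_nonneg _ _) zero_le_one (by positivity)]
  have m : Measurable fun s : State p =>
      ENNReal.ofReal (1 * anchorError F s + 1 / b * snapGap P Fo s) :=
    ((h.measurable_anchorError.const_mul 1).add
      (h.measurable_snapGap.const_mul _)).ennreal_ofReal
  have e1 := h.lintegral_run_succ (x0 := x0) hD hlaw hind k m
  have e2 := lintegral_draw_run (μ := μ) (r := r) (β := β) (x0 := x0) h.oracle.measurable
    h.measurable_resolvent hD hlaw hind k
    (f := fun q => ENNReal.ofReal
      (‖estimate Fo q.1 q.2 (step Fo T lam μ r β k q.1 q.2) - F q.2.x‖ ^ 2))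
    (h.measurable_estimate_error k).ennreal_ofReal
  refine (le_of_eq e2).trans (le_trans ?_ (le_of_eq e1.symm))
  refine lintegral_mono fun ω => ?_
  refine (h.lintegral_estimate_error_le hb _ k _).trans (le_of_eq ?_)
  refine lintegral_congr fun d => ?_
  rw [one_mul, one_div_mul_eq_div]

/-- Each stored average is an unbiased mega-batch average, whenever it was drawn. -/
lemma lintegral_anchorError_run_le (hn : 1 ≤ n) (hε : 0 < ε)
    (hε' : ε ≤ (μ * (r - 5) - 1) / (2 * μ * (r - 1) - 2)) (k : ℕ) :
    ∫⁻ ω, ENNReal.ofReal (anchorError F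
        (run Fo T lam μ r β x0 (fun j => D j ω) (k + 1))) ∂Q ≤ ENNReal.ofReal (σ ^ 2 / n) := by
  induction k with
  | zero =>
    rw [h.lintegral_run_succ hD hlaw hind 0 h.measurable_anchorError.ennreal_ofReal]
    refine (lintegral_mono fun ω => h.lintegral_anchorError_zero_le hn
      (h.snapProb_pos hε 0).le (h.snapProb_le_one hε' 0) _).trans ?_
    simp
  | succ k ih =>
    have hq0 := (h.snapProb_pos hε (k + 1)).le
    have hq1 := h.snapProb_le_one hε' (k + 1)
    rw [h.lintegral_run_succ hD hlaw hind (k + 1) h.measurable_anchorError.ennreal_ofReal]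
    refine (lintegral_mono fun ω => h.lintegral_anchorError_le hn _ k.succ_ne_zero _).trans ?_
    rw [lintegral_add_left measurable_const, lintegral_const, measure_univ, mul_one,
      lintegral_const_mul' _ _ ENNReal.ofReal_ne_top]
    calc _ ≤ ENNReal.ofReal (snapProb μ r ε (k + 1)) * ENNReal.ofReal (σ ^ 2 / n)
          + ENNReal.ofReal (1 - snapProb μ r ε (k + 1)) * ENNReal.ofReal (σ ^ 2 / n) := by
          gcongr
      _ = _ := by
          rw [← add_mul, ← ENNReal.ofReal_add hq0 (by linarith), add_sub_cancel,
            ENNReal.ofReal_one, one_mul]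

lemma lintegral_snapGap_run_one :
    ∫⁻ ω, ENNReal.ofReal (snapGap P Fo
        (run Fo T lam μ r β x0 (fun j => D j ω) (0 + 1))) ∂Q = 0 := by
  rw [h.lintegral_run_succ hD hlaw hind 0 h.measurable_snapGap.ennreal_ofReal]
  refine (lintegral_congr fun ω => lintegral_snapGap_zero _ rfl).trans ?_
  simp

lemma lintegral_snapGap_run_succ (hε : 0 < ε)
    (hε' : ε ≤ (μ * (r - 5) - 1) / (2 * μ * (r - 1) - 2)) (k : ℕ) :
    ∫⁻ ω, ENNReal.ofReal (snapGap P Fo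
        (run Fo T lam μ r β x0 (fun j => D j ω) (k + 1 + 1))) ∂Q
    ≤ ENNReal.ofReal (1 - snapProb μ r ε (k + 1) / 2) * ∫⁻ ω, ENNReal.ofReal (snapGap P Fo
        (run Fo T lam μ r β x0 (fun j => D j ω) (k + 1))) ∂Q
      + ENNReal.ofReal (2 / snapProb μ r ε (k + 1)) * ∫⁻ ω, ENNReal.ofReal (moveGap P Fo
        (run Fo T lam μ r β x0 (fun j => D j ω) (k + 1))) ∂Q := by
  have hq0 := h.snapProb_pos hε (k + 1)
  have hq1 := h.snapProb_le_one hε' (k + 1)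
  rw [h.lintegral_run_succ hD hlaw hind (k + 1) h.measurable_snapGap.ennreal_ofReal,
    ← lintegral_ofReal_add_mul
    (X := fun ω => snapGap P Fo (run Fo T lam μ r β x0 (fun j => D j ω) (k + 1)))
    (Y := fun ω => moveGap P Fo (run Fo T lam μ r β x0 (fun j => D j ω) (k + 1)))
    (h.measurable_snapGap.comp (h.measurable_run hD (k + 1)))
    (fun ω => oracleGap_nonneg _ _) (fun ω => oracleGap_nonneg _ _) (by linarith)
    (by positivity)]
  exact lintegral_mono fun ω => h.lintegral_snapGap_le hq0 hq1 k.succ_ne_zero _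

end recursions

/-- Combines the expected one-step estimates with the summed recursions. All expectations are
extended nonnegative numbers; they are shown to be finite along the way, by induction, so that the
recursions can be summed over the reals. -/
lemma lintegral_sq_norm_residual_le (hε : 0 < ε)
    (hε' : ε ≤ (μ * (r - 5) - 1) / (2 * μ * (r - 1) - 2)) (hb : 1 ≤ b) (hn : 1 ≤ n)
    (hbε : 1 / b * (1 / ε ^ 2) ≤ μ * Lam L Lhat / (5 * β))
    [IsProbabilityMeasure Q] (hD : ∀ k, Measurable (D k))
    (hlaw : ∀ k, Q.map (D k) = drawLaw P b n (snapProb μ r ε k)) (hind : iIndepFun D Q)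
    (K : ℕ) :
    ∫⁻ ω, ENNReal.ofReal (‖fbsResidual lam F T
        (run Fo T lam μ r β x0 (fun j => D j ω) K).x‖ ^ 2) ∂Q
      ≤ ENNReal.ofReal ((4 * psi0 F T lam μ r β x0 xstar ^ 2
        + 8 / μ * (σ ^ 2 / n * ((tSeq μ r K - μ) ^ 3 / (3 * μ)))) / (tSeq μ r K - μ) ^ 2) := by
  have hβ := h.β_pos
  have hμ := h.μ_pos
  have hΛ := h.Lam_pos
  set S : ℕ → Ω → State p := fun k ω => run Fo T lam μ r β x0 (fun j => D j ω) k with hS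
  set V : ℕ → ENNReal := fun k =>
    ∫⁻ ω, ENNReal.ofReal (statePotential F T xstar lam μ r β k (S k ω)) ∂Q with hV
  set Z : ℕ → ENNReal := fun k =>
    ∫⁻ ω, ENNReal.ofReal (stateEnergy xstar μ r β k (S k ω)) ∂Q with hZ
  set W : ℕ → ENNReal := fun k => ∫⁻ ω, ENNReal.ofReal (snapGap P Fo (S (k + 1) ω)) ∂Q with hW
  set M : ℕ → ENNReal := fun k => ∫⁻ ω, ENNReal.ofReal (moveGap P Fo (S k ω)) ∂Q with hM
  set A : ℕ → ENNReal := fun k => ∫⁻ ω, ENNReal.ofReal (anchorError F (S (k + 1) ω)) ∂Q with hA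
  set R : ℕ → ENNReal := fun k => ∫⁻ ω, ENNReal.ofReal
    (‖estimate Fo (D k ω) (S k ω) (S (k + 1) ω) - F (S k ω).x‖ ^ 2) ∂Q with hR
  set Ψ := psi0 F T lam μ r β x0 xstar with hΨ
  obtain ⟨hV0, hZ0⟩ := h.initial_le x0
  have hV0' : V 0 ≤ ENNReal.ofReal (β * Ψ ^ 2) := by
    simp only [hV, hS, run, lintegral_const, measure_univ, mul_one]
    exact ENNReal.ofReal_le_ofReal hV0
  have hZ0' : Z 0 ≤ ENNReal.ofReal (Ψ ^ 2) := by
    simp only [hZ, hS, run, lintegral_const, measure_univ, mul_one]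
    exact ENNReal.ofReal_le_ofReal hZ0
  have hW0 : W 0 = 0 := h.lintegral_snapGap_run_one hD hlaw hind
  have hwpos := fun k => h.weight_pos k
  have hq0 := fun k => h.snapProb_pos hε k
  have hq1 := fun k => h.snapProb_le_one hε' k
  have hN : 0 ≤ σ ^ 2 / (n : ℝ) := by positivity
  have hAle : ∀ k, A k ≤ ENNReal.ofReal (σ ^ 2 / n) :=
    fun k => h.lintegral_anchorError_run_le hD hlaw hind hn hε hε' k
  have hAne : ∀ k, A k ≠ ⊤ := fun k => ne_top_of_le_ne_top ENNReal.ofReal_ne_top (hAle k)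
  have rR := fun k (hWk : W k ≠ ⊤) => toReal_le_of_le_add zero_le_one (by positivity)
    (hAne k) hWk (h.lintegral_estimate_error_run_le (x0 := x0) hD hlaw hind hb k)
  have rV := fun k (hVk : V k ≠ ⊤) (hRk : R k ≠ ⊤) => toReal_le_of_le_add zero_le_one
    (mul_nonneg (by positivity) (hwpos k).le) hVk hRk
    (h.lintegral_potential_succ (x0 := x0) (Q := Q) hD k)
  -- The decrease of the Lyapunov function also bounds the expected move, so that finiteness
  -- propagates from iteration `k` to iteration `k + 1`.
  have hM_of : ∀ k, V k ≠ ⊤ → R k ≠ ⊤ → V (k + 1) ≠ ⊤ ∧ M (k + 1) ≠ ⊤ := by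
    intro k hVk hRk
    obtain ⟨h1, h2⟩ := ENNReal.add_ne_top.1 (rV k hVk hRk).1
    refine ⟨h1, fun h3 => h2 ?_⟩
    have h4 : ∫⁻ ω, ENNReal.ofReal (moveGap P Fo (run Fo T lam μ r β x0 (fun j => D j ω) (k + 1)))
        ∂Q = ⊤ := h3
    rw [h4, ENNReal.mul_top]
    simpa using mul_pos (hwpos k) hΛ
  have rW := fun k (hWk : W k ≠ ⊤) (hMk : M (k + 1) ≠ ⊤) =>
    toReal_le_of_le_add (by linarith [hq1 (k + 1)]) (div_nonneg zero_le_two (hq0 (k + 1)).le)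
    hWk hMk (h.lintegral_snapGap_run_succ (x0 := x0) hD hlaw hind hε hε' k)
  have hfin : ∀ k, V k ≠ ⊤ ∧ W k ≠ ⊤ := by
    intro k
    induction k with
    | zero => exact ⟨ne_top_of_le_ne_top ENNReal.ofReal_ne_top hV0', by simp [hW0]⟩
    | succ k ih =>
      obtain ⟨h1, h2⟩ := hM_of k ih.1 (rR k ih.2).1
      exact ⟨h1, (rW k ih.2 h2).1⟩
  have hVfin := fun k => (hfin k).1
  have hWfin := fun k => (hfin k).2
  have hRfin : ∀ k, R k ≠ ⊤ := fun k => (rR k (hWfin k)).1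
  have hMfin : ∀ k, M (k + 1) ≠ ⊤ := fun k => (hM_of k (hVfin k) (hRfin k)).2
  have hspos : ∀ k, 0 < tSeq μ r k - μ := fun k => by linarith [h.lt_tSeq k]
  have hθ : ∀ k, 0 ≤ μ / 2 / (tSeq μ r k - μ) := fun k => div_nonneg (by positivity) (hspos k).le
  have hθ1 : ∀ k, μ / 2 / (tSeq μ r k - μ) ≤ 1 := fun k => by
    rw [div_le_one (hspos k)]; linarith [h.lt_tSeq k]
  have rZ : ∀ k, Z k ≠ ⊤ → Z (k + 1) ≠ ⊤ ∧ (Z (k + 1)).toReal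
      ≤ (1 - μ / 2 / (tSeq μ r k - μ)) * (Z k).toReal
        + μ / 2 / (tSeq μ r k - μ) * ((V k).toReal / β)
        + 1 / 4 * weight μ r k * (R k).toReal := by
    intro k hZk
    obtain ⟨h1, h2⟩ := toReal_le_of_le_add (sub_nonneg.2 (hθ1 k)) (div_nonneg (hθ k) hβ.le) hZk
      (hVfin k) le_rfl
    obtain ⟨h3, h4⟩ := toReal_le_of_le_add zero_le_one
      (mul_nonneg (by norm_num) (hwpos k).le) h1 (hRfin k)
      (h.lintegral_energy_succ (x0 := x0) (Q := Q) hD k)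
    refine ⟨h3, h4.trans ?_⟩
    rw [one_mul, mul_div_assoc', ← div_mul_eq_mul_div]
    exact add_le_add_left h2 _
  have hZfin : ∀ k, Z k ≠ ⊤ := by
    intro k
    induction k with
    | zero => exact ne_top_of_le_ne_top ENNReal.ofReal_ne_top hZ0'
    | succ k ih => exact (rZ k ih).1
  have hΨ2 : 0 ≤ β * Ψ ^ 2 := by positivity
  have hmain := lyapunov_sum_le (w := weight μ r) (m := fun k => (M k).toReal)
    (e := fun k => (R k).toReal) (v := fun k => (V k).toReal) (z := fun k => (Z k).toReal)
    (θ := fun k => μ / 2 / (tSeq μ r k - μ)) (N := σ ^ 2 / n) (Ψ := Ψ)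
    (c := 1 / b * (1 / ε ^ 2)) hβ hμ h.μ_lt hΛ hN (fun k => (hwpos k).le)
    (fun k => ENNReal.toReal_nonneg) hθ hθ1 hbε
    (fun k => by
      have h1 := (rV k (hVfin k) (hRfin k)).2
      rw [ENNReal.toReal_add (hVfin (k + 1))
        (ENNReal.mul_ne_top ENNReal.ofReal_ne_top (hMfin k)), ENNReal.toReal_mul,
        ENNReal.toReal_ofReal (mul_pos (hwpos k) hΛ).le, one_mul] at h1
      exact h1)
    (fun k => (rZ k (hZfin k)).2) (fun k => ENNReal.toReal_nonneg)
    (fun K => by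
      have h1 := sum_snapshot_le (w := weight μ r) (ω := fun k => (W k).toReal)
        (m := fun k => (M k).toReal) (q := snapProb μ r ε) hε (fun k => (hwpos k).le)
        (fun k => ENNReal.toReal_nonneg) (fun k => ENNReal.toReal_nonneg) (by simp [hW0])
        (fun k => (rW k (hWfin k) (hMfin k)).2) (fun k => h.weight_succ_mul_le hε k)
        (fun k => h.weight_succ_mul_div_le hε (h.ε_lt_half hε') k) K
      have h2 : ∀ k, (R k).toReal ≤ σ ^ 2 / n + 1 / b * (W k).toReal := by
        intro k
        refine (rR k (hWfin k)).2.trans ?_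
        rw [one_mul]
        refine add_le_add_left ?_ _
        have := ENNReal.toReal_mono ENNReal.ofReal_ne_top (hAle k)
        rwa [ENNReal.toReal_ofReal hN] at this
      calc ∑ j ∈ Finset.range K, weight μ r j * (R j).toReal
          ≤ ∑ j ∈ Finset.range K, weight μ r j * (σ ^ 2 / n + 1 / b * (W j).toReal) :=
            Finset.sum_le_sum fun j _ => mul_le_mul_of_nonneg_left (h2 j) (hwpos j).le
        _ = σ ^ 2 / n * ∑ j ∈ Finset.range K, weight μ r j
            + 1 / b * ∑ j ∈ Finset.range K, weight μ r j * (W j).toReal := by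
            rw [Finset.mul_sum, Finset.mul_sum, ← Finset.sum_add_distrib]
            exact Finset.sum_congr rfl fun j _ => by ring
        _ ≤ _ := by
            rw [mul_assoc (1 / (b : ℝ))]
            gcongr)
    (by
      have := ENNReal.toReal_mono ENNReal.ofReal_ne_top hV0'
      rwa [ENNReal.toReal_ofReal hΨ2] at this)
    (by
      have := ENNReal.toReal_mono ENNReal.ofReal_ne_top hZ0'
      rwa [ENNReal.toReal_ofReal (sq_nonneg _)] at this) K
  have hsum := h.sum_weight_le K
  have hs := hspos K
  set s := tSeq μ r K - μ with hs'
  -- the residual is controlled pointwise by the two Lyapunov functions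
  have hpt : ∀ ω, ENNReal.ofReal (‖fbsResidual lam F T (S K ω).x‖ ^ 2)
      ≤ ENNReal.ofReal (2 / s ^ 2 * stateEnergy xstar μ r β K (S K ω)
        + 2 / (β * s ^ 2) * statePotential F T xstar lam μ r β K (S K ω)) := by
    intro ω
    refine ENNReal.ofReal_le_ofReal ?_
    have h1 := h.sq_norm_residual_le_state K (S K ω)
    have h2 : 2 / s ^ 2 * stateEnergy xstar μ r β K (S K ω)
        + 2 / (β * s ^ 2) * statePotential F T xstar lam μ r β K (S K ω)
        = (2 * (β * stateEnergy xstar μ r β K (S K ω))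
          + 2 * statePotential F T xstar lam μ r β K (S K ω)) / (β * s ^ 2) := by
      field_simp
    rw [h2, le_div_iff₀ (by positivity)]
    linarith
  have h1 : 0 ≤ 2 / s ^ 2 := by positivity
  have h2 : 0 ≤ 2 / (β * s ^ 2) := by positivity
  refine (lintegral_mono hpt).trans ?_
  rw [lintegral_ofReal_add_mul (X := fun ω => stateEnergy xstar μ r β K (S K ω))
    (Y := fun ω => statePotential F T xstar lam μ r β K (S K ω))
    ((measurable_stateEnergy xstar μ r β K).comp (h.measurable_run hD K))
    (fun ω => h.stateEnergy_nonneg K _)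
    (fun ω => h.statePotential_nonneg K _) h1 h2]
  have e1 : ENNReal.ofReal (2 / s ^ 2) * Z K + ENNReal.ofReal (2 / (β * s ^ 2)) * V K
      = ENNReal.ofReal (2 / s ^ 2 * (Z K).toReal + 2 / (β * s ^ 2) * (V K).toReal) := by
    rw [ENNReal.ofReal_add (mul_nonneg h1 ENNReal.toReal_nonneg)
      (mul_nonneg h2 ENNReal.toReal_nonneg), ENNReal.ofReal_mul h1, ENNReal.ofReal_mul h2,
      ENNReal.ofReal_toReal (hZfin K), ENNReal.ofReal_toReal (hVfin K)]
  refine (le_of_eq e1).trans (ENNReal.ofReal_le_ofReal ?_)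
  have h3 : 2 / s ^ 2 * (Z K).toReal + 2 / (β * s ^ 2) * (V K).toReal
      = (2 * (β * (Z K).toReal) + 2 * (V K).toReal) / β / s ^ 2 := by field_simp
  rw [h3]
  refine div_le_div_of_nonneg_right ?_ (by positivity)
  rw [div_le_iff₀ hβ]
  refine hmain.trans ((mul_le_mul_of_nonneg_left ?_ hβ.le).trans_eq (mul_comm _ _))
  gcongr

end Setting

/-! ### The expected number of calls -/

section calls

variable {p : ℕ} {Ξ : Type*} {Fo : Vec p → Ξ → Vec p} {T : Vec p → Set (Vec p)}
  {lam μ r β : ℝ} {x0 : Vec p} {b n : ℕ}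

/-- The number of calls made by iteration `k` when its coin shows `c`. -/
def iterationCalls (b n k : ℕ) (c : Bool) : ℕ :=
  (if decide (k = 0) || c then n else 0) + (2 * b + 1)

lemma calls_run (d : ℕ → Draw Ξ b n) (K : ℕ) :
    (run Fo T lam μ r β x0 d K).calls
      = ∑ k ∈ Finset.range K, iterationCalls b n k (d k).2.2 := by
  induction K with
  | zero => rfl
  | succ K ih => rw [Finset.sum_range_succ, ← ih]; simp only [run, step, iterationCalls]; ring

lemma integral_coinLaw {q : ℝ} (hq : 0 ≤ q) (hq1 : q ≤ 1) (f : Bool → ℝ) :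
    ∫ c, f c ∂(coinLaw q) = q * f true + (1 - q) * f false := by
  rw [coinLaw, integral_add_measure (.smul_measure .of_finite ENNReal.ofReal_ne_top)
    (.smul_measure .of_finite ENNReal.ofReal_ne_top), integral_smul_measure,
    integral_smul_measure, integral_dirac, integral_dirac, ENNReal.toReal_ofReal hq,
    ENNReal.toReal_ofReal (sub_nonneg.2 hq1), smul_eq_mul, smul_eq_mul]

variable [MeasurableSpace Ξ] {P : Measure Ξ} [IsProbabilityMeasure P]

lemma map_coin_drawLaw (q : ℝ) :
    (drawLaw P b n q).map (fun d : Draw Ξ b n => d.2.2) = coinLaw q := by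
  have h1 : (drawLaw P b n q).map Prod.snd
      = (Measure.pi fun _ : Fin n => P).prod (coinLaw q) := Measure.snd_prod
  have h2 : ((Measure.pi fun _ : Fin n => P).prod (coinLaw q)).map Prod.snd = coinLaw q :=
    Measure.snd_prod
  rw [← h2, ← h1, Measure.map_map measurable_snd measurable_snd]
  rfl

variable {Ω : Type*} [MeasurableSpace Ω] {Q : Measure Ω}
  {D : ℕ → Ω → Draw Ξ b n} (hD : ∀ k, Measurable (D k)) {q : ℕ → ℝ}
include hD

lemma integrable_iterationCalls [IsProbabilityMeasure Q] (k : ℕ) :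
    Integrable (fun ω => (iterationCalls b n k (D k ω).2.2 : ℝ)) Q := by
  have h1 : Measurable fun ω => (iterationCalls b n k (D k ω).2.2 : ℝ) :=
    (measurable_of_finite fun c : Bool => (iterationCalls b n k c : ℝ)).comp (hD k).snd.snd
  refine Integrable.of_bound h1.aestronglyMeasurable (n + (2 * b + 1)) (.of_forall fun ω => ?_)
  rw [Real.norm_natCast]
  have : iterationCalls b n k (D k ω).2.2 ≤ n + (2 * b + 1) := by
    unfold iterationCalls
    split_ifs <;> omega
  exact_mod_cast this

lemma integrable_calls [IsProbabilityMeasure Q] (K : ℕ) :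
    Integrable (fun ω => ((run Fo T lam μ r β x0 (fun k => D k ω) K).calls : ℝ)) Q := by
  simp only [calls_run, Nat.cast_sum]
  exact integrable_finsetSum _ fun k _ => integrable_iterationCalls hD k

/-- Iteration `0` always evaluates a mega-batch; later ones do so with probability `q k`. -/
lemma integral_iterationCalls_le (hlaw : ∀ k, Q.map (D k) = drawLaw P b n (q k))
    (hq0 : ∀ k, 0 ≤ q k) (hq1 : ∀ k, q k ≤ 1) (k : ℕ) :
    ∫ ω, (iterationCalls b n k (D k ω).2.2 : ℝ) ∂Q
      ≤ (if k = 0 then (n : ℝ) else 0) + n * q k + (2 * b + 1) := by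
  have h1 : Q.map (fun ω => (D k ω).2.2) = coinLaw (q k) := by
    rw [← map_coin_drawLaw (P := P) (b := b) (n := n), ← hlaw k,
      Measure.map_map (by fun_prop) (hD k)]
    rfl
  have h2 := integral_map (μ := Q) (hD k).snd.snd.aemeasurable
    (f := fun c : Bool => (iterationCalls b n k c : ℝ))
    (measurable_of_finite _).aestronglyMeasurable
  rw [← h2, h1, integral_coinLaw (hq0 k) (hq1 k)]
  have hn : (0 : ℝ) ≤ n := Nat.cast_nonneg n
  have := mul_nonneg hn (hq0 k)
  unfold iterationCalls
  by_cases hk : k = 0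
  · simp [hk] at this ⊢
    linarith
  · simp [hk]
    linarith

lemma integral_calls_le [IsProbabilityMeasure Q] (hlaw : ∀ k, Q.map (D k) = drawLaw P b n (q k))
    (hq0 : ∀ k, 0 ≤ q k) (hq1 : ∀ k, q k ≤ 1) {ε : ℝ}
    (hq : ∀ k, q k ≤ 2 * ε + 4 * ((k + 1 : ℕ) : ℝ)⁻¹) (K : ℕ) :
    ∫ ω, ((run Fo T lam μ r β x0 (fun k => D k ω) K).calls : ℝ) ∂Q
      ≤ n * (1 + 2 * (ε * K) + 4 * (1 + Real.log K)) + (2 * b + 1) * K := by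
  simp only [calls_run, Nat.cast_sum]
  rw [integral_finsetSum _ fun k _ => integrable_iterationCalls hD k]
  have hn : (0 : ℝ) ≤ n := Nat.cast_nonneg n
  have h1 : ∑ k ∈ Finset.range K, (if k = 0 then (n : ℝ) else 0) ≤ n := by
    rw [Finset.sum_ite_eq']
    split_ifs
    exacts [le_rfl, hn]
  have h2 : ∑ k ∈ Finset.range K, ((k + 1 : ℕ) : ℝ)⁻¹ ≤ 1 + Real.log K := by
    have := harmonic_le_one_add_log K
    rw [harmonic] at this
    push_cast at this ⊢
    exact this
  calc _ ≤ ∑ k ∈ Finset.range K, ((if k = 0 then (n : ℝ) else 0)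
        + n * (2 * ε + 4 * ((k + 1 : ℕ) : ℝ)⁻¹) + (2 * b + 1)) := by
        refine Finset.sum_le_sum fun k _ =>
          (integral_iterationCalls_le hD hlaw hq0 hq1 k).trans ?_
        have := hq k
        gcongr
    _ = ∑ k ∈ Finset.range K, (if k = 0 then (n : ℝ) else 0)
        + n * (2 * (ε * K) + 4 * ∑ k ∈ Finset.range K, ((k + 1 : ℕ) : ℝ)⁻¹)
        + (2 * b + 1) * K := by
        rw [Finset.sum_add_distrib, Finset.sum_add_distrib, ← Finset.mul_sum,
          Finset.sum_add_distrib, ← Finset.mul_sum _ _ (4 : ℝ)]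
        simp only [Finset.sum_const, Finset.card_range, nsmul_eq_mul]
        ring
    _ ≤ n + n * (2 * (ε * K) + 4 * (1 + Real.log K)) + (2 * b + 1) * K := by gcongr
    _ = _ := by ring

end calls

/-! ### Batch sizes and the number of iterations -/

lemma half_le_floor {x : ℝ} (hx : 1 ≤ ⌊x⌋₊) : x / 2 ≤ ⌊x⌋₊ := by
  have h1 := Nat.lt_floor_add_one x
  have h2 : (1 : ℝ) ≤ ⌊x⌋₊ := by exact_mod_cast hx
  linarith

/-- If the initial point is not yet accurate, some number of iterations makes `t_K - μ`
comparable with `Ψ / ε`. -/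
lemma exists_iterations {μ r ε Ψ : ℝ} (hμ : 0 < μ) (hr : 2 ≤ r) (hε : 0 < ε)
    (hΨ : μ * r * ε < Ψ) :
    ∃ K : ℕ, 1 ≤ K ∧ 3 * Ψ ≤ ε * (tSeq μ r K - μ) ∧ ε * (tSeq μ r K - μ) ≤ 4 * Ψ ∧
      ε * K ≤ 4 * Ψ / μ := by
  have hμε : 0 < μ * ε := mul_pos hμ hε
  have ha : 3 * Ψ = μ * ε * (3 * Ψ / (μ * ε)) := by field_simp
  set a := 3 * Ψ / (μ * ε)
  have har : 3 * r ≤ a := by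
    have : μ * ε * (3 * r) ≤ μ * ε * a := by rw [← ha]; linarith
    exact le_of_mul_le_mul_left this hμε
  have h1 := Nat.le_ceil (a - r)
  have h2 := Nat.ceil_lt_add_one (show 0 ≤ a - r by linarith)
  have hs : tSeq μ r (⌈a - r⌉₊ + 1) - μ = μ * (⌈a - r⌉₊ + r) := by
    rw [tSeq]; push_cast; ring
  set m : ℝ := (⌈a - r⌉₊ : ℝ) with hm
  have h3 : μ * ε ≤ μ * r * ε := by nlinarith
  refine ⟨⌈a - r⌉₊ + 1, by omega, ?_, ?_, ?_⟩
  · rw [hs, ha]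
    nlinarith
  · rw [hs]
    nlinarith
  · rw [le_div_iff₀ hμ]
    push_cast
    rw [← hm]
    nlinarith

/-- The bound on the squared residual is at most `ε ^ 2` once `t_K - μ` is between `3 Ψ / ε` and
`4 Ψ / ε`. -/
lemma accuracy_le {μ ε Ψ s N : ℝ} (hμ : 0 < μ) (hε : 0 < ε) (hΨ : 0 < Ψ)
    (h3 : 3 * Ψ ≤ ε * s) (h4 : ε * s ≤ 4 * Ψ)
    (hN : N * (12 * Real.sqrt 2 * Ψ) ≤ ε ^ 3 * μ ^ 2) (hN0 : 0 ≤ N) :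
    (4 * Ψ ^ 2 + 8 / μ * (N * (s ^ 3 / (3 * μ)))) / s ^ 2 ≤ ε ^ 2 := by
  have hs : 0 < s := by
    by_contra hs
    have : ε * s ≤ 0 := mul_nonpos_of_nonneg_of_nonpos hε.le (not_lt.1 hs)
    linarith
  have h2 : (7 : ℝ) / 5 ≤ Real.sqrt 2 := Real.le_sqrt_of_sq_le (by norm_num)
  have hN' : N * Ψ ≤ 5 / 84 * (ε ^ 3 * μ ^ 2) := by
    have : N * (12 * (7 / 5) * Ψ) ≤ N * (12 * Real.sqrt 2 * Ψ) := by gcongr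
    linarith
  have hcub : 4 * Ψ ^ 3 + 10 / 63 * (ε * s) ^ 3 ≤ Ψ * (ε * s) ^ 2 := by
    set u := ε * s
    have h5 : 0 ≤ (u - 3 * Ψ) * (4 * Ψ - u) := mul_nonneg (by linarith) (by linarith)
    have h6 := mul_nonneg (show 0 ≤ u by linarith) h5
    have h7 := mul_nonneg hΨ.le h5
    have h8 := mul_nonneg (sq_nonneg Ψ) (sub_nonneg.2 h3)
    nlinarith [pow_pos hΨ 3]
  rw [div_le_iff₀ (by positivity)]
  refine le_of_mul_le_mul_left ?_ hΨ
  have h6 : Ψ * (8 / μ * (N * (s ^ 3 / (3 * μ)))) ≤ 10 / 63 * (ε * s) ^ 3 := by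
    calc _ = 8 / 3 * (s ^ 3 / μ ^ 2) * (N * Ψ) := by field_simp
      _ ≤ 8 / 3 * (s ^ 3 / μ ^ 2) * (5 / 84 * (ε ^ 3 * μ ^ 2)) := by gcongr
      _ = _ := by field_simp; norm_num
  nlinarith

/-- The number of calls is dominated by the mega-batches, of size of order `ε⁻³`, which are
evaluated about `log ε⁻¹` times. -/
lemma calls_bound_le {ε c c' M n b K : ℝ} (hε : 0 < ε) (hε1 : ε < 1) (hc : 0 ≤ c) (hc' : 0 ≤ c')
    (hn : n ≤ c / ε ^ 3) (hb : b ≤ c' / ε ^ 2) (hK : 1 ≤ K) (hKM : ε * K ≤ M) :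
    n * (1 + 2 * (ε * K) + 4 * (1 + Real.log K)) + (2 * b + 1) * K
      ≤ (c * (5 + 2 * M + 4 * |Real.log M|) + (2 * c' + 1) * M)
        * (ε⁻¹ ^ 3 + ε⁻¹ ^ 3 * Real.log ε⁻¹) := by
  have hK0 : 0 < K := by linarith
  have hM : 0 < M := (mul_pos hε hK0).trans_le hKM
  have hl : 0 < Real.log ε⁻¹ := Real.log_pos ((one_lt_inv₀ hε).2 hε1)
  have hlogK : Real.log K ≤ |Real.log M| + Real.log ε⁻¹ := by
    have h1 : K ≤ M * ε⁻¹ := by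
      rw [← div_eq_mul_inv, le_div_iff₀ hε]; linarith
    have h2 := Real.log_le_log hK0 h1
    rw [Real.log_mul hM.ne' (inv_pos.2 hε).ne'] at h2
    linarith [le_abs_self (Real.log M)]
  have hlogK0 : 0 ≤ Real.log K := Real.log_nonneg hK
  set ℓ := Real.log ε⁻¹
  set A := |Real.log M| with hA
  have hA0 : 0 ≤ A := abs_nonneg _
  have hε' : 1 ≤ ε⁻¹ := ((one_lt_inv₀ hε).2 hε1).le
  have hn' : n ≤ c * ε⁻¹ ^ 3 := by rwa [inv_pow, ← div_eq_mul_inv]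
  have hb' : b ≤ c' * ε⁻¹ ^ 2 := by rwa [inv_pow, ← div_eq_mul_inv]
  have hKε : K ≤ M * ε⁻¹ := by
    rw [← div_eq_mul_inv, le_div_iff₀ hε]; linarith
  have e1 : n * (1 + 2 * (ε * K) + 4 * (1 + Real.log K))
      ≤ c * ε⁻¹ ^ 3 * (1 + 2 * M + 4 * (1 + (A + ℓ))) := by gcongr
  have e2 : (2 * b + 1) * K ≤ (2 * (c' * ε⁻¹ ^ 2) + 1) * (M * ε⁻¹) := by
    have : 2 * b + 1 ≤ 2 * (c' * ε⁻¹ ^ 2) + 1 := by linarith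
    exact mul_le_mul this hKε hK0.le (by positivity)
  have e3 : ε⁻¹ ≤ ε⁻¹ ^ 3 := le_self_pow₀ hε' (by norm_num)
  have e4 : M * ε⁻¹ ≤ M * ε⁻¹ ^ 3 := by gcongr
  have e5 : 0 ≤ ε⁻¹ ^ 3 * ℓ := by positivity
  have e6 : 0 ≤ (c * (1 + 2 * M + 4 * A) + (2 * c' + 1) * M) * (ε⁻¹ ^ 3 * ℓ) := by positivity
  nlinarith

namespace Setting

variable {p : ℕ} {Ξ : Type*} [MeasurableSpace Ξ] {L Lhat ρ lam μ r β σ : ℝ}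
  {P : Measure Ξ} {F : Vec p → Vec p} {Fo : Vec p → Ξ → Vec p} {T : Vec p → Set (Vec p)}
  {xstar : Vec p} (h : Setting L Lhat ρ lam μ r β σ P F Fo T xstar)
include h

lemma five_lt : 5 < r := by
  have h1 := h.lt_r
  have h2 := one_div_pos.2 h.μ_pos
  linarith

/-- The form of the snapshot probability whose sum is a harmonic sum. -/
lemma snapProb_le (ε : ℝ) (k : ℕ) : snapProb μ r ε k ≤ 2 * ε + 4 * ((k + 1 : ℕ) : ℝ)⁻¹ := by
  have h1 := h.lt_tSeq 0
  have hμ := h.μ_pos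
  have h2 : μ * ((k + 1 : ℕ) : ℝ) ≤ tSeq μ r k - μ - 1 := by
    simp only [tSeq] at h1 ⊢
    push_cast at h1 ⊢
    linarith
  rw [snapProb_eq]
  gcongr
  calc 4 * μ / (tSeq μ r k - μ - 1) ≤ 4 * μ / (μ * ((k + 1 : ℕ) : ℝ)) := by gcongr
    _ = _ := by field_simp

/-- The size of the mini-batch lets the decrease of the Lyapunov function absorb the snapshot
gaps. -/
lemma one_div_miniBatch_le {ε : ℝ} (hε : 0 < ε) {b : ℕ} (hb : 1 ≤ b)
    (hbdef : b = ⌊cb L Lhat μ β / ε ^ 2⌋₊) :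
    1 / (b : ℝ) * (1 / ε ^ 2) ≤ μ * Lam L Lhat / (5 * β) := by
  have hμ := h.μ_pos
  have hβ := h.β_pos
  have hΛ := h.Lam_pos
  have h1 := half_le_floor (hbdef ▸ hb)
  rw [← hbdef, cb] at h1
  have hb0 : (0 : ℝ) < b := by exact_mod_cast hb
  rw [div_mul_div_comm, one_mul, div_le_div_iff₀ (by positivity) (by positivity)]
  have h2 : 10 * β / (μ * Lam L Lhat) / ε ^ 2 / 2 = 5 * β / (μ * Lam L Lhat * ε ^ 2) := by
    field_simp; norm_num
  rw [h2, div_le_iff₀ (by positivity)] at h1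
  linarith

/-- An accurate initial point has a small residual. -/
lemma sq_norm_residual_le_of_psi0_le {ε : ℝ} {x0 : Vec p} (hε : 0 < ε)
    (hΨ : psi0 F T lam μ r β x0 xstar ≤ μ * r * ε) : ‖fbsResidual lam F T x0‖ ^ 2 ≤ ε ^ 2 := by
  have hμ := h.μ_pos
  have hr := h.five_lt
  have h1 : 0 < μ * r - 1 := by
    have := h.lt_tSeq 0
    simp only [tSeq, Nat.cast_zero, zero_add] at this
    linarith
  have h2 : 0 ≤ (2 * r - 1) / (4 * β ^ 2 * (μ * r - 1)) * ‖x0 - xstar‖ ^ 2 :=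
    mul_nonneg (div_nonneg (by linarith) (by positivity)) (sq_nonneg _)
  rw [psi0, Real.sqrt_le_left (by positivity)] at hΨ
  have h3 : (μ * r) ^ 2 * ‖fbsResidual lam F T x0‖ ^ 2 ≤ (μ * r) ^ 2 * ε ^ 2 := by nlinarith
  exact le_of_mul_le_mul_left h3 (by positivity)

end Setting

/-- The size of the mega-batch, including the second entry of the maximum in `cn`, makes the noise
summed over about `Ψ / ε` iterations comparable with the initial error. -/
lemma megaBatch_error_le {σ μ Ψ ε : ℝ} (hε : 0 < ε) (hμ : 0 < μ) {n : ℕ}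
    (hn : 1 ≤ n) (hndef : n = ⌊cn σ μ Ψ / ε ^ 3⌋₊) :
    σ ^ 2 / n * (12 * Real.sqrt 2 * Ψ) ≤ ε ^ 3 * μ ^ 2 := by
  have h1 := half_le_floor (hndef ▸ hn)
  rw [← hndef, cn] at h1
  have hn0 : (0 : ℝ) < n := by exact_mod_cast hn
  have h2 := le_max_right 1 (2 * Real.sqrt 2 * Ψ / μ ^ 2)
  set M := max 1 (2 * Real.sqrt 2 * Ψ / μ ^ 2)
  rw [div_le_iff₀ (by positivity)] at h2
  rw [div_div, div_le_iff₀ (by positivity)] at h1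
  rw [div_mul_eq_mul_div, div_le_iff₀ hn0]
  calc σ ^ 2 * (12 * Real.sqrt 2 * Ψ) = 6 * σ ^ 2 * (2 * Real.sqrt 2 * Ψ) := by ring
    _ ≤ 6 * σ ^ 2 * (M * μ ^ 2) := by gcongr
    _ = 12 * σ ^ 2 * M / 2 * μ ^ 2 := by ring
    _ ≤ n * (ε ^ 3 * 2) / 2 * μ ^ 2 := by gcongr
    _ = _ := by ring

end VFOSA

theorem mainTheorem10
    (L Lhat ρ lam μ r β σ Ψ : ℝ)
    (hL : 0 < L) (hLhat : L < Lhat) (hρ : 0 ≤ ρ) (hLhatρ : Lhat * ρ < 1)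
    (hlam_pos : 0 < lam) (hlam_ge : 2 * ρ ≤ lam)
    (hlam_lt : lam < 2 * (1 + Real.sqrt (1 - Lhat * ρ)) / Lhat)
    (hμ_pos : 0 < μ) (hμ_lt : μ < 2 / 3)
    (hr : 5 + 1 / μ < r)
    (hβ_pos : 0 < β) (hβ_le : β ≤ (2 - μ) * VFOSA.betaBar Lhat ρ lam / (2 + μ))
    (hσ : 0 ≤ σ) :
    ∃ C : ℝ,
      ∀ (p : ℕ) (Ξ : Type*) [MeasurableSpace Ξ] (P : Measure Ξ) [IsProbabilityMeasure P]
        (F : VFOSA.Vec p → VFOSA.Vec p) (Fo : VFOSA.Vec p → Ξ → VFOSA.Vec p)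
        (T : VFOSA.Vec p → Set (VFOSA.Vec p)) (x0 xstar : VFOSA.Vec p),
        VFOSA.IsUnbiasedOracle P F Fo σ →
        VFOSA.CocoerciveInExpectation P F Fo L →
        VFOSA.MaximallyCoHypomonotone ρ T →
        (T x0).Nonempty →
        xstar ∈ VFOSA.zer F T →
        VFOSA.psi0 F T lam μ r β x0 xstar = Ψ →
        ∀ (ε : ℝ) (b n : ℕ),
          0 < ε →
          ε ≤ (μ * (r - 5) - 1) / (2 * μ * (r - 1) - 2) →
          b = ⌊VFOSA.cb L Lhat μ β / ε ^ 2⌋₊ → 1 ≤ b →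
          n = ⌊VFOSA.cn σ μ Ψ / ε ^ 3⌋₊ → 1 ≤ n →
          ∃ K : ℕ,
            ∀ (Ω : Type*) [MeasurableSpace Ω] (Q : Measure Ω) [IsProbabilityMeasure Q]
              (D : ℕ → Ω → VFOSA.Draw Ξ b n),
              (∀ k, Measurable (D k)) →
              (∀ k, Q.map (D k) = VFOSA.drawLaw P b n (VFOSA.snapProb μ r ε k)) →
              iIndepFun D Q →
              Integrable (fun ω =>
                ‖VFOSA.fbsResidual lam F T
                  (VFOSA.run Fo T lam μ r β x0 (fun k => D k ω) K).x‖ ^ 2) Q ∧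
              ∫ ω, ‖VFOSA.fbsResidual lam F T
                  (VFOSA.run Fo T lam μ r β x0 (fun k => D k ω) K).x‖ ^ 2 ∂Q ≤ ε ^ 2 ∧
              Integrable (fun ω =>
                ((VFOSA.run Fo T lam μ r β x0 (fun k => D k ω) K).calls : ℝ)) Q ∧
              ∫ ω, ((VFOSA.run Fo T lam μ r β x0 (fun k => D k ω) K).calls : ℝ) ∂Q
                ≤ C * (ε⁻¹ ^ 3 + ε⁻¹ ^ 3 * Real.log ε⁻¹) := by
  -- `4 Ψ / μ` bounds `ε K`.
  refine ⟨VFOSA.cn σ μ Ψ * (5 + 2 * (4 * Ψ / μ) + 4 * |Real.log (4 * Ψ / μ)|)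
    + (2 * VFOSA.cb L Lhat μ β + 1) * (4 * Ψ / μ), ?_⟩
  intro p Ξ _ P _ F Fo T x0 xstar hFo hco hT _ hxstar hpsi ε b n hε hε' hb hb1 hn hn1
  have h : VFOSA.Setting L Lhat ρ lam μ r β σ P F Fo T xstar :=
    ⟨hL, hLhat, hLhatρ, hlam_pos, hlam_ge, hμ_pos, hμ_lt, hr, hβ_pos, hβ_le, hFo, hco, hT, hxstar⟩
  have hΨ : 0 ≤ Ψ := hpsi ▸ Real.sqrt_nonneg _
  have hε1 : ε < 1 := (h.ε_lt_half hε').trans (by norm_num)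
  have hcb : 0 ≤ VFOSA.cb L Lhat μ β :=
    div_nonneg (by positivity) (mul_pos hμ_pos h.Lam_pos).le
  have hcn : 0 ≤ VFOSA.cn σ μ Ψ :=
    mul_nonneg (by positivity) (zero_le_one.trans (le_max_left _ _))
  -- If `Ψ` is small, the initial point is accurate enough.
  by_cases hcase : Ψ ≤ μ * r * ε
  · refine ⟨0, fun Ω _ Q _ D hD _ _ => ⟨integrable_const (‖VFOSA.fbsResidual lam F T x0‖ ^ 2), ?_,
      VFOSA.integrable_calls hD 0, ?_⟩⟩
    · have h1 := h.sq_norm_residual_le_of_psi0_le (x0 := x0) hε (hpsi ▸ hcase)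
      simpa [VFOSA.run, VFOSA.initState] using h1
    · have h1 : 0 ≤ Real.log ε⁻¹ := Real.log_nonneg ((one_lt_inv₀ hε).2 hε1).le
      simp only [VFOSA.run, VFOSA.initState, Nat.cast_zero, integral_zero]
      positivity
  · rw [not_le] at hcase
    have hr5 := h.five_lt
    have hΨ0 : 0 < Ψ := lt_of_le_of_lt (by positivity) hcase
    obtain ⟨K, hK1, hK3, hK4, hKM⟩ :=
      VFOSA.exists_iterations hμ_pos (by linarith : 2 ≤ r) hε hcase
    refine ⟨K, fun Ω _ Q _ D hD hlaw hind => ?_⟩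
    have hbound := h.lintegral_sq_norm_residual_le (x0 := x0) hε hε' hb1 hn1
      (h.one_div_miniBatch_le hε hb1 hb) hD hlaw hind K
    rw [hpsi] at hbound
    have hacc := VFOSA.accuracy_le hμ_pos hε hΨ0 hK3 hK4
      (VFOSA.megaBatch_error_le hε hμ_pos hn1 hn) (by positivity)
    have hle := hbound.trans (ENNReal.ofReal_le_ofReal hacc)
    have hmeas : Measurable fun ω => ‖VFOSA.fbsResidual lam F T
        (VFOSA.run Fo T lam μ r β x0 (fun k => D k ω) K).x‖ ^ 2 :=
      ((h.continuous_residual.measurable.comp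
        (VFOSA.State.measurable_x.comp (h.measurable_run hD K))).norm).pow_const 2
    have hnn : ∀ ω, 0 ≤ ‖VFOSA.fbsResidual lam F T
        (VFOSA.run Fo T lam μ r β x0 (fun k => D k ω) K).x‖ ^ 2 := fun ω => sq_nonneg _
    refine ⟨⟨hmeas.aestronglyMeasurable, ?_⟩, ?_, VFOSA.integrable_calls hD K, ?_⟩
    · rw [hasFiniteIntegral_iff_ofReal (.of_forall hnn)]
      exact hle.trans_lt ENNReal.ofReal_lt_top
    · rw [integral_eq_lintegral_of_nonneg_ae (.of_forall hnn) hmeas.aestronglyMeasurable]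
      exact ENNReal.toReal_le_of_le_ofReal (sq_nonneg ε) hle
    · refine (VFOSA.integral_calls_le hD hlaw (fun k => (h.snapProb_pos hε k).le)
        (h.snapProb_le_one hε') (h.snapProb_le ε) K).trans ?_
      refine VFOSA.calls_bound_le hε hε1 hcn hcb ?_ ?_ ?_ hKM
      · rw [hn]; exact Nat.floor_le (by positivity)
      · rw [hb]; exact Nat.floor_le (by positivity)
      · exact_mod_cast hK1
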